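/- Let $k$ be an algebraically closed field and let $\mathcal{C}$ be a pivotal finite tensor category over $k$. That is: $\mathcal{C}$ is a $k$-linear abelian category which is $k$-linearly equivalent to the category of finite-dimensional modules over some finite-dimensional $k$-algebra; $\mathcal{C}$ is monoidal with $k$-bilinear tensor product and simple unit $I$; every object has a left and a right dual; and there is a chosen monoidal natural isomorphism $X \cong X^{\vee\vee}$. Here $X^\vee$ denotes the dual of $X$ with evaluation $X^\vee\otimes X\to I$ and coevaluation $I\to X\otimes X^\vee$. Let $\operatorname{Proj}\mathcal{C}\subset\mathcal{C}$ be the full subcategory of projective objects. For a $k$-linear functor $G:\mathcal{C}\to\mathcal{C}$, let $$\int_{\mathbb{L}}^{X\in\operatorname{Proj}\mathcal{C}}\mathcal{C}(G(X),X)$$ be the total complex of the simplicial $k$-vector space with $n$-simplices $$\bigoplus_{X_0,\dots,X_n\in\operatorname{Proj}\mathcal{C}}\mathcal{C}(X_1,X_0)\otimes\dots\otimes\mathcal{C}(X_n,X_{n-1})\otimes\mathcal{C}(G(X_0),X_n),$$ whose inner face maps compose neighbouring morphisms, whose outer face maps let $\mathcal{C}(X_1,X_0)$ (through $G$), respectively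 $\mathcal{C}(X_n,X_{n-1})$, act on the last tensor factor, and whose degeneracy maps insert identities. For $G=\mathrm{id}_{\mathcal{C}}$ this is the Hochschild complex $\int_{\mathbb{L}}^{X\in\operatorname{Proj}\mathcal{C}}\mathcal{C}(X,X)$ of $\mathcal{C}$. **Theorem.** For every exact $k$-linear functor $G:\mathcal{C}\to\mathcal{C}$ the coend $\int^{X\in\mathcal{C}}X\otimes G(X)^\vee$ exists in $\mathcal{C}$, and for an arbitrary projective resolution $\mathsf{Q}\int^{X\in\mathcal{C}}X\otimes G(X)^\vee$ of it there is a canonical equivalence (quasi-isomorphism) of chain complexes of $k$-vector spaces $$\Phi:\int_{\mathbb{L}}^{X\in\operatorname{Proj}\mathcal{C}}\mathcal{C}(G(X),X)\ \xrightarrow{\ \simeq\ }\ \mathcal{C}\Big(I,\mathsf{Q}\int^{X\in\mathcal{C}}X\otimes G(X)^\vee\Big).$$ Canonical means that the maps $\Phi$ can be chosen, simultaneously for all $G$, all choices of the coend and all projective resolutions, such that the following hold. 1. In degree $0$, for every projective object $P$ there is a lift $\ell_P:P\otimes G(P)^\vee\to\mathsf{Q}_0$ of the structure map $P\otimes G(P)^\vee\to\int^{X\in\mathcal{C}}X\otimes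 G(X)^\vee$ such that $\Phi$ sends each $h\in\mathcal{C}(G(P),P)$ to $\ell_P\circ\tilde h$, where $\tilde h:I\to P\otimes G(P)^\vee$ corresponds to $h$ by duality. 2. $\Phi$ is natural up to chain homotopy: let $\alpha:G'\to G$ be a natural transformation between exact $k$-linear endofunctors, and let $\varphi$ be a chain map from a projective resolution of the coend for $G$ to one of the coend for $G'$ that lifts the map of coends induced by the morphisms $\mathrm{id}_X\otimes\alpha_X^\vee$. Then the square formed by the two maps $\Phi$, by precomposition with $\alpha$ on the left-hand sides and by $\mathcal{C}(I,\varphi)$ on the right-hand sides commutes up to chain homotopy. In particular, the canonical coend $\mathbb{F}=\int^{X\in\mathcal{C}}X\otimes X^\vee$ exists, and for every projective resolution $\mathsf{Q}\mathbb{F}$ of $\mathbb{F}$ there is an equivalence $$\int_{\mathbb{L}}^{X\in\operatorname{Proj}\mathcal{C}}\mathcal{C}(X,X)\ \simeq\ \mathcal{C}(I,\mathsf{Q}\mathbb{F}).$$ -/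

import Mathlib

open CategoryTheory CategoryTheory.Limits MonoidalCategory Opposite
open scoped TensorProduct

universe w v u t

noncomputable section

/-! ### Strings of composable morphisms -/

section Strings

variable {A : Type u} [Category.{v} A]

/-- Given objects `X 0, …, X n` and morphisms `f i : X (i + 1) ⟶ X i`, the composite
`X b ⟶ X a` of the `f i` with `a ≤ i < b`. -/
def stringComp {n : ℕ} {X : Fin (n + 1) → A} (f : ∀ i : Fin n, X i.succ ⟶ X i.castSucc)
    {a b : Fin (n + 1)} (h : a ≤ b) : X b ⟶ X a :=
  ((ComposableArrows.mkOfObjOfMapSucc (fun i => op (X i)) (fun i => (f i).op)).map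
    (homOfLE h)).unop

section

variable {n : ℕ} {X : Fin (n + 1) → A} (f : ∀ i : Fin n, X i.succ ⟶ X i.castSucc)

theorem stringComp_refl (a : Fin (n + 1)) : stringComp f (le_refl a) = 𝟙 (X a) := by
  exact congrArg Quiver.Hom.unop (CategoryTheory.Functor.map_id
    (ComposableArrows.mkOfObjOfMapSucc (fun i => op (X i)) (fun i => (f i).op)) a)

theorem stringComp_trans {a b c : Fin (n + 1)} (h : a ≤ b) (h' : b ≤ c) :
    stringComp f (h.trans h') = stringComp f h' ≫ stringComp f h := by
  unfold stringComp
  rw [← homOfLE_comp h h', Functor.map_comp]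
  rfl

theorem stringComp_succ (i : Fin n) : stringComp f (Fin.castSucc_le_succ i) = f i := by
  have := ComposableArrows.mkOfObjOfMapSucc_map_succ (fun i => op (X i)) (fun i => (f i).op)
    i.1 i.2
  exact congrArg Quiver.Hom.unop this

/-- Two strings whose morphisms agree between the positions `a` and `b` have the same composite. -/
theorem stringComp_congr (g : ∀ i : Fin n, X i.succ ⟶ X i.castSucc) {a b : Fin (n + 1)}
    (h : a ≤ b) (hfg : ∀ i : Fin n, a ≤ i.castSucc → i.succ ≤ b → f i = g i) :
    stringComp f h = stringComp g h := by
  induction b using Fin.induction with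
  | zero =>
    obtain rfl : a = 0 := Fin.le_zero_iff.mp h
    rw [stringComp_refl, stringComp_refl]
  | succ b ih =>
    rcases h.eq_or_lt with rfl | hlt
    · rw [stringComp_refl, stringComp_refl]
    · have hab : a ≤ b.castSucc := Fin.le_castSucc_iff.mpr hlt
      rw [stringComp_trans f hab (Fin.castSucc_le_succ b),
        stringComp_trans g hab (Fin.castSucc_le_succ b), stringComp_succ, stringComp_succ,
        hfg b hab le_rfl, ih hab (fun i h1 h2 => hfg i h1 (h2.trans (Fin.castSucc_le_succ b)))]

theorem stringComp_update_of_not (j : Fin n) (x : X j.succ ⟶ X j.castSucc) {a b : Fin (n + 1)}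
    (h : a ≤ b) (hj : ¬ (a ≤ j.castSucc ∧ j.succ ≤ b)) :
    stringComp (Function.update f j x) h = stringComp f h := by
  refine stringComp_congr _ _ h (fun i h1 h2 => Function.update_of_ne ?_ _ _)
  rintro rfl
  exact hj ⟨h1, h2⟩

theorem stringComp_update (j : Fin n) (x : X j.succ ⟶ X j.castSucc) {a b : Fin (n + 1)}
    (h1 : a ≤ j.castSucc) (h2 : j.succ ≤ b) :
    stringComp (Function.update f j x) ((h1.trans (Fin.castSucc_le_succ j)).trans h2) =
      stringComp f h2 ≫ x ≫ stringComp f h1 := by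
  rw [stringComp_trans _ (h1.trans (Fin.castSucc_le_succ j)) h2,
    stringComp_trans _ h1 (Fin.castSucc_le_succ j), stringComp_succ, Function.update_self,
    stringComp_update_of_not, stringComp_update_of_not]
  · rintro ⟨-, h⟩
    exact absurd h (not_le.mpr (Fin.castSucc_lt_succ (i := j)))
  · rintro ⟨h, -⟩
    exact absurd h (not_le.mpr (Fin.castSucc_lt_succ (i := j)))

/-- The string of composites obtained by restricting a string along a monotone map. -/
def stringPull {m : ℕ} (θ : Fin (m + 1) →o Fin (n + 1)) (i : Fin m) :
    (X ∘ θ) i.succ ⟶ (X ∘ θ) i.castSucc :=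
  stringComp f (θ.monotone (Fin.castSucc_le_succ i))

theorem stringComp_stringPull {m : ℕ} (θ : Fin (m + 1) →o Fin (n + 1)) {a b : Fin (m + 1)}
    (h : a ≤ b) : stringComp (X := X ∘ θ) (stringPull f θ) h = stringComp f (θ.monotone h) := by
  induction b using Fin.induction with
  | zero =>
    obtain rfl : a = 0 := Fin.le_zero_iff.mp h
    rw [stringComp_refl, stringComp_refl]
    rfl
  | succ b ih =>
    rcases h.eq_or_lt with rfl | hlt
    · rw [stringComp_refl, stringComp_refl]
      rfl
    · have hab : a ≤ b.castSucc := Fin.le_castSucc_iff.mpr hlt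
      rw [stringComp_trans _ hab (Fin.castSucc_le_succ b),
        stringComp_trans f (θ.monotone hab) (θ.monotone (Fin.castSucc_le_succ b)),
        stringComp_succ, ih hab]
      rfl

end

end Strings

/-! ### The simplicial bar construction and the derived coend -/

section Bar

variable {k : Type w} [Field k] {A : Type u} [Category.{v} A]

/-- The two-sided action `F(X, Y) ⟶ F(X', Y')` of morphisms `p : X' ⟶ X` and `q : Y ⟶ Y'`. -/
def bimoduleAct (F : Aᵒᵖ ⥤ A ⥤ ModuleCat.{t} k) {X X' Y Y' : A} (p : X' ⟶ X) (q : Y ⟶ Y') :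
    (F.obj (op X)).obj Y →ₗ[k] (F.obj (op X')).obj Y' :=
  ((F.map p.op).app Y ≫ (F.obj (op X')).map q).hom

theorem bimoduleAct_id (F : Aᵒᵖ ⥤ A ⥤ ModuleCat.{t} k) (X Y : A) :
    bimoduleAct F (𝟙 X) (𝟙 Y) = LinearMap.id := by
  simp [bimoduleAct]

theorem bimoduleAct_comp (F : Aᵒᵖ ⥤ A ⥤ ModuleCat.{t} k) {X X' X'' Y Y' Y'' : A} (p : X' ⟶ X)
    (p' : X'' ⟶ X') (q : Y ⟶ Y') (q' : Y' ⟶ Y'') :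
    bimoduleAct F (p' ≫ p) (q ≫ q') = bimoduleAct F p' q' ∘ₗ bimoduleAct F p q := by
  simp only [bimoduleAct, ← ModuleCat.hom_comp]
  simp

theorem bimoduleAct_naturality {F F' : Aᵒᵖ ⥤ A ⥤ ModuleCat.{t} k} (η : F ⟶ F') {X X' Y Y' : A}
    (p : X' ⟶ X) (q : Y ⟶ Y') :
    ((η.app (op X')).app Y').hom ∘ₗ bimoduleAct F p q =
      bimoduleAct F' p q ∘ₗ ((η.app (op X)).app Y).hom := by
  have h : (F.map p.op).app Y ≫ (η.app (op X')).app Y =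
      (η.app (op X)).app Y ≫ (F'.map p.op).app Y := by
    rw [← NatTrans.comp_app, η.naturality, NatTrans.comp_app]
  simp only [bimoduleAct, ← ModuleCat.hom_comp]
  rw [Category.assoc, (η.app (op X')).naturality, reassoc_of% h]

variable [Preadditive A] [Linear k A]

variable (k) in
/-- A functor `F : Aᵒᵖ ⥤ A ⥤ Vect k` is a linear bimodule if it is `k`-linear in each of its two
variables, i.e. if it is a functor `Aᵒᵖ ⊗ A ⥤ Vect k` enriched over `k`-vector spaces. -/
class IsLinearBimodule (F : Aᵒᵖ ⥤ A ⥤ ModuleCat.{t} k) : Prop where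
  map_add_left : ∀ {X X' : A} (f g : X ⟶ X') (Y : A),
    (F.map (f + g).op).app Y = (F.map f.op).app Y + (F.map g.op).app Y
  map_smul_left : ∀ {X X' : A} (r : k) (f : X ⟶ X') (Y : A),
    (F.map (r • f).op).app Y = r • (F.map f.op).app Y
  map_add_right : ∀ (X : A) {Y Y' : A} (f g : Y ⟶ Y'),
    (F.obj (op X)).map (f + g) = (F.obj (op X)).map f + (F.obj (op X)).map g
  map_smul_right : ∀ (X : A) {Y Y' : A} (r : k) (f : Y ⟶ Y'),
    (F.obj (op X)).map (r • f) = r • (F.obj (op X)).map f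

/-- `bimoduleAct` as a linear map in its first argument. -/
def bimoduleActLeft (F : Aᵒᵖ ⥤ A ⥤ ModuleCat.{t} k) [IsLinearBimodule k F] {X X' Y Y' : A}
    (q : Y ⟶ Y') :
    (X' ⟶ X) →ₗ[k] ((F.obj (op X)).obj Y →ₗ[k] (F.obj (op X')).obj Y') where
  toFun p := bimoduleAct F p q
  map_add' p p' := by
    unfold bimoduleAct
    rw [IsLinearBimodule.map_add_left (k := k), Preadditive.add_comp, ModuleCat.hom_add]
  map_smul' r p := by
    unfold bimoduleAct
    rw [IsLinearBimodule.map_smul_left (k := k), Linear.smul_comp, ModuleCat.hom_smul]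
    rfl

/-- `bimoduleAct` as a linear map in its second argument. -/
def bimoduleActRight (F : Aᵒᵖ ⥤ A ⥤ ModuleCat.{t} k) [IsLinearBimodule k F] {X X' Y Y' : A}
    (p : X' ⟶ X) :
    (Y ⟶ Y') →ₗ[k] ((F.obj (op X)).obj Y →ₗ[k] (F.obj (op X')).obj Y') where
  toFun q := bimoduleAct F p q
  map_add' q q' := by
    unfold bimoduleAct
    rw [IsLinearBimodule.map_add_right (k := k), Preadditive.comp_add, ModuleCat.hom_add]
  map_smul' r q := by
    unfold bimoduleAct
    rw [IsLinearBimodule.map_smul_right (k := k), Linear.comp_smul, ModuleCat.hom_smul]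
    rfl

/-- The summand `A(X₁, X₀) ⊗ ⋯ ⊗ A(Xₙ, Xₙ₋₁) ⊗ F(X₀, Xₙ)` of the bar construction. -/
abbrev BarSummand (F : Aᵒᵖ ⥤ A ⥤ ModuleCat.{t} k) {n : ℕ} (X : Fin (n + 1) → A) :
    Type (max w v t) :=
  (⨂[k] i : Fin n, (X i.succ ⟶ X i.castSucc)) ⊗[k] ((F.obj (op (X 0))).obj (X (Fin.last n)))

/-- The vector space of `n`-simplices of the bar construction: the direct sum of the
`BarSummand F X` over all families `X = (X₀, …, Xₙ)` of objects of `A`. -/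
abbrev BarSimplices (F : Aᵒᵖ ⥤ A ⥤ ModuleCat.{t} k) (n : ℕ) : Type (max u w v t) :=
  DirectSum (Fin (n + 1) → A) (fun X => BarSummand F X)

open Classical in
/-- The element `f₁ ⊗ ⋯ ⊗ fₙ ⊗ x` of the summand of `BarSimplices F n` indexed by `X`. -/
def barElt (F : Aᵒᵖ ⥤ A ⥤ ModuleCat.{t} k) {n : ℕ} (X : Fin (n + 1) → A)
    (f : ∀ i : Fin n, X i.succ ⟶ X i.castSucc) (x : (F.obj (op (X 0))).obj (X (Fin.last n))) :
    BarSimplices F n :=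
  DirectSum.lof k (Fin (n + 1) → A) (fun X => BarSummand F X) X
    (PiTensorProduct.tprod k f ⊗ₜ[k] x)

/-- The effect of the simplicial operator of a monotone map `θ` on a pure tensor
`f₁ ⊗ ⋯ ⊗ fₙ ⊗ x`, as a linear function of `x`: the `f i` are composed according to `θ`, and those
before `θ 0` or after `θ m` act on `x` through the functor `F`. -/
def barOpAux (F : Aᵒᵖ ⥤ A ⥤ ModuleCat.{t} k) {n m : ℕ} (θ : Fin (m + 1) →o Fin (n + 1))
    (X : Fin (n + 1) → A) (f : ∀ i : Fin n, X i.succ ⟶ X i.castSucc) :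
    ((F.obj (op (X 0))).obj (X (Fin.last n))) →ₗ[k] BarSummand F (X ∘ θ) :=
  TensorProduct.mk k _ _ (PiTensorProduct.tprod k (stringPull f θ)) ∘ₗ
    bimoduleAct F (stringComp f (Fin.zero_le (θ 0))) (stringComp f (Fin.le_last (θ (Fin.last m))))

theorem exists_linear_barOpAux_update (F : Aᵒᵖ ⥤ A ⥤ ModuleCat.{t} k) [IsLinearBimodule k F]
    {n m : ℕ} (θ : Fin (m + 1) →o Fin (n + 1)) (X : Fin (n + 1) → A)
    (f : ∀ i : Fin n, X i.succ ⟶ X i.castSucc) (j : Fin n) :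
    ∃ L : (X j.succ ⟶ X j.castSucc) →ₗ[k]
        (((F.obj (op (X 0))).obj (X (Fin.last n))) →ₗ[k] BarSummand F (X ∘ θ)),
      ∀ x, barOpAux F θ X (Function.update f j x) = L x := by
  have hlt : j.castSucc < j.succ := Fin.castSucc_lt_succ
  by_cases h0 : j.succ ≤ θ 0
  · -- the morphism acts on the first variable of `F`
    have hpull : ∀ x, stringPull (Function.update f j x) θ = stringPull f θ := fun x => by
      funext i
      exact stringComp_update_of_not f j x _ (fun h => absurd (hlt.trans_le (h0.trans
        ((θ.monotone (Fin.zero_le _)).trans h.1))) (lt_irrefl _))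
    have hr : ∀ x, stringComp (Function.update f j x) (Fin.le_last (θ (Fin.last m))) =
        stringComp f (Fin.le_last (θ (Fin.last m))) := fun x =>
      stringComp_update_of_not f j x _ (fun h => absurd (hlt.trans_le (h0.trans
        ((θ.monotone (Fin.zero_le _)).trans h.1))) (lt_irrefl _))
    have hl := fun x => stringComp_update f j x (Fin.zero_le _) h0
    refine ⟨LinearMap.llcomp k _ _ _ (TensorProduct.mk k _ _
      (PiTensorProduct.tprod k (stringPull f θ))) ∘ₗ
      bimoduleActLeft F (stringComp f (Fin.le_last (θ (Fin.last m)))) ∘ₗ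
      Linear.leftComp k _ (stringComp f h0) ∘ₗ
      Linear.rightComp k _ (stringComp f (Fin.zero_le j.castSucc)), fun x => ?_⟩
    unfold barOpAux
    rw [hpull x, hr x, hl x]
    rfl
  by_cases h1 : θ (Fin.last m) ≤ j.castSucc
  · -- the morphism acts on the second variable of `F`
    have hpull : ∀ x, stringPull (Function.update f j x) θ = stringPull f θ := fun x => by
      funext i
      exact stringComp_update_of_not f j x _ (fun h => absurd (hlt.trans_le (h.2.trans
        ((θ.monotone (Fin.le_last _)).trans h1))) (lt_irrefl _))
    have hl : ∀ x, stringComp (Function.update f j x) (Fin.zero_le (θ 0)) =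
        stringComp f (Fin.zero_le (θ 0)) := fun x =>
      stringComp_update_of_not f j x _ (fun h => h0 h.2)
    have hr := fun x => stringComp_update f j x h1 (Fin.le_last _)
    refine ⟨LinearMap.llcomp k _ _ _ (TensorProduct.mk k _ _
      (PiTensorProduct.tprod k (stringPull f θ))) ∘ₗ
      bimoduleActRight F (stringComp f (Fin.zero_le (θ 0))) ∘ₗ
      Linear.leftComp k _ (stringComp f (Fin.le_last j.succ)) ∘ₗ
      Linear.rightComp k _ (stringComp f h1), fun x => ?_⟩
    unfold barOpAux
    rw [hpull x, hl x, hr x]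
    rfl
  · -- the morphism enters exactly one of the composites
    have hi : ∃ i : Fin m, θ i.castSucc ≤ j.castSucc ∧ j.succ ≤ θ i.succ := by
      by_contra hcon
      push Not at hcon
      have key : ∀ b : Fin (m + 1), θ b ≤ j.castSucc := by
        intro b
        induction b using Fin.induction with
        | zero => exact Fin.le_castSucc_iff.mpr (not_le.mp h0)
        | succ b ih => exact Fin.le_castSucc_iff.mpr (hcon b ih)
      exact h1 (key _)
    obtain ⟨i, hi1, hi2⟩ := hi
    have hl : ∀ x, stringComp (Function.update f j x) (Fin.zero_le (θ 0)) =
        stringComp f (Fin.zero_le (θ 0)) := fun x =>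
      stringComp_update_of_not f j x _ (fun h => h0 h.2)
    have hr : ∀ x, stringComp (Function.update f j x) (Fin.le_last (θ (Fin.last m))) =
        stringComp f (Fin.le_last (θ (Fin.last m))) := fun x =>
      stringComp_update_of_not f j x _ (fun h => h1 h.1)
    have hpull : ∀ x, stringPull (Function.update f j x) θ =
        Function.update (stringPull f θ) i (stringComp f hi2 ≫ x ≫ stringComp f hi1) := fun x => by
      funext i'
      by_cases hii : i' = i
      · subst hii
        rw [Function.update_self]
        exact stringComp_update f j x hi1 hi2
      · rw [Function.update_of_ne hii]
        refine stringComp_update_of_not f j x _ (fun h => ?_)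
        rcases lt_or_gt_of_ne hii with hlt' | hlt'
        · exact absurd (hlt.trans_le (h.2.trans ((θ.monotone
            (Fin.succ_le_castSucc_iff.mpr hlt')).trans hi1))) (lt_irrefl _)
        · exact absurd (hlt.trans_le (hi2.trans ((θ.monotone
            (Fin.succ_le_castSucc_iff.mpr hlt')).trans h.1))) (lt_irrefl _)
    refine ⟨LinearMap.lcomp k _ (bimoduleAct F (stringComp f (Fin.zero_le (θ 0)))
        (stringComp f (Fin.le_last (θ (Fin.last m))))) ∘ₗ
      TensorProduct.mk k _ _ ∘ₗ
      (PiTensorProduct.tprod k).toLinearMap (stringPull f θ) i ∘ₗ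
      Linear.leftComp k _ (stringComp f hi2) ∘ₗ
      Linear.rightComp k _ (stringComp f hi1), fun x => ?_⟩
    unfold barOpAux
    rw [hpull x, hl x, hr x]
    rfl

/-- The simplicial operator of a monotone map `θ`, on the summand indexed by `X`. -/
def barOpSummand (F : Aᵒᵖ ⥤ A ⥤ ModuleCat.{t} k) [IsLinearBimodule k F]
    {n m : ℕ} (θ : Fin (m + 1) →o Fin (n + 1)) (X : Fin (n + 1) → A) :
    BarSummand F X →ₗ[k] BarSummand F (X ∘ θ) :=
  TensorProduct.lift (PiTensorProduct.lift
    { toFun := barOpAux F θ X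
      map_update_add' := fun {inst} f j x y => by
        obtain rfl : inst = (fun a b => instDecidableEqFin n a b) := Subsingleton.elim _ _
        obtain ⟨L, hL⟩ := exists_linear_barOpAux_update F θ X f j
        rw [hL, hL, hL, map_add]
      map_update_smul' := fun {inst} f j r x => by
        obtain rfl : inst = (fun a b => instDecidableEqFin n a b) := Subsingleton.elim _ _
        obtain ⟨L, hL⟩ := exists_linear_barOpAux_update F θ X f j
        rw [hL, hL, map_smul] })

open Classical in
/-- The simplicial operator of a monotone map `θ`. -/
def barOp (F : Aᵒᵖ ⥤ A ⥤ ModuleCat.{t} k) [IsLinearBimodule k F]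
    {n m : ℕ} (θ : Fin (m + 1) →o Fin (n + 1)) : BarSimplices F n →ₗ[k] BarSimplices F m :=
  DirectSum.toModule k _ _ (fun X =>
    DirectSum.lof k (Fin (m + 1) → A) (fun X => BarSummand F X) (X ∘ θ) ∘ₗ barOpSummand F θ X)

theorem barOp_barElt (F : Aᵒᵖ ⥤ A ⥤ ModuleCat.{t} k) [IsLinearBimodule k F]
    {n m : ℕ} (θ : Fin (m + 1) →o Fin (n + 1)) (X : Fin (n + 1) → A)
    (f : ∀ i : Fin n, X i.succ ⟶ X i.castSucc) (x : (F.obj (op (X 0))).obj (X (Fin.last n))) :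
    barOp F θ (barElt F X f x) =
      barElt F (X ∘ θ) (stringPull f θ) (bimoduleAct F (stringComp f (Fin.zero_le (θ 0)))
        (stringComp f (Fin.le_last (θ (Fin.last m)))) x) := by
  classical
  unfold barOp barElt
  erw [DirectSum.toModule_lof]
  simp [barOpSummand, barOpAux]

/-- Linear maps out of `BarSimplices F n` are determined by their values on the `barElt`. -/
theorem bar_hom_ext {F : Aᵒᵖ ⥤ A ⥤ ModuleCat.{t} k} {n : ℕ} {M : Type*} [AddCommGroup M]
    [Module k M] {g h : BarSimplices F n →ₗ[k] M}
    (H : ∀ X f x, g (barElt F X f x) = h (barElt F X f x)) : g = h := by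
  classical
  refine DirectSum.linearMap_ext k (fun X => ?_)
  exact TensorProduct.ext (PiTensorProduct.ext (MultilinearMap.ext fun f =>
    LinearMap.ext fun x => H X f x))

theorem barOp_id (F : Aᵒᵖ ⥤ A ⥤ ModuleCat.{t} k) [IsLinearBimodule k F] (n : ℕ) :
    barOp F (OrderHom.id (α := Fin (n + 1))) = LinearMap.id := by
  refine bar_hom_ext (M := BarSimplices F n) fun X f x => ?_
  rw [barOp_barElt, LinearMap.id_apply]
  have h1 : stringPull f (OrderHom.id (α := Fin (n + 1))) = f :=
    funext fun i => stringComp_succ f i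
  have h2 : bimoduleAct F (stringComp f (Fin.zero_le (OrderHom.id (α := Fin (n + 1)) 0)))
      (stringComp f (Fin.le_last (OrderHom.id (α := Fin (n + 1)) (Fin.last n)))) =
        LinearMap.id := by
    rw [← bimoduleAct_id, ← stringComp_refl f, ← stringComp_refl f]
    rfl
  rw [h1, h2]
  rfl

theorem barOp_comp (F : Aᵒᵖ ⥤ A ⥤ ModuleCat.{t} k) [IsLinearBimodule k F] {n m l : ℕ}
    (θ : Fin (m + 1) →o Fin (n + 1)) (θ' : Fin (l + 1) →o Fin (m + 1)) :
    barOp F (θ.comp θ') = barOp F θ' ∘ₗ barOp F θ := by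
  refine bar_hom_ext (M := BarSimplices F l) fun X f x => ?_
  rw [LinearMap.comp_apply, barOp_barElt, barOp_barElt, barOp_barElt]
  have h1 : stringPull (X := X ∘ θ) (stringPull f θ) θ' = stringPull f (θ.comp θ') :=
    funext fun i => stringComp_stringPull f θ _
  have h2 := bimoduleAct_comp F (stringComp f (Fin.zero_le (θ 0)))
    (stringComp (X := X ∘ θ) (stringPull f θ) (Fin.zero_le (θ' 0)))
    (stringComp f (Fin.le_last (θ (Fin.last m))))
    (stringComp (X := X ∘ θ) (stringPull f θ) (Fin.le_last (θ' (Fin.last l))))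
  have h3 : stringComp (X := X ∘ θ) (stringPull f θ) (Fin.zero_le (θ' 0)) ≫
      stringComp f (Fin.zero_le (θ 0)) = stringComp f (Fin.zero_le (θ (θ' 0))) := by
    rw [stringComp_stringPull]
    exact (stringComp_trans f _ _).symm
  have h4 : stringComp f (Fin.le_last (θ (Fin.last m))) ≫
      stringComp (X := X ∘ θ) (stringPull f θ) (Fin.le_last (θ' (Fin.last l))) =
        stringComp f (Fin.le_last (θ (θ' (Fin.last l)))) := by
    rw [stringComp_stringPull]
    exact (stringComp_trans f _ _).symm
  rw [h1]
  refine congrArg (barElt F (X ∘ θ.comp θ') (stringPull f (θ.comp θ'))) ?_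
  refine (DFunLike.congr_fun ?_ x).trans (DFunLike.congr_fun h2 x)
  rw [h3, h4]
  rfl

/-- The simplicial bar construction `B_* F` of a linear bimodule `F`. The face maps compose
neighbouring morphisms (the two outer ones act on `F`), the degeneracies insert identities. -/
def barConstruction (F : Aᵒᵖ ⥤ A ⥤ ModuleCat.{t} k) [IsLinearBimodule k F] :
    SimplicialObject (ModuleCat.{max u w v t} k) where
  obj Δ := ModuleCat.of k (BarSimplices F Δ.unop.len)
  map θ := ModuleCat.ofHom (barOp F θ.unop.toOrderHom)
  map_id _ := ModuleCat.hom_ext (barOp_id F _)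
  map_comp _ _ := ModuleCat.hom_ext (barOp_comp F _ _)

/-- The map of bar constructions in degree `n` induced by a morphism of bimodules. -/
def barMap {F F' : Aᵒᵖ ⥤ A ⥤ ModuleCat.{t} k} (η : F ⟶ F') (n : ℕ) :
    BarSimplices F n →ₗ[k] BarSimplices F' n :=
  DirectSum.lmap (fun X => TensorProduct.map LinearMap.id
    ((η.app (op (X 0))).app (X (Fin.last n))).hom)

theorem barMap_barElt {F F' : Aᵒᵖ ⥤ A ⥤ ModuleCat.{t} k} (η : F ⟶ F') {n : ℕ}
    (X : Fin (n + 1) → A) (f : ∀ i : Fin n, X i.succ ⟶ X i.castSucc)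
    (x : (F.obj (op (X 0))).obj (X (Fin.last n))) :
    barMap η n (barElt F X f x) =
      barElt F' X f (((η.app (op (X 0))).app (X (Fin.last n))).hom x) := by
  classical
  unfold barMap barElt
  rw [DirectSum.lmap_lof]
  rfl

/-- The map of simplicial bar constructions induced by a morphism of bimodules. -/
def barConstructionMap {F F' : Aᵒᵖ ⥤ A ⥤ ModuleCat.{t} k} [IsLinearBimodule k F]
    [IsLinearBimodule k F'] (η : F ⟶ F') : barConstruction F ⟶ barConstruction F' where
  app Δ := ModuleCat.ofHom (barMap η Δ.unop.len)
  naturality Δ Δ' θ := by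
    refine ModuleCat.hom_ext (bar_hom_ext fun X f x => ?_)
    change barMap η _ (barOp F θ.unop.toOrderHom (barElt F X f x)) =
      barOp F' θ.unop.toOrderHom (barMap η _ (barElt F X f x))
    rw [barOp_barElt, barMap_barElt, barMap_barElt, barOp_barElt]
    exact congrArg _ (DFunLike.congr_fun (bimoduleAct_naturality η _ _) x)

/-- The derived coend `∫_L^{X ∈ A} F(X, X)` of a linear bimodule: the total complex of the
simplicial vector space `B_* F`, i.e. the complex with `B_n F` in degree `n` and the alternating
sum of the face maps as differential. -/
def derivedCoend (F : Aᵒᵖ ⥤ A ⥤ ModuleCat.{t} k) [IsLinearBimodule k F] :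
    ChainComplex (ModuleCat.{max u w v t} k) ℕ :=
  (AlgebraicTopology.alternatingFaceMapComplex _).obj (barConstruction F)

/-- The chain map of derived coends induced by a morphism of bimodules. -/
def derivedCoendMap {F F' : Aᵒᵖ ⥤ A ⥤ ModuleCat.{t} k} [IsLinearBimodule k F]
    [IsLinearBimodule k F'] (η : F ⟶ F') : derivedCoend F ⟶ derivedCoend F' :=
  (AlgebraicTopology.alternatingFaceMapComplex _).map (barConstructionMap η)

/-- The `0`-chain of the derived coend given by `x ∈ F(X, X)`. -/
def derivedCoendZero (F : Aᵒᵖ ⥤ A ⥤ ModuleCat.{t} k) [IsLinearBimodule k F] (X : A)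
    (x : (F.obj (op X)).obj X) : (derivedCoend F).X 0 :=
  barElt F (n := 0) (fun _ => X) (fun i => i.elim0) x

end Bar

/-! ### Finite linear categories, pivotal structures -/

section Finite

variable (k : Type w) [Field k] (C : Type u) [Category.{v} C] [Preadditive C] [Linear k C]

/-- A `k`-linear category is finite if it is equivalent, as a `k`-linear category, to the category
of finite-dimensional modules over a finite-dimensional `k`-algebra `A`. (Since `A` is
finite-dimensional, the finite-dimensional modules are the finitely generated ones.) -/
class IsFiniteLinearCategory : Prop where
  exists_equivalence : ∃ (A : Type w) (_ : Ring A) (_ : Algebra k A) (_ : Module.Finite k A)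
    (e : C ≌ FGModuleCat.{w} A), e.functor.Additive ∧
      ∀ (X Y : C) (r : k) (f : X ⟶ Y) (x : e.functor.obj X),
        (e.functor.map (r • f)).hom.hom x = algebraMap k A r • (e.functor.map f).hom.hom x

end Finite

section Dual

variable (C : Type u) [Category.{v} C] [MonoidalCategory C] [RightRigidCategory C]

/-- The duality functor `X ↦ Xᘁ`, where `Xᘁ` is the dual of `X` with `𝟙_ C ⟶ X ⊗ Xᘁ` and
`Xᘁ ⊗ X ⟶ 𝟙_ C`. -/
def dualityFunctor : Cᵒᵖ ⥤ C where
  obj X := X.unopᘁ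
  map f := f.unopᘁ
  map_id _ := rightAdjointMate_id
  map_comp _ _ := comp_rightAdjointMate

/-- A pivotal structure on a rigid monoidal category: a monoidal natural isomorphism from the
identity functor to the double dual functor. The monoidal structure
`Xᘁᘁ ⊗ Yᘁᘁ ≅ (Yᘁ ⊗ Xᘁ)ᘁ ≅ (X ⊗ Y)ᘁᘁ` of the double dual functor is the one given by uniqueness
of duals. -/
class PivotalCategory where
  pivot : ∀ X : C, X ≅ HasRightDual.rightDual (HasRightDual.rightDual X)
  pivot_naturality : ∀ {X Y : C} (f : X ⟶ Y),
    f ≫ (pivot Y).hom = (pivot X).hom ≫ rightAdjointMate (rightAdjointMate f)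
  pivot_tensor : ∀ X Y : C, (pivot (X ⊗ Y)).hom =
    ((pivot X).hom ⊗ₘ (pivot Y).hom) ≫
      (rightDualTensorIso (HasRightDual.rightDual Y) (HasRightDual.rightDual X)).inv ≫
        rightAdjointMate (rightDualTensorIso X Y).hom

end Dual

/-! ### The two sides of the equivalence -/

section Hochschild

variable (k : Type w) [Field k] {C : Type u} [Category.{v} C] [Preadditive C] [Linear k C]

/-- The full subcategory of projective objects. -/
abbrev Proj (C : Type u) [Category.{v} C] := (isProjective C).FullSubcategory

/-- The bimodule `(X, Y) ↦ C(G(X), Y)` over the category of projective objects. -/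
def twistedHom (G : C ⥤ C) : (Proj C)ᵒᵖ ⥤ Proj C ⥤ ModuleCat.{v} k :=
  ((isProjective C).ι ⋙ G).op ⋙ linearCoyoneda k C ⋙
    (Functor.whiskeringLeft _ _ _).obj (isProjective C).ι

instance (G : C ⥤ C) [G.Additive] [G.Linear k] : IsLinearBimodule k (twistedHom k G) where
  map_add_left f g Y := by
    ext h
    exact (congrArg (fun p => p ≫ (show G.obj _ ⟶ Y.obj from h)) (G.map_add (f := f.hom))).trans
      (Preadditive.add_comp _ _ _ (G.map f.hom) (G.map g.hom) h)
  map_smul_left r f Y := by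
    ext h
    exact (congrArg (fun p => p ≫ (show G.obj _ ⟶ Y.obj from h)) (G.map_smul r f.hom)).trans
      (Linear.smul_comp _ _ _ r (G.map f.hom) h)
  map_add_right X Y Y' f g := by
    ext h
    exact Preadditive.comp_add _ _ _ h f.hom g.hom
  map_smul_right X Y Y' r f := by
    ext h
    exact Linear.comp_smul _ _ _ h r f.hom

/-- The complex `∫_L^{X ∈ Proj C} C(G(X), X)`. -/
def twistedHochschildComplex (G : C ⥤ C) [G.Additive] [G.Linear k] :
    ChainComplex (ModuleCat.{max u v w} k) ℕ :=
  derivedCoend (twistedHom k G)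

/-- Precomposition with a natural transformation `G' ⟶ G`, as a map from the complex for `G` to
the complex for `G'`. -/
def twistedHochschildMap {G G' : C ⥤ C} [G.Additive] [G.Linear k] [G'.Additive] [G'.Linear k]
    (α : G' ⟶ G) : twistedHochschildComplex k G ⟶ twistedHochschildComplex k G' :=
  derivedCoendMap (F := twistedHom k G) (F' := twistedHom k G')
    (Functor.whiskerRight (NatTrans.op (Functor.whiskerLeft (isProjective C).ι α))
      (linearCoyoneda k C ⋙ (Functor.whiskeringLeft _ _ _).obj (isProjective C).ι))

/-- The `0`-chain of `∫_L^{X ∈ Proj C} C(G(X), X)` given by a projective object `P` and a morphism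
`h : G(P) ⟶ P`. -/
def twistedHochschildZero (G : C ⥤ C) [G.Additive] [G.Linear k] (P : Proj C)
    (h : G.obj P.obj ⟶ P.obj) : (twistedHochschildComplex k G).X 0 :=
  derivedCoendZero (twistedHom k G) P h

variable (C) in
/-- The bimodule `(X, Y) ↦ C(X, Y)` over the category of projective objects. -/
def projHom : (Proj C)ᵒᵖ ⥤ Proj C ⥤ ModuleCat.{v} k :=
  (isProjective C).ι.op ⋙ linearCoyoneda k C ⋙
    (Functor.whiskeringLeft _ _ _).obj (isProjective C).ι

instance : IsLinearBimodule k (projHom k C) :=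
  inferInstanceAs (IsLinearBimodule k (twistedHom k (𝟭 C)))

variable (C) in
/-- The Hochschild complex `∫_L^{X ∈ Proj C} C(X, X)` of a `k`-linear category `C`. -/
def hochschildComplex : ChainComplex (ModuleCat.{max u v w} k) ℕ :=
  derivedCoend (projHom k C)

/-- The functor `C(X, -)` with values in `k`-vector spaces (lifted to a larger universe). -/
def homFunctor (X : C) : C ⥤ ModuleCat.{max u v w} k :=
  (linearCoyoneda k C).obj (op X) ⋙ ModuleCat.uliftFunctor.{max u w} k

instance (X : C) : (homFunctor k X).Additive := by
  unfold homFunctor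
  infer_instance

end Hochschild

section Coend

variable {C : Type u} [Category.{v} C] [MonoidalCategory C] [RightRigidCategory C]

/-- The bifunctor `(X, Y) ↦ Y ⊗ G(X)ᘁ`, whose coend is `∫^{X ∈ C} X ⊗ G(X)ᘁ`. -/
def tensorTwistedDual (G : C ⥤ C) : Cᵒᵖ ⥤ C ⥤ C :=
  G.op ⋙ dualityFunctor C ⋙ (curriedTensor C).flip

variable (C) in
/-- The bifunctor `(X, Y) ↦ Y ⊗ Xᘁ`, whose coend is the canonical coend
`𝔽 = ∫^{X ∈ C} X ⊗ Xᘁ`. -/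
def tensorDual : Cᵒᵖ ⥤ C ⥤ C :=
  dualityFunctor C ⋙ (curriedTensor C).flip

/-- The morphism `𝟙_ C ⟶ Y ⊗ Xᘁ` corresponding to `h : X ⟶ Y` by duality. -/
def homToTensorDual {X Y : C} (h : X ⟶ Y) : 𝟙_ C ⟶ Y ⊗ Xᘁ :=
  η_ X (Xᘁ) ≫ h ▷ Xᘁ

end Coend

section Resolution

variable (k : Type w) [Field k] {C : Type u} [Category.{v} C] [Abelian C] [Linear k C]
  [MonoidalCategory C]

/-- The complex `C(𝟙_ C, Q)` of `k`-vector spaces. -/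
def unitHomComplex (Q : ChainComplex C ℕ) : ChainComplex (ModuleCat.{max u v w} k) ℕ :=
  ((homFunctor k (𝟙_ C)).mapHomologicalComplex _).obj Q

/-- The chain map `C(𝟙_ C, Q) ⟶ C(𝟙_ C, Q')` induced by a chain map `Q ⟶ Q'`. -/
def unitHomMap {Q Q' : ChainComplex C ℕ} (φ : Q ⟶ Q') :
    unitHomComplex k Q ⟶ unitHomComplex k Q' :=
  ((homFunctor k (𝟙_ C)).mapHomologicalComplex _).map φ

/-- The `0`-chain of `C(𝟙_ C, Q)` given by a morphism `𝟙_ C ⟶ Q 0`. -/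
def unitHomZero (Q : ChainComplex C ℕ) (g : 𝟙_ C ⟶ Q.X 0) : (unitHomComplex k Q).X 0 :=
  ULift.up g

variable [RightRigidCategory C]

variable (C) in
/-- An exact `k`-linear endofunctor `G` of `C`, a coend `∫^{X ∈ C} X ⊗ G(X)ᘁ` (that is, a universal
cowedge) and a projective resolution of this coend. -/
structure CoendResolution where
  G : C ⥤ C
  [additive : G.Additive]
  [linear : G.Linear k]
  [preservesFiniteLimits : PreservesFiniteLimits G]
  [preservesFiniteColimits : PreservesFiniteColimits G]
  cowedge : Cowedge (tensorTwistedDual G)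
  isColimit : IsColimit cowedge
  resolution : ProjectiveResolution cowedge.pt

attribute [instance] CoendResolution.additive CoendResolution.linear
  CoendResolution.preservesFiniteLimits CoendResolution.preservesFiniteColimits

end Resolution

end

/-! The theorem is the comparison theorem for projective resolutions, applied to complexes of
presheaves on C instead of complexes of vector spaces. Let F be the coend and insert a variable
object Z. The bar constructions of the bimodules C(Z ⊗ G(X), Y) form a complex of presheaves B in Z,
whose value at Z = I is the complex of the theorem. Duality C(Z ⊗ G(X), X) ≅ C(Z, X ⊗ G(X)ᘁ),
followed by the structure map of the coend, augments B to C(-, F). The other complex is C(-, Q),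
augmented to the same presheaf.

Both are relative projective resolutions of C(-, F). They are exact over projective Z, and their
terms lift against maps of presheaves that are surjective over projective objects: for C(-, Q) by
the Yoneda lemma, for B because each summand is a vector space tensored with C(-, Xₙ ⊗ G(X₀)ᘁ),
which is represented by a projective object (`isRelativelyProjective_barPresheaf`). Hence there is a
homotopy equivalence over C(-, F), unique up to homotopy (`exists_presheaf_comparison`). The unit I
need not be projective, but a homotopy equivalence of presheaves, unlike exactness over projectives,
survives evaluation at every object. Naturality of Φ is the uniqueness of lifts, and ℓ_P is the
image of the universal element of C(-, P ⊗ G(P)ᘁ).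

The main work is exactness of the augmented B over projective Z. There T = Z ⊗ G(-) is exact with
projective values. The functor X ↦ Hom(T X, Sⱼ)* on projectives is corepresented by some Rⱼ, so T X
is naturally the sum of the C(Rⱼ, X) ⊗ Qⱼ, where Qⱼ is the projective cover of the simple object Sⱼ.
Therefore C(T X, Y) is a natural summand of the sum of the C(Qⱼ, Y) ⊗ C(T X, Qⱼ), which provides an
extra degeneracy and kills homology in positive degrees (`IsSplitBimodule.exists_barDiff_eq`). In
degree zero one uses a progenerator P: the coend is the cokernel of finitely many relations on P ⊗
G(P)ᘁ, which also shows that it exists. -/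

noncomputable section

/-! ### Projective generators of finite linear categories -/

section Progenerator

variable {C : Type u} [Category.{v} C]

/-- A projective object from which every object is reached by a finite jointly epimorphic family. -/
structure IsProgenerator (P : C) : Prop where
  projective : Projective P
  exists_family : ∀ X : C, ∃ (n : ℕ) (b : Fin n → (P ⟶ X)),
    ∀ (Y : C) (f g : X ⟶ Y), (∀ i, b i ≫ f = b i ≫ g) → f = g

end Progenerator

section FGModule

variable {A : Type w} [Ring A]

theorem FGModuleCat.surjective_of_epi {M N : FGModuleCat.{w} A} (f : M ⟶ N) [Epi f] :
    Function.Surjective f.hom.hom := by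
  rw [← LinearMap.range_eq_top]
  let q : N ⟶ FGModuleCat.of A (N ⧸ LinearMap.range f.hom.hom) :=
    FGModuleCat.ofHom (LinearMap.range f.hom.hom).mkQ
  have hq : q = 0 := by
    rw [← cancel_epi f]
    refine FGModuleCat.hom_ext (LinearMap.ext fun x => ?_)
    exact (Submodule.Quotient.mk_eq_zero _).mpr ⟨x, rfl⟩
  rw [eq_top_iff]
  intro y _
  rw [← Submodule.Quotient.mk_eq_zero]
  exact congrArg (fun g : N ⟶ _ => g.hom.hom y) hq

theorem FGModuleCat.projective_self : Projective (FGModuleCat.of A A) where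
  factors {M N} f e _ := by
    obtain ⟨m, hm⟩ := FGModuleCat.surjective_of_epi e (f.hom.hom (1 : A))
    refine ⟨FGModuleCat.ofHom (LinearMap.toSpanSingleton A M m), FGModuleCat.hom_ext ?_⟩
    refine LinearMap.ext_ring ?_
    change e.hom.hom ((1 : A) • m) = _
    rw [one_smul, hm]

end FGModule

section Finite

variable (k : Type w) [Field k] (C : Type u) [Category.{v} C] [Preadditive C] [Linear k C]

/-- The regular module does it: a finite generating set of a module is a jointly epimorphic family
of maps out of the regular module. -/
theorem exists_isProgenerator [IsFiniteLinearCategory k C] : ∃ P : C, IsProgenerator P := by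
  obtain ⟨A, _, _, _, e, _, -⟩ := IsFiniteLinearCategory.exists_equivalence (k := k) (C := C)
  refine ⟨e.inverse.obj (FGModuleCat.of A A), ?_, fun X => ?_⟩
  · exact (e.symm.map_projective_iff _).mpr FGModuleCat.projective_self
  · obtain ⟨n, s, hs⟩ := Module.Finite.exists_fin (R := A) (M := e.functor.obj X)
    let b' : Fin n → (FGModuleCat.of A A ⟶ e.functor.obj X) := fun i =>
      FGModuleCat.ofHom (LinearMap.toSpanSingleton A (e.functor.obj X) (s i))
    refine ⟨n, fun i => e.inverse.map (b' i) ≫ e.unitInv.app X, fun Y f g h => ?_⟩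
    apply e.functor.map_injective
    refine FGModuleCat.hom_ext ?_
    refine LinearMap.ext_on_range hs fun i => ?_
    have key : ∀ f : X ⟶ Y, e.counitInv.app _ ≫ e.functor.map
        ((e.inverse.map (b' i) ≫ e.unitInv.app X) ≫ f) = b' i ≫ e.functor.map f := by
      intro f
      simp
    have := (key f).symm.trans ((congrArg (fun t => e.counitInv.app _ ≫ e.functor.map t)
      (h i)).trans (key g))
    have h1 := congrArg (fun t => t.hom.hom (1 : A)) this
    have h2 : (b' i).hom.hom (1 : A) = s i := one_smul _ _
    change (e.functor.map f).hom.hom ((b' i).hom.hom (1 : A)) =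
      (e.functor.map g).hom.hom ((b' i).hom.hom (1 : A)) at h1
    rwa [h2] at h1

/-- A morphism is determined by its values on finitely many generators of the source, and these lie
in a finite-dimensional space. -/
theorem finite_hom [IsFiniteLinearCategory k C] (X Y : C) : Module.Finite k (X ⟶ Y) := by
  obtain ⟨A, _, _, _, e, _, he⟩ := IsFiniteLinearCategory.exists_equivalence (k := k) (C := C)
  obtain ⟨n, s, hs⟩ := Module.Finite.exists_fin (R := A) (M := e.functor.obj X)
  let : Module k (e.functor.obj Y) := Module.compHom _ (algebraMap k A)
  have : IsScalarTower k A (e.functor.obj Y) := ⟨fun r a m => by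
    rw [Algebra.smul_def, mul_smul]; rfl⟩
  have : Module.Finite k (e.functor.obj Y) := Module.Finite.trans A _
  let φ : (X ⟶ Y) →ₗ[k] (Fin n → e.functor.obj Y) :=
    { toFun := fun f i => (e.functor.map f).hom.hom (s i)
      map_add' := fun f g => by
        funext i
        rw [e.functor.map_add]
        rfl
      map_smul' := fun r f => by
        funext i
        exact he X Y r f (s i) }
  refine Module.Finite.of_injective φ fun f g h => ?_
  apply e.functor.map_injective
  refine FGModuleCat.hom_ext ?_
  exact LinearMap.ext_on_range hs fun i => congrFun h i

end Finite

/-! ### Simple objects and their projective covers -/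

set_option linter.unusedSectionVars false

/-- Used with dim C(P, -) as a length function, to pick minimal objects without invoking chains of
subobjects. -/
theorem exists_forall_le_nat {α : Sort*} (p : α → Prop) (f : α → ℕ) (h : ∃ a, p a) :
    ∃ a, p a ∧ ∀ b, p b → f a ≤ f b := by
  classical
  have h' : ∃ n a, p a ∧ f a = n := let ⟨a, ha⟩ := h; ⟨f a, a, ha, rfl⟩
  obtain ⟨a, ha, hn⟩ := Nat.find_spec h'
  exact ⟨a, ha, fun b hb => hn.trans_le (Nat.find_min' h' ⟨b, hb, rfl⟩)⟩

section Simple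

variable {k : Type w} [Field k] {C : Type u} [Category.{v} C] [Abelian C] [Linear k C]
  {P : C}

theorem IsProgenerator.epi_of_forall_factors (hP : IsProgenerator P) {X Y : C} (f : X ⟶ Y)
    (h : ∀ b : P ⟶ Y, ∃ a : P ⟶ X, a ≫ f = b) : Epi f := by
  obtain ⟨n, b, hb⟩ := hP.exists_family Y
  refine ⟨fun g g' hg => hb _ _ _ fun i => ?_⟩
  obtain ⟨a, ha⟩ := h (b i)
  rw [← ha, Category.assoc, Category.assoc, hg]

theorem IsProgenerator.eq_zero (hP : IsProgenerator P) {X Y : C} (f : X ⟶ Y)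
    (h : ∀ b : P ⟶ X, b ≫ f = 0) : f = 0 := by
  obtain ⟨n, b, hb⟩ := hP.exists_family X
  exact hb _ _ _ fun i => by rw [h, comp_zero]

theorem IsProgenerator.exists_hom_simple_ne_zero (hP : IsProgenerator P) (S : C) [Simple S] : ∃ b : P ⟶ S, b ≠ 0 := by
  by_contra! h
  exact id_nonzero S (hP.eq_zero (𝟙 S) fun b => by rw [h b, zero_comp])

section

variable (hP : IsProgenerator P) (hfin : ∀ X Y : C, Module.Finite k (X ⟶ Y))
include hP hfin

/-- For a progenerator P the functor C(P, -) is exact and faithful, so dim C(P, -) behaves like a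
length: a subobject of full dimension is everything. The next lemma is the same for quotients. -/
theorem IsProgenerator.isIso_of_mono {K X : C} (i : K ⟶ X) [Mono i]
    (h : Module.finrank k (P ⟶ X) ≤ Module.finrank k (P ⟶ K)) : IsIso i := by
  have := hfin P K
  have := hfin P X
  have hinj : Function.Injective (Linear.rightComp k P i) := fun a b hab => (cancel_mono i).mp hab
  have hsurj : Function.Surjective (Linear.rightComp k P i) :=
    (LinearMap.injective_iff_surjective_of_finrank_eq_finrank
      (le_antisymm (LinearMap.finrank_le_finrank_of_injective hinj) h)).mp hinj
  have := hP.epi_of_forall_factors i hsurj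
  exact isIso_of_mono_of_epi i

theorem IsProgenerator.isIso_of_epi {X Q : C} (p : X ⟶ Q) [Epi p]
    (h : Module.finrank k (P ⟶ X) ≤ Module.finrank k (P ⟶ Q)) : IsIso p := by
  have := hfin P X
  have := hfin P Q
  have := hP.projective
  have hsurj : Function.Surjective (Linear.rightComp k P p) := fun b =>
    ⟨Projective.factorThru b p, Projective.factorThru_comp b p⟩
  have hinj : Function.Injective (Linear.rightComp k P p) :=
    (LinearMap.injective_iff_surjective_of_finrank_eq_finrank
      (le_antisymm h (LinearMap.finrank_le_finrank_of_surjective hsurj))).mpr hsurj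
  have : Mono p := Preadditive.mono_of_cancel_zero p fun g hg => hP.eq_zero g fun b =>
    hinj (by simp [hg])
  exact isIso_of_mono_of_epi p

/-- A nonzero quotient of least dimension is simple, since dividing out a nonzero proper subobject
would give a smaller one. -/
theorem IsProgenerator.exists_simple_quotient {X : C} (hX : ¬ IsZero X) :
    ∃ (S : C) (_ : Simple S) (q : X ⟶ S), q ≠ 0 := by
  obtain ⟨⟨Q, q⟩, ⟨hq, hQ⟩, hmin⟩ := exists_forall_le_nat
    (fun a : Σ Q : C, X ⟶ Q => Epi a.2 ∧ ¬ IsZero a.1) (fun a => Module.finrank k (P ⟶ a.1))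
    ⟨⟨X, 𝟙 X⟩, inferInstance, hX⟩
  dsimp only at hq hQ hmin
  refine ⟨Q, ⟨fun {Y} f _ => ⟨?_, fun hf => ?_⟩⟩, q, ?_⟩
  · rintro hf rfl
    exact hQ (IsZero.of_epi_eq_zero (0 : Y ⟶ Q) rfl)
  · by_cases hc : IsZero (cokernel f)
    · have : Epi f := Preadditive.epi_of_isZero_cokernel f hc
      exact isIso_of_mono_of_epi f
    · have hle := hmin ⟨cokernel f, q ≫ cokernel.π f⟩ ⟨epi_comp _ _, hc⟩
      have := hP.isIso_of_epi hfin (cokernel.π f) hle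
      exact absurd ((cancel_mono (cokernel.π f)).mp (by simp)) hf
  · rintro rfl
    exact hQ (IsZero.of_epi_eq_zero (0 : X ⟶ Q) rfl)

/-- The cover is a minimal subobject M of P on which a fixed nonzero b : P ⟶ S does not vanish.
Minimality makes M a retract of P and forces every map from M to a simple object to factor through
S. -/
theorem IsProgenerator.exists_projectiveCover (S : C) [Simple S] :
    ∃ (M : C) (π : M ⟶ S), Projective M ∧ π ≠ 0 ∧
      ∀ (S' : C) [Simple S'] (q : M ⟶ S'), ∃ c : S ⟶ S', q = π ≫ c := by
  have := hP.projective
  obtain ⟨b, hb⟩ := hP.exists_hom_simple_ne_zero S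
  obtain ⟨⟨M, m⟩, ⟨hm, hmb⟩, hmin⟩ := exists_forall_le_nat
    (fun a : Σ M : C, M ⟶ P => Mono a.2 ∧ a.2 ≫ b ≠ 0) (fun a => Module.finrank k (P ⟶ a.1))
    ⟨⟨P, 𝟙 P⟩, inferInstance, by simpa using hb⟩
  dsimp only at hm hmb hmin
  have hminK : ∀ {K : C} (i : K ⟶ M) [Mono i], i ≫ m ≫ b ≠ 0 → IsIso i := fun {K} i _ hi =>
    hP.isIso_of_mono hfin i (hmin ⟨K, i ≫ m⟩ ⟨mono_comp _ _, by simpa using hi⟩)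
  have : Epi (m ≫ b) := epi_of_nonzero_to_simple hmb
  let v : P ⟶ M := Projective.factorThru b (m ≫ b)
  have hv : v ≫ m ≫ b = b := Projective.factorThru_comp _ _
  -- The endomorphism m ≫ v of M is compatible with M ⟶ S, so its image still maps nontrivially to S
  -- and is all of M by minimality.
  have hepi : Epi (m ≫ v) := by
    have := hminK (image.ι (m ≫ v)) fun h => hmb <| by
      have h2 := congrArg (fun t => factorThruImage (m ≫ v) ≫ t) h
      simpa [hv] using h2
    rw [← image.fac (m ≫ v)]
    infer_instance
  have hiso : IsIso (m ≫ v) := hP.isIso_of_epi hfin _ le_rfl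
  refine ⟨M, m ≫ b, ?_, hmb, fun S' _ q => ?_⟩
  · exact Retract.projective (Y := P) ⟨m, v ≫ inv (m ≫ v), by
      rw [← Category.assoc, IsIso.hom_inv_id]⟩
  · by_cases hq : q = 0
    · exact ⟨0, by simp [hq]⟩
    · have : Epi q := epi_of_nonzero_to_simple hq
      by_cases hk : kernel.ι q ≫ m ≫ b = 0
      · let d : S' ⟶ S := Abelian.epiDesc q (m ≫ b) hk
        have hd : q ≫ d = m ≫ b := Abelian.comp_epiDesc _ _ _
        have hd0 : d ≠ 0 := by
          rintro h
          exact hmb (by rw [← hd, h, comp_zero])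
        have := isIso_of_hom_simple hd0
        exact ⟨inv d, by rw [← hd, Category.assoc, IsIso.hom_inv_id, Category.comp_id]⟩
      · have := hminK (kernel.ι q) hk
        exact absurd ((cancel_epi (kernel.ι q)).mp (by simp)) hq

end

end Simple

attribute [local instance] Abelian.hasFiniteBiproducts

section SimpleFamily

/-- A finite family of representatives of the simple objects, with their projective covers. -/
structure SimpleFamily (k : Type w) [Field k] (C : Type u) [Category.{v} C] [Abelian C]
    [Linear k C] where
  J : Type u
  [fintype : Fintype J]
  S : J → C
  [simple : ∀ j, Simple (S j)]
  Q : J → C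
  projective : ∀ j, Projective (Q j)
  π : ∀ j, Q j ⟶ S j
  π_ne_zero : ∀ j, π j ≠ 0
  hom_eq_zero : ∀ {i j}, i ≠ j → ∀ q : Q i ⟶ S j, q = 0
  hom_eq_smul : ∀ {j} (q : Q j ⟶ S j), ∃ c : k, q = c • π j
  exists_iso : ∀ (X : C) [Simple X], ∃ j, Nonempty (X ≅ S j)

attribute [instance] SimpleFamily.fintype SimpleFamily.simple

variable {k : Type w} [Field k] {C : Type u} [Category.{v} C] [Abelian C] [Linear k C]
  {P : C}

/-- There are at most dim End(P) simple objects up to isomorphism. Algebraic closedness enters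
through Schur's lemma, which makes every map from Q j to S j a scalar multiple of π j. -/
theorem IsProgenerator.nonempty_simpleFamily [IsAlgClosed k] (hP : IsProgenerator P)
    (hfin : ∀ X Y : C, Module.Finite k (X ⟶ Y)) : Nonempty (SimpleFamily k C) := by
  let s : Setoid {X : C // Simple X} :=
    { r := fun X Y => Nonempty (X.1 ≅ Y.1)
      iseqv := ⟨fun X => ⟨Iso.refl _⟩, fun ⟨e⟩ => ⟨e.symm⟩, fun ⟨e⟩ ⟨f⟩ => ⟨e.trans f⟩⟩ }
  let S : Quotient s → C := fun j => j.out.1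
  have hS : ∀ j, Simple (S j) := fun j => j.out.2
  have hiso : ∀ i j, Nonempty (S i ≅ S j) → i = j := fun i j h => by
    rw [← Quotient.out_eq i, ← Quotient.out_eq j]
    exact Quotient.sound h
  choose Q π hproj hπ hcov using fun j => hP.exists_projectiveCover hfin (S j)
  have hzero : ∀ {i j}, i ≠ j → ∀ q : Q i ⟶ S j, q = 0 := fun {i j} hij q => by
    obtain ⟨c, hc⟩ := hcov i (S j) q
    by_cases h0 : c = 0
    · rw [hc, h0, comp_zero]
    · have := isIso_of_hom_simple h0
      exact absurd (hiso i j ⟨asIso c⟩) hij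
  have := hP.projective
  choose b hb using fun j => hP.exists_hom_simple_ne_zero (S j)
  have hepi : ∀ j, Epi (π j) := fun j => epi_of_nonzero_to_simple (hπ j)
  have hepi' : ∀ j, Epi (b j) := fun j => epi_of_nonzero_to_simple (hb j)
  let a : ∀ j, P ⟶ Q j := fun j => Projective.factorThru (b j) (π j)
  have ha : ∀ j, a j ≫ π j = b j := fun j => Projective.factorThru_comp _ _
  let c : ∀ j, Q j ⟶ P := fun j =>
    have := hproj j
    Projective.factorThru (π j) (b j)
  have hc : ∀ j, c j ≫ b j = π j := fun j =>
    have := hproj j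
    Projective.factorThru_comp _ _
  -- Composing with b i kills the terms with j ≠ i, since Q j has no nonzero map to S i, and turns
  -- the i-th term into b i ≠ 0.
  have hli : LinearIndependent k (fun j => a j ≫ c j) := by
    rw [linearIndependent_iff']
    intro T g hg i hi
    have h := congrArg (fun x => x ≫ b i) hg
    rw [Preadditive.sum_comp, Finset.sum_eq_single i] at h
    · rw [Linear.smul_comp, Category.assoc, hc, ha, zero_comp] at h
      exact (smul_eq_zero.mp h).resolve_right (hb i)
    · intro j _ hj
      rw [Linear.smul_comp, Category.assoc, hzero hj (c j ≫ b i), comp_zero, smul_zero]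
    · exact fun h => absurd hi h
  have := hfin P P
  have : Finite (Quotient s) := hli.finite
  have : Fintype (Quotient s) := Fintype.ofFinite _
  refine ⟨⟨Quotient s, S, Q, hproj, π, hπ, hzero, fun {j} q => ?_, fun X hX => ?_⟩⟩
  · obtain ⟨c, hc⟩ := hcov j (S j) q
    have := hfin (S j) (S j)
    obtain ⟨r, hr⟩ := endomorphism_simple_eq_smul_id k c
    exact ⟨r, by rw [hc, ← hr, Linear.comp_smul, Category.comp_id]⟩
  · refine ⟨Quotient.mk s ⟨X, hX⟩, ?_⟩
    have h : (Quotient.mk s ⟨X, hX⟩) = Quotient.mk s (Quotient.mk s ⟨X, hX⟩).out :=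
      (Quotient.out_eq _).symm
    exact Quotient.exact h

theorem SimpleFamily.exists_hom_ne_zero (𝒮 : SimpleFamily k C) (hP : IsProgenerator P)
    (hfin : ∀ X Y : C, Module.Finite k (X ⟶ Y)) {X : C} (hX : ¬ IsZero X) :
    ∃ (j : 𝒮.J) (q : X ⟶ 𝒮.S j), q ≠ 0 := by
  obtain ⟨S, _, q, hq⟩ := hP.exists_simple_quotient hfin hX
  obtain ⟨j, ⟨e⟩⟩ := 𝒮.exists_iso S
  exact ⟨j, q ≫ e.hom, fun h => hq ((cancel_mono e.hom).mp (by rw [h, zero_comp]))⟩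

/-- Functionals on `Y ⟶ S` are represented by morphisms from the projective cover of `S` to `Y`. -/
theorem SimpleFamily.exists_hom_of_dual (𝒮 : SimpleFamily k C)
    (hfin : ∀ X Y : C, Module.Finite k (X ⟶ Y)) (j : 𝒮.J) {Y : C}
    (r : Module.Dual k (Y ⟶ 𝒮.S j)) :
    ∃ p : 𝒮.Q j ⟶ Y, ∀ q : Y ⟶ 𝒮.S j, p ≫ q = r q • 𝒮.π j := by
  choose c hc using fun q => 𝒮.hom_eq_smul (j := j) q
  have hinj : ∀ x y : k, x • 𝒮.π j = y • 𝒮.π j → x = y :=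
    fun x y h => smul_left_injective k (𝒮.π_ne_zero j) h
  let coe : (𝒮.Q j ⟶ 𝒮.S j) →ₗ[k] k :=
    { toFun := c
      map_add' := fun x y => hinj _ _ (by rw [← hc, add_smul, ← hc, ← hc])
      map_smul' := fun x y => hinj _ _ (by
        rw [← hc, smul_eq_mul, mul_smul, RingHom.id_apply, ← hc]) }
  let B : (𝒮.Q j ⟶ Y) →ₗ[k] (Y ⟶ 𝒮.S j) →ₗ[k] k :=
    LinearMap.compr₂ (Linear.comp _ _ _) coe
  have hB : ∀ p q, B p q • 𝒮.π j = p ≫ q := fun p q => (hc _).symm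
  have := hfin (𝒮.Q j) Y
  -- A nonzero q : Y ⟶ S j is epi, so π j lifts through it and pairs with q to 1. Nondegeneracy on
  -- this side gives surjectivity onto the dual space on the other, by finite dimension.
  have hflip : Function.Injective B.flip := by
    rw [injective_iff_map_eq_zero]
    intro q hq
    by_contra h0
    have : Epi q := epi_of_nonzero_to_simple h0
    have := 𝒮.projective j
    have h1 := hB (Projective.factorThru (𝒮.π j) q) q
    rw [Projective.factorThru_comp] at h1
    have h2 : B (Projective.factorThru (𝒮.π j) q) q = 0 := LinearMap.congr_fun hq _
    rw [h2, zero_smul] at h1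
    exact 𝒮.π_ne_zero j h1.symm
  obtain ⟨p, hp⟩ := LinearMap.flip_injective_iff₁.mp hflip r
  exact ⟨p, fun q => by rw [← hB, hp]⟩

end SimpleFamily

/-! ### Corepresenting the functors X ↦ Hom(T X, s)* on projective objects -/

section Corepresentable

variable {k : Type w} [Field k] {C : Type u} [Category.{v} C] [Abelian C] [Linear k C]
  {P : C}

theorem IsProgenerator.exists_decomposition (hP : IsProgenerator P) (X : C) [Projective X] :
    ∃ (n : ℕ) (a : Fin n → (X ⟶ P)) (b : Fin n → (P ⟶ X)), ∑ i, a i ≫ b i = 𝟙 X := by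
  obtain ⟨n, b, hb⟩ := hP.exists_family X
  have : Epi (biproduct.desc b) := ⟨fun f g h => hb _ _ _ fun i => by
    simpa using congrArg (fun t => biproduct.ι (fun _ : Fin n => P) i ≫ t) h⟩
  refine ⟨n, fun i => Projective.factorThru (𝟙 X) (biproduct.desc b) ≫ biproduct.π _ i, b, ?_⟩
  obtain ⟨s, hs⟩ : ∃ s, s = Projective.factorThru (𝟙 X) (biproduct.desc b) := ⟨_, rfl⟩
  have h := Projective.factorThru_comp (𝟙 X) (biproduct.desc b)
  rw [← hs, biproduct.desc_eq, Preadditive.comp_sum] at h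
  simpa [← hs] using h

/-- An exact functor `T` with projective values makes `Hom(T(-), s)` dual to a corepresentable
functor. -/
theorem IsProgenerator.exists_corepresentation (hP : IsProgenerator P)
    (hfin : ∀ X Y : C, Module.Finite k (X ⟶ Y)) (T : C ⥤ C) [T.Additive] [T.Linear k]
    [PreservesFiniteLimits T] [PreservesFiniteColimits T] (hT : ∀ X, Projective (T.obj X))
    (s : C) :
    ∃ (R : C) (r : Module.Dual k (T.obj R ⟶ s)),
      (∀ (X : C) [Projective X] (y : Module.Dual k (T.obj X ⟶ s)),
        ∃ g : R ⟶ X, ∀ q : T.obj X ⟶ s, r (T.map g ≫ q) = y q) ∧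
      (∀ (X : C) (g : R ⟶ X), (∀ q, r (T.map g ≫ q) = 0) → g = 0) := by
  -- Among the pairs (R, r) whose comparison map C(R, P) ⟶ Hom(T P, s)* is onto, a smallest one is
  -- chosen; minimality will give injectivity.
  obtain ⟨⟨R, r⟩, hG, hmin⟩ := exists_forall_le_nat
    (fun a : Σ R : C, Module.Dual k (T.obj R ⟶ s) =>
      ∀ y : Module.Dual k (T.obj P ⟶ s), ∃ g : a.1 ⟶ P, ∀ q, a.2 (T.map g ≫ q) = y q)
    (fun a => Module.finrank k (P ⟶ a.1)) (by
      have := hfin (T.obj P) s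
      let β := Module.finBasis k (Module.Dual k (T.obj P ⟶ s))
      -- Some pair is onto: take one copy of P for each basis functional β l and let r apply β l on
      -- the l-th copy. A functional y is then reached from its coordinates.
      refine ⟨⟨⨁ fun _ : Fin (Module.finrank k (Module.Dual k (T.obj P ⟶ s))) => P,
        ∑ l, β l ∘ₗ Linear.leftComp k s (T.map (biproduct.ι (fun _ => P) l))⟩, fun y => ?_⟩
      refine ⟨biproduct.desc fun l => β.repr y l • 𝟙 P, fun q => ?_⟩
      conv_rhs => rw [← β.sum_repr y]
      simp only [LinearMap.coe_sum, Finset.sum_apply, LinearMap.comp_apply,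
        Linear.leftComp_apply, LinearMap.smul_apply]
      refine Finset.sum_congr rfl fun l _ => ?_
      rw [← Category.assoc, ← T.map_comp, biproduct.ι_desc, T.map_smul, T.map_id,
        Linear.smul_comp, Category.id_comp, map_smul])
  dsimp only at hG hmin
  refine ⟨R, r, fun X _ y => ?_, fun X g hg => ?_⟩
  · obtain ⟨n, a, b, hab⟩ := hP.exists_decomposition X
    choose g hg using fun i => hG (y ∘ₗ Linear.leftComp k s (T.map (a i)))
    refine ⟨∑ i, g i ≫ b i, fun q => ?_⟩
    have h1 : ∀ i, r (T.map (g i ≫ b i) ≫ q) = y (T.map (a i ≫ b i) ≫ q) := fun i => by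
      simpa using hg i (T.map (b i) ≫ q)
    rw [T.map_sum, Preadditive.sum_comp, map_sum, Finset.sum_congr rfl fun i _ => h1 i,
      ← map_sum, ← Preadditive.sum_comp, ← T.map_sum, hab, T.map_id, Category.id_comp]
  · let pre : (T.obj R ⟶ s) →ₗ[k] (T.obj (kernel g) ⟶ s) :=
      Linear.leftComp k s (T.map (kernel.ι g))
    -- The aim is that r only depends on the restriction to T(ker g). A map q vanishing on T(ker g)
    -- factors through T(im g) by exactness, and should extend to T X, where r vanishes by
    -- assumption.
    have hker : r ∈ (LinearMap.ker pre).dualAnnihilator := by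
      rw [Submodule.mem_dualAnnihilator]
      intro q hq
      have hq' : T.map (kernel.ι g) ≫ q = 0 := hq
      let S₁ : ShortComplex C := ShortComplex.mk (kernel.ι g) (factorThruImage g) (by
        rw [← cancel_mono (image.ι g), Category.assoc, image.fac, kernel.condition, zero_comp])
      have hS₁ : S₁.Exact := ShortComplex.exact_of_f_is_kernel _ (KernelFork.IsLimit.ofι _ _
        (fun t ht => kernel.lift g t (by rw [← image.fac g, reassoc_of% ht, zero_comp]))
        (fun t ht => kernel.lift_ι _ _ _)
        (fun t ht m hm => by rw [← cancel_mono (kernel.ι g), hm, kernel.lift_ι]))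
      have : Epi (S₁.map T).g := inferInstanceAs (Epi (T.map (factorThruImage g)))
      obtain ⟨q₁, hq₁⟩ := (hS₁.map T).desc' q hq'
      let S₂ : ShortComplex C := ShortComplex.mk (image.ι g) (cokernel.π (image.ι g))
        (cokernel.condition _)
      have hS₂ : S₂.ShortExact :=
        { exact := ShortComplex.exact_cokernel _
          mono_f := inferInstanceAs (Mono (image.ι g))
          epi_g := inferInstanceAs (Epi (cokernel.π _)) }
      -- Projectivity of T(coker) splits T(im g) ⟶ T X, which gives the required extension.
      have := hT (cokernel (image.ι g))
      have : Projective (S₂.map T).X₃ := this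
      let σ := (hS₂.map T).splittingOfProjective
      let ρ : T.obj X ⟶ T.obj (image g) := σ.r
      have hσ : T.map (image.ι g) ≫ ρ = 𝟙 _ := σ.f_r
      have hq₁' : T.map (factorThruImage g) ≫ q₁ = q := hq₁
      have : q = T.map g ≫ ρ ≫ q₁ := by
        have hg' : T.map g = T.map (factorThruImage g) ≫ T.map (image.ι g) := by
          rw [← T.map_comp, image.fac]
        rw [hg', Category.assoc]
        exact hq₁'.symm.trans (congrArg (T.map (factorThruImage g) ≫ ·)
          ((Category.id_comp q₁).symm.trans ((congrArg (· ≫ q₁) hσ.symm).trans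
            (Category.assoc _ _ _))))
      rw [this]
      exact hg _
    rw [← LinearMap.range_dualMap_eq_dualAnnihilator_ker] at hker
    obtain ⟨r', hr'⟩ := hker
    -- Since r comes from a functional r' for ker g, the pair (ker g, r') is again onto; minimality
    -- yields ker g = R.
    have hle := hmin ⟨kernel g, r'⟩ fun y => by
      obtain ⟨g', hg'⟩ := hG y
      refine ⟨kernel.ι g ≫ g', fun q => ?_⟩
      rw [← hg' q, ← hr', T.map_comp, Category.assoc]
      rfl
    have := hP.isIso_of_mono hfin (kernel.ι g) hle
    exact (cancel_epi (kernel.ι g)).mp (by simp)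

end Corepresentable


/-! ### Exact functors with projective values -/

section Decomposition

variable {k : Type w} [Field k] {C : Type u} [Category.{v} C] [Abelian C] [Linear k C]
  {P : C}

/-- Objects `R j`, functionals and morphisms which decompose an exact functor `T` with projective
values into the functors `X ↦ (R j ⟶ X) ⊗ Q j`. -/
structure SimpleFamily.Splitting (𝒮 : SimpleFamily k C) (T : C ⥤ C) where
  R : 𝒮.J → C
  r : ∀ j, Module.Dual k (T.obj (R j) ⟶ 𝒮.S j)
  p : ∀ j, 𝒮.Q j ⟶ T.obj (R j)
  exists_map : ∀ (j) (X : C) [Projective X] (y : Module.Dual k (T.obj X ⟶ 𝒮.S j)),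
    ∃ g : R j ⟶ X, ∀ q : T.obj X ⟶ 𝒮.S j, r j (T.map g ≫ q) = y q
  eq_zero : ∀ (j) (X : C) (g : R j ⟶ X), (∀ q, r j (T.map g ≫ q) = 0) → g = 0
  p_comp : ∀ j (q : T.obj (R j) ⟶ 𝒮.S j), p j ≫ q = r j q • 𝒮.π j

theorem IsProgenerator.nonempty_splitting (hP : IsProgenerator P)
    (hfin : ∀ X Y : C, Module.Finite k (X ⟶ Y)) (𝒮 : SimpleFamily k C)
    (T : C ⥤ C) [T.Additive] [T.Linear k]
    [PreservesFiniteLimits T] [PreservesFiniteColimits T] (hT : ∀ X, Projective (T.obj X)) :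
    Nonempty (𝒮.Splitting T) := by
  choose R r h1 h2 using fun j => hP.exists_corepresentation hfin T hT (𝒮.S j)
  choose p hp using fun j => 𝒮.exists_hom_of_dual hfin j (r j)
  exact ⟨⟨R, r, p, h1, h2, hp⟩⟩

namespace SimpleFamily.Splitting

variable {𝒮 : SimpleFamily k C} {T : C ⥤ C} (D : 𝒮.Splitting T)

section

variable [T.Additive] [T.Linear k] (X : C) (n : 𝒮.J → ℕ)
  (β : ∀ j, Module.Basis (Fin (n j)) k (D.R j ⟶ X))

/-- The natural map `⨁ j, (R j ⟶ X) ⊗ Q j ⟶ T X`. -/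
def desc : (⨁ fun i : Σ j, Fin (n j) => 𝒮.Q i.1) ⟶ T.obj X :=
  biproduct.desc fun i => D.p i.1 ≫ T.map (β i.1 i.2)

/-- A nonzero cokernel would have a nonzero map to some S j. The resulting map T X ⟶ S j is
annihilated by all functionals r j (T g ≫ -), and these exhaust the dual space. -/
theorem epi_desc (hP : IsProgenerator P) (hfin : ∀ X Y : C, Module.Finite k (X ⟶ Y))
    [Projective X] : Epi (D.desc X n β) := by
  refine Preadditive.epi_of_isZero_cokernel _ ?_
  by_contra hc
  obtain ⟨j, q, hq⟩ := 𝒮.exists_hom_ne_zero hP hfin hc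
  have hq' : cokernel.π (D.desc X n β) ≫ q ≠ 0 := fun h =>
    hq ((cancel_epi (cokernel.π (D.desc X n β))).mp (by rw [h, comp_zero]))
  obtain ⟨q', hqq⟩ : ∃ q', q' = cokernel.π (D.desc X n β) ≫ q := ⟨_, rfl⟩
  rw [← hqq] at hq'
  have hz : D.desc X n β ≫ q' = 0 := by rw [hqq, cokernel.condition_assoc, zero_comp]
  have hβ : ∀ b, D.r j (T.map (β j b) ≫ q') = 0 := fun b => by
    have h1 := congrArg (fun t => biproduct.ι (fun i : Σ j, Fin (n j) => 𝒮.Q i.1) ⟨j, b⟩ ≫ t) hz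
    rw [desc, biproduct.ι_desc_assoc, comp_zero, Category.assoc, D.p_comp] at h1
    exact (smul_eq_zero.mp h1).resolve_right (𝒮.π_ne_zero j)
  have hg : ∀ g : D.R j ⟶ X, D.r j (T.map g ≫ q') = 0 := fun g => by
    conv_lhs => rw [← (β j).sum_repr g]
    simp only [T.map_sum, T.map_smul, Preadditive.sum_comp, Linear.smul_comp, map_sum, map_smul,
      hβ, smul_zero, Finset.sum_const_zero]
  refine hq' ?_
  rw [← Module.forall_dual_apply_eq_zero_iff k]
  intro y
  obtain ⟨g, hy⟩ := D.exists_map j X y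
  rw [← hy, hg]

/-- The kernel splits off because T X is projective. A nonzero map from it to some S j would extend
to the whole sum, and injectivity of C(R j, X) ⟶ Hom(T X, S j)* shows that every such map factors
through T X, hence vanishes on the kernel. -/
theorem isIso_desc (hP : IsProgenerator P) (hfin : ∀ X Y : C, Module.Finite k (X ⟶ Y))
    (hT : ∀ X, Projective (T.obj X)) [Projective X] : IsIso (D.desc X n β) := by
  have := D.epi_desc X n β hP hfin
  suffices Mono (D.desc X n β) from isIso_of_mono_of_epi _
  refine Preadditive.mono_of_isZero_kernel _ ?_
  by_contra hc
  obtain ⟨j, κ, hκ⟩ := 𝒮.exists_hom_ne_zero hP hfin hc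
  have := hT X
  let σ : T.obj X ⟶ _ := Projective.factorThru (𝟙 (T.obj X)) (D.desc X n β)
  have hσ : σ ≫ D.desc X n β = 𝟙 _ := Projective.factorThru_comp _ _
  let ρ := kernel.lift (D.desc X n β) (𝟙 _ - D.desc X n β ≫ σ) (by
    rw [Preadditive.sub_comp, Category.id_comp, Category.assoc, hσ, Category.comp_id, sub_self])
  have hρ : kernel.ι (D.desc X n β) ≫ ρ = 𝟙 _ := by
    rw [← cancel_mono (kernel.ι (D.desc X n β)), Category.assoc, kernel.lift_ι]
    simp
  choose c hcc using fun b =>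
    𝒮.hom_eq_smul (biproduct.ι (fun i : Σ j, Fin (n j) => 𝒮.Q i.1) ⟨j, b⟩ ≫ ρ ≫ κ)
  let B : (T.obj X ⟶ 𝒮.S j) →ₗ[k] (D.R j ⟶ X) →ₗ[k] k :=
    LinearMap.mk₂ k (fun q g => D.r j (T.map g ≫ q))
      (by simp) (by simp) (by simp) (by simp)
  have := hfin (T.obj X) (𝒮.S j)
  have hB : Function.Injective B.flip := by
    rw [injective_iff_map_eq_zero]
    exact fun g hg => D.eq_zero j X g fun q => LinearMap.congr_fun hg q
  -- The map q : T X ⟶ S j is chosen to have the same coefficients c as ρ ≫ κ on all the copies of Q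
  -- j.
  obtain ⟨q, hq⟩ := LinearMap.flip_injective_iff₁.mp hB ((β j).constr k c)
  have hq' : ∀ b, D.r j (T.map (β j b) ≫ q) = c b := fun b => by
    have := LinearMap.congr_fun hq (β j b)
    rwa [Module.Basis.constr_basis] at this
  have hθ : D.desc X n β ≫ q = ρ ≫ κ := by
    refine biproduct.hom_ext' _ _ fun ⟨i, b⟩ => ?_
    by_cases hij : i = j
    · subst hij
      rw [hcc, desc, biproduct.ι_desc_assoc, Category.assoc, D.p_comp, hq']
    · exact (𝒮.hom_eq_zero hij _).trans (𝒮.hom_eq_zero hij _).symm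
  refine hκ ?_
  rw [← Category.id_comp κ, ← hρ, Category.assoc, ← hθ, kernel.condition_assoc, zero_comp]

end

variable [T.Additive] [T.Linear k]

/-- The inverse of the natural map `⨁ j, (R j ⟶ X) ⊗ Q j ⟶ T X`, in terms of its components. -/
theorem exists_components (hP : IsProgenerator P) (hfin : ∀ X Y : C, Module.Finite k (X ⟶ Y))
    (hT : ∀ X, Projective (T.obj X)) (X : C) [Projective X] :
    ∃ (n : 𝒮.J → ℕ) (β : ∀ j, Module.Basis (Fin (n j)) k (D.R j ⟶ X))
      (γ : ∀ j, Fin (n j) → (T.obj X ⟶ 𝒮.Q j)),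
      (∑ j, ∑ b, γ j b ≫ D.p j ≫ T.map (β j b) = 𝟙 _) ∧
      (∀ j (b) (g : D.R j ⟶ X), (D.p j ≫ T.map g) ≫ γ j b = (β j).repr g b • 𝟙 (𝒮.Q j)) ∧
      (∀ i j (_ : i ≠ j) (b) (g : D.R i ⟶ X), (D.p i ≫ T.map g) ≫ γ j b = 0) := by
  have := fun j => hfin (D.R j) X
  let n : 𝒮.J → ℕ := fun j => Module.finrank k (D.R j ⟶ X)
  let β : ∀ j, Module.Basis (Fin (n j)) k (D.R j ⟶ X) := fun j => Module.finBasis k _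
  have := D.isIso_desc X n β hP hfin hT
  let γ : ∀ j, Fin (n j) → (T.obj X ⟶ 𝒮.Q j) := fun j b =>
    inv (D.desc X n β) ≫ biproduct.π (fun i : Σ j, Fin (n j) => 𝒮.Q i.1) ⟨j, b⟩
  have hι : ∀ i b, D.p i ≫ T.map (β i b) =
      biproduct.ι (fun i : Σ j, Fin (n j) => 𝒮.Q i.1) ⟨i, b⟩ ≫ D.desc X n β := fun i b => by
    rw [desc, biproduct.ι_desc]
  have hexp : ∀ (i j) (b) (g : D.R i ⟶ X), (D.p i ≫ T.map g) ≫ γ j b =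
      ∑ b', (β i).repr g b' • (biproduct.ι (fun i : Σ j, Fin (n j) => 𝒮.Q i.1) ⟨i, b'⟩ ≫
        biproduct.π (fun i : Σ j, Fin (n j) => 𝒮.Q i.1) ⟨j, b⟩) := fun i j b g => by
    conv_lhs => rw [← (β i).sum_repr g]
    simp only [T.map_sum, T.map_smul, Preadditive.comp_sum, Preadditive.sum_comp, Linear.comp_smul,
      Linear.smul_comp, hι, γ, Category.assoc, IsIso.hom_inv_id_assoc]
  refine ⟨n, β, γ, ?_, fun j b g => ?_, fun i j hij b g => ?_⟩
  · have h : inv (D.desc X n β) ≫ (∑ i, biproduct.π (fun i : Σ j, Fin (n j) => 𝒮.Q i.1) i ≫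
        biproduct.ι (fun i : Σ j, Fin (n j) => 𝒮.Q i.1) i) ≫ D.desc X n β = 𝟙 _ := by
      have ht : ∑ i, biproduct.π (fun i : Σ j, Fin (n j) => 𝒮.Q i.1) i ≫
          biproduct.ι (fun i : Σ j, Fin (n j) => 𝒮.Q i.1) i = 𝟙 _ := by
        refine biproduct.hom_ext' _ _ fun i => ?_
        rw [Preadditive.comp_sum, Finset.sum_eq_single i]
        · rw [biproduct.ι_π_self_assoc, Category.comp_id]
        · intro i' _ h
          rw [biproduct.ι_π_ne_assoc _ h.symm, zero_comp]
        · simp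
      rw [ht, Category.id_comp, IsIso.inv_hom_id]
    rw [Finset.sum_sigma' (f := fun j b => γ j b ≫ D.p j ≫ T.map (β j b)), ← h]
    simp only [Preadditive.comp_sum, Preadditive.sum_comp, Category.assoc, ← hι, γ]
    rfl
  · rw [hexp, Finset.sum_eq_single b]
    · rw [biproduct.ι_π_self]
    · intro b' _ hb'
      rw [biproduct.ι_π_ne _ (by simpa using hb'), smul_zero]
    · simp
  · rw [hexp]
    refine Finset.sum_eq_zero fun b' _ => ?_
    rw [biproduct.ι_π_ne _ (fun h => hij (congrArg Sigma.fst h)), smul_zero]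

end SimpleFamily.Splitting

end Decomposition

/-! ### Splittings of bimodules -/

section BarSplitting

variable {k : Type w} [Field k] {A : Type u} [Category.{v} A] [Preadditive A] [Linear k A]

/-- The action map `A(q, Y) ⊗ F(X, q) ⟶ F(X, Y)` of a linear bimodule. -/
def bimoduleMul (F : Aᵒᵖ ⥤ A ⥤ ModuleCat.{t} k) [IsLinearBimodule k F] (q X Y : A) :
    (q ⟶ Y) ⊗[k] ((F.obj (op X)).obj q) →ₗ[k] (F.obj (op X)).obj Y :=
  TensorProduct.lift (bimoduleActRight F (𝟙 X))

/-- A natural map `F(X, Y) ⟶ A(q, Y) ⊗ F(X, q)`. -/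
structure BimoduleFactorization (F : Aᵒᵖ ⥤ A ⥤ ModuleCat.{t} k) (q : A) where
  τ : ∀ X Y : A, (F.obj (op X)).obj Y →ₗ[k] (q ⟶ Y) ⊗[k] ((F.obj (op X)).obj q)
  naturality : ∀ {X X' Y Y' : A} (p : X' ⟶ X) (f : Y ⟶ Y') (h : (F.obj (op X)).obj Y),
    τ X' Y' (bimoduleAct F p f h) =
      TensorProduct.map (Linear.rightComp k q f) (bimoduleAct F p (𝟙 q)) (τ X Y h)

/-- A bimodule is split if it is a direct summand of a finite direct sum of bimodules
`A(q, Y) ⊗ F(X, q)`. -/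
def IsSplitBimodule (F : Aᵒᵖ ⥤ A ⥤ ModuleCat.{t} k) [IsLinearBimodule k F] : Prop :=
  ∃ (J : Type u) (_ : Fintype J) (q : J → A) (τ : ∀ j, BimoduleFactorization F (q j)),
    ∀ (X Y : A) (h : (F.obj (op X)).obj Y), ∑ j, bimoduleMul F (q j) X Y ((τ j).τ X Y h) = h

end BarSplitting

section Split

variable {k : Type w} [Field k] {C : Type u} [Category.{v} C] [Abelian C] [Linear k C]
  {P : C}

/-- The linear equivalence between morphisms of `C` and of the full subcategory of projectives. -/
def projHomEquiv (X Y : Proj C) : (X.obj ⟶ Y.obj) ≃ₗ[k] (X ⟶ Y) where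
  toFun f := ObjectProperty.homMk f
  invFun f := f.hom
  left_inv _ := rfl
  right_inv _ := rfl
  map_add' _ _ := rfl
  map_smul' _ _ := rfl

/-- A morphism h : T X ⟶ Y is recovered from its restrictions to the copies of Q j in T X. The
tensor of these restrictions with the projections γ does not depend on the basis of C(R j, X), hence
is natural in X although the bases are chosen object by object. -/
theorem SimpleFamily.Splitting.isSplitBimodule {𝒮 : SimpleFamily k C} {T : C ⥤ C}
    (D : 𝒮.Splitting T) [T.Additive] [T.Linear k] (hP : IsProgenerator P)
    (hfin : ∀ X Y : C, Module.Finite k (X ⟶ Y)) (hT : ∀ X, Projective (T.obj X)) :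
    IsSplitBimodule (twistedHom k T) := by
  choose n β γ h1 h2 h3 using fun X : Proj C =>
    have : Projective X.obj := X.property
    D.exists_components hP hfin hT X.obj
  let q : 𝒮.J → Proj C := fun j => ⟨𝒮.Q j, 𝒮.projective j⟩
  let τ : ∀ (j) (X Y : Proj C), (T.obj X.obj ⟶ Y.obj) →ₗ[k]
      (q j ⟶ Y) ⊗[k] (T.obj X.obj ⟶ 𝒮.Q j) := fun j X Y =>
    ∑ b, (TensorProduct.mk k (q j ⟶ Y) (T.obj X.obj ⟶ 𝒮.Q j)).flip (γ X j b) ∘ₗ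
      (projHomEquiv (q j) Y).toLinearMap ∘ₗ Linear.leftComp k Y.obj (D.p j ≫ T.map (β X j b))
  have hτ : ∀ j X Y h, τ j X Y h = ∑ b, (ObjectProperty.homMk ((D.p j ≫ T.map (β X j b)) ≫ h) :
      q j ⟶ Y) ⊗ₜ[k] γ X j b := fun j X Y h => by
    simp only [τ, LinearMap.coe_sum, Finset.sum_apply]
    rfl
  refine ⟨𝒮.J, 𝒮.fintype, q, fun j => ⟨τ j, fun {X X' Y Y'} p f h => ?_⟩, fun X Y h => ?_⟩
  · change T.obj X.obj ⟶ Y.obj at h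
    -- The matrix of postcomposition with p in the chosen bases appears here on the projections and
    -- in `hβ` on the restrictions, so it can be moved across the tensor sign.
    have hγ : ∀ b, T.map p.hom ≫ γ X j b =
        ∑ b', (β X j).repr (β X' j b' ≫ p.hom) b • γ X' j b' := fun b => by
      rw [← Category.id_comp (T.map p.hom ≫ γ X j b), ← h1 X', Preadditive.sum_comp,
        Finset.sum_eq_single j]
      · rw [Preadditive.sum_comp]
        refine Finset.sum_congr rfl fun b' _ => ?_
        have := h2 X j b (β X' j b' ≫ p.hom)
        rw [T.map_comp] at this
        simp only [Category.assoc] at this ⊢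
        rw [this, Linear.comp_smul, Category.comp_id]
      · intro i _ hij
        rw [Preadditive.sum_comp]
        refine Finset.sum_eq_zero fun b' _ => ?_
        have := h3 X i j hij b (β X' i b' ≫ p.hom)
        rw [T.map_comp] at this
        simp only [Category.assoc] at this ⊢
        rw [this, comp_zero]
      · simp
    have hβ : ∀ b', (D.p j ≫ T.map (β X' j b')) ≫ ((T.map p.hom ≫ h) ≫ f.hom) =
        ∑ b, (β X j).repr (β X' j b' ≫ p.hom) b •
          (((D.p j ≫ T.map (β X j b)) ≫ h) ≫ f.hom) := fun b' => by
      have : T.map (β X' j b') ≫ T.map p.hom =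
          ∑ b, (β X j).repr (β X' j b' ≫ p.hom) b • T.map (β X j b) := by
        rw [← T.map_comp]
        conv_lhs => rw [← (β X j).sum_repr (β X' j b' ≫ p.hom)]
        simp only [T.map_sum, T.map_smul]
      simp only [Category.assoc]
      rw [reassoc_of% this]
      simp only [Preadditive.comp_sum, Preadditive.sum_comp, Linear.smul_comp, Linear.comp_smul]
    have hl : ∀ b', (ObjectProperty.homMk ((D.p j ≫ T.map (β X' j b')) ≫
        ((T.map p.hom ≫ h) ≫ f.hom)) : q j ⟶ Y') =
        ∑ b, (β X j).repr (β X' j b' ≫ p.hom) b •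
          (ObjectProperty.homMk (((D.p j ≫ T.map (β X j b)) ≫ h) ≫ f.hom) : q j ⟶ Y') :=
      fun b' => by
        rw [hβ]
        exact (map_sum (projHomEquiv (k := k) (q j) Y') _ _)
    have main : ∑ b, (ObjectProperty.homMk ((D.p j ≫ T.map (β X' j b)) ≫
        ((T.map p.hom ≫ h) ≫ f.hom)) : q j ⟶ Y') ⊗ₜ[k] γ X' j b =
        ∑ b, (ObjectProperty.homMk (((D.p j ≫ T.map (β X j b)) ≫ h) ≫ f.hom) : q j ⟶ Y')
          ⊗ₜ[k] ((T.map p.hom ≫ γ X j b) ≫ 𝟙 _) := by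
      simp only [hl, Category.comp_id, hγ, TensorProduct.sum_tmul, TensorProduct.tmul_sum]
      rw [Finset.sum_comm]
      simp only [TensorProduct.smul_tmul]
    refine (hτ j X' Y' ((T.map p.hom ≫ h) ≫ f.hom)).trans (main.trans ?_)
    refine Eq.symm ((congrArg (TensorProduct.map (Linear.rightComp k (q j) f)
      (bimoduleAct (twistedHom k T) p (𝟙 (q j)))) (hτ j X Y h)).trans ?_)
    exact map_sum (TensorProduct.map (Linear.rightComp k (q j) f)
      (bimoduleAct (twistedHom k T) p (𝟙 (q j)))) _ _
  · change T.obj X.obj ⟶ Y.obj at h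
    have : ∀ j, bimoduleMul (twistedHom k T) (q j) X Y (τ j X Y h) =
        ∑ b, (γ X j b ≫ D.p j ≫ T.map (β X j b)) ≫ h := fun j => by
      erw [hτ, map_sum]
      refine Finset.sum_congr rfl fun b _ => ?_
      change (T.map (𝟙 _) ≫ γ X j b) ≫ ((D.p j ≫ T.map (β X j b)) ≫ h) = _
      rw [T.map_id, Category.id_comp]
      simp only [Category.assoc]
    have main : ∑ j, ∑ b, (γ X j b ≫ D.p j ≫ T.map (β X j b)) ≫ h = h := by
      simp only [← Preadditive.sum_comp]
      rw [h1, Category.id_comp]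
    exact (Finset.sum_congr rfl fun j _ => this j).trans main

end Split

/-! ### Acyclicity of the bar construction of a split bimodule -/

section Strings

variable {A : Type u} [Category.{v} A] {n : ℕ}

theorem stringComp_eq_eqToHom {X : Fin (n + 1) → A} (f : ∀ i : Fin n, X i.succ ⟶ X i.castSucc)
    {a b : Fin (n + 1)} (h : a ≤ b) (hab : b = a) :
    stringComp f h = eqToHom (congrArg X hab) := by
  subst hab
  exact stringComp_refl f b

theorem stringComp_eqToHom {X : Fin (n + 1) → A} (f : ∀ i : Fin n, X i.succ ⟶ X i.castSucc)
    {a b a' b' : Fin (n + 1)} (h : a ≤ b) (h' : a' ≤ b') (ha : a = a') (hb : b = b') :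
    stringComp f h = eqToHom (congrArg X hb) ≫ stringComp f h' ≫ eqToHom (congrArg X ha.symm) := by
  subst ha hb
  simp

/-- The restriction of a string to all but its last morphism. -/
def stringInit {X : Fin (n + 2) → A} (f : ∀ i : Fin (n + 1), X i.succ ⟶ X i.castSucc)
    (i : Fin n) : (X ∘ Fin.castSucc) i.succ ⟶ (X ∘ Fin.castSucc) i.castSucc :=
  f i.castSucc

theorem stringComp_stringInit {X : Fin (n + 2) → A}
    (f : ∀ i : Fin (n + 1), X i.succ ⟶ X i.castSucc) {a b : Fin (n + 1)} (h : a ≤ b) :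
    stringComp (X := X ∘ Fin.castSucc) (stringInit f) h =
      stringComp f (Fin.castSucc_le_castSucc_iff.mpr h) := by
  have h1 : stringInit f = stringPull f (Fin.castSuccOrderEmb.toOrderHom) :=
    funext fun i => (stringComp_succ f i.castSucc).symm
  rw [h1]
  exact stringComp_stringPull f _ h

end Strings

section Bar

variable {k : Type w} [Field k] {A : Type u} [Category.{v} A] [Preadditive A] [Linear k A]

/-- For families of objects that agree only propositionally; all transports are absorbed into
`eqToHom`. -/
theorem barElt_eq (F : Aᵒᵖ ⥤ A ⥤ ModuleCat.{t} k) {n : ℕ} {X Y : Fin (n + 1) → A}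
    (f : ∀ i : Fin n, X i.succ ⟶ X i.castSucc) (g : ∀ i : Fin n, Y i.succ ⟶ Y i.castSucc)
    (x : (F.obj (op (X 0))).obj (X (Fin.last n))) (y : (F.obj (op (Y 0))).obj (Y (Fin.last n)))
    (h : ∀ i, X i = Y i) (hf : ∀ i, f i = eqToHom (h _) ≫ g i ≫ eqToHom (h _).symm)
    (hx : y = bimoduleAct F (eqToHom (h _).symm) (eqToHom (h _)) x) :
    barElt F X f x = barElt F Y g y := by
  obtain rfl : X = Y := funext h
  have h1 : f = g := funext fun i => by simpa using hf i
  have h2 : y = x := by simpa [bimoduleAct_id] using hx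
  rw [h1, h2]

theorem barElt_add (F : Aᵒᵖ ⥤ A ⥤ ModuleCat.{t} k) {n : ℕ} (X : Fin (n + 1) → A)
    (f : ∀ i : Fin n, X i.succ ⟶ X i.castSucc) (x y : (F.obj (op (X 0))).obj (X (Fin.last n))) :
    barElt F X f (x + y) = barElt F X f x + barElt F X f y := by
  unfold barElt
  rw [TensorProduct.tmul_add, map_add]

theorem barElt_zero (F : Aᵒᵖ ⥤ A ⥤ ModuleCat.{t} k) {n : ℕ} (X : Fin (n + 1) → A)
    (f : ∀ i : Fin n, X i.succ ⟶ X i.castSucc) : barElt F X f 0 = 0 := by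
  unfold barElt
  rw [TensorProduct.tmul_zero, map_zero]

theorem barElt_sum (F : Aᵒᵖ ⥤ A ⥤ ModuleCat.{t} k) {n : ℕ} (X : Fin (n + 1) → A)
    (f : ∀ i : Fin n, X i.succ ⟶ X i.castSucc) {J : Type*} (s : Finset J)
    (x : J → (F.obj (op (X 0))).obj (X (Fin.last n))) :
    barElt F X f (∑ j ∈ s, x j) = ∑ j ∈ s, barElt F X f (x j) := by
  unfold barElt
  rw [TensorProduct.tmul_sum, map_sum]

/-- Appending a morphism to a string, as a linear map. -/
def barSnoc (F : Aᵒᵖ ⥤ A ⥤ ModuleCat.{t} k) {n : ℕ} (X : Fin (n + 2) → A) :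
    (⨂[k] i : Fin n, ((X ∘ Fin.castSucc) i.succ ⟶ (X ∘ Fin.castSucc) i.castSucc)) →ₗ[k]
      (((X (Fin.last (n + 1)) ⟶ X (Fin.last n).castSucc) ⊗[k]
        ((F.obj (op (X 0))).obj (X (Fin.last (n + 1))))) →ₗ[k] BarSummand F X) :=
  PiTensorProduct.lift ((LinearMap.rTensorHom _).compMultilinearMap
    (PiTensorProduct.tprod k (s := fun i : Fin (n + 1) => (X i.succ ⟶ X i.castSucc))).curryRight)

/-- The shorter string is presented as the initial part of a longer string f whose last morphism is
a placeholder to be overwritten by a. Computations with the contraction are kept in this form to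
avoid rewriting along `Fin.snoc`. -/
theorem barSnoc_tprod (F : Aᵒᵖ ⥤ A ⥤ ModuleCat.{t} k) {n : ℕ} (X : Fin (n + 2) → A)
    (f : ∀ i : Fin (n + 1), X i.succ ⟶ X i.castSucc)
    (a : X (Fin.last (n + 1)) ⟶ X (Fin.last n).castSucc)
    (y : (F.obj (op (X 0))).obj (X (Fin.last (n + 1)))) :
    barSnoc F X (PiTensorProduct.tprod k (stringInit f)) (a ⊗ₜ[k] y) =
      PiTensorProduct.tprod k (Function.update f (Fin.last n) a) ⊗ₜ[k] y := by
  have h1 : barSnoc F X (PiTensorProduct.tprod k (stringInit f)) =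
      LinearMap.rTensor _ ((PiTensorProduct.tprod k
        (s := fun i : Fin (n + 1) => (X i.succ ⟶ X i.castSucc))).curryRight (stringInit f)) := by
    unfold barSnoc
    exact PiTensorProduct.lift.tprod _
  rw [h1]
  refine congrArg (fun z => PiTensorProduct.tprod k z ⊗ₜ[k] y) ?_
  funext i
  refine Fin.lastCases ?_ (fun i => ?_) i
  · exact (Fin.snoc_last (α := fun i : Fin (n + 1) => (X i.succ ⟶ X i.castSucc)) a
      (stringInit f)).trans (Function.update_self (Fin.last n) a f).symm
  · exact (Fin.snoc_castSucc (α := fun i : Fin (n + 1) => (X i.succ ⟶ X i.castSucc)) a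
      (stringInit f) i).trans (Function.update_of_ne (Fin.castSucc_lt_last i).ne _ _).symm

namespace BimoduleFactorization

variable {F : Aᵒᵖ ⥤ A ⥤ ModuleCat.{t} k} {q : A} (τ : BimoduleFactorization F q)

/-- The contraction on the summand indexed by `X₀, …, Xₙ`, where `Xₙ₊₁ = q`. -/
def contractSummand {n : ℕ} (X : Fin (n + 1) → A) (X' : Fin (n + 2) → A)
    (e : X' ∘ Fin.castSucc = X) (e' : X' (Fin.last _) = q) :
    BarSummand F X →ₗ[k] BarSimplices F (n + 1) := by
  classical
  subst e e'
  exact DirectSum.lof k (Fin (n + 2) → A) (fun X => BarSummand F X) X' ∘ₗ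
    TensorProduct.lift (LinearMap.lcomp k _ (τ.τ (X' 0) (X' (Fin.last n).castSucc)) ∘ₗ barSnoc F X')

open Classical in
/-- The contraction of the bar construction given by a factorization of a bimodule. -/
def contract (n : ℕ) : BarSimplices F n →ₗ[k] BarSimplices F (n + 1) :=
  DirectSum.toModule k _ _ fun X => τ.contractSummand X (Fin.snoc X q)
    (funext fun i => Fin.snoc_castSucc (α := fun _ => A) q X i)
    (Fin.snoc_last (α := fun _ => A) q X)

variable [IsLinearBimodule k F]

/-- The value of the contraction on an elementary tensor, as a function of `τ`. -/
def contractValue {n : ℕ} (X : Fin (n + 2) → A)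
    (f : ∀ i : Fin (n + 1), X i.succ ⟶ X i.castSucc) (e : X (Fin.last _) = q) :
    (q ⟶ X (Fin.last n).castSucc) ⊗[k] ((F.obj (op (X 0))).obj q) →ₗ[k]
      BarSimplices F (n + 1) := by
  classical
  exact DirectSum.lof k (Fin (n + 2) → A) (fun X => BarSummand F X) X ∘ₗ
    TensorProduct.map ((PiTensorProduct.tprod k).toLinearMap f (Fin.last n) ∘ₗ
      Linear.leftComp k _ (eqToHom e)) (bimoduleAct F (𝟙 _) (eqToHom e.symm))

omit [IsLinearBimodule k F] in
theorem contractValue_tmul {n : ℕ} (X : Fin (n + 2) → A)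
    (f : ∀ i : Fin (n + 1), X i.succ ⟶ X i.castSucc) (e : X (Fin.last _) = q)
    (a : q ⟶ X (Fin.last n).castSucc) (y : (F.obj (op (X 0))).obj q) :
    contractValue X f e (a ⊗ₜ[k] y) = barElt F X (Function.update f (Fin.last n) (eqToHom e ≫ a))
      (bimoduleAct F (𝟙 _) (eqToHom e.symm) y) := rfl

omit [IsLinearBimodule k F] in
theorem contract_barElt {n : ℕ} (X : Fin (n + 2) → A)
    (f : ∀ i : Fin (n + 1), X i.succ ⟶ X i.castSucc) (e : X (Fin.last _) = q)
    (x : (F.obj (op (X 0))).obj (X (Fin.last n).castSucc)) :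
    τ.contract n (barElt F (X ∘ Fin.castSucc) (stringInit f) x) =
      contractValue X f e (τ.τ _ _ x) := by
  classical
  -- The family `Fin.snoc _ q` of the definition is equal to X only propositionally; generalizing it
  -- allows the substitution.
  have h1 : ∀ (X' : Fin (n + 2) → A) (h : X' = X) (e₁ : X' ∘ Fin.castSucc = X ∘ Fin.castSucc)
      (e₂ : X' (Fin.last _) = q), τ.contractSummand (X ∘ Fin.castSucc) X' e₁ e₂ =
        τ.contractSummand (X ∘ Fin.castSucc) X rfl e := by
    rintro X' rfl e₁ e₂
    rfl
  unfold contract barElt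
  erw [DirectSum.toModule_lof]
  rw [h1]
  · subst e
    change DirectSum.lof k _ (fun X => BarSummand F X) X (barSnoc F X
      (PiTensorProduct.tprod k (stringInit f)) (τ.τ _ _ x)) = _
    generalize τ.τ (X 0) (X (Fin.last n).castSucc) x = z
    induction z using TensorProduct.induction_on with
    | zero => simp only [map_zero]
    | add z z' h h' => simp only [map_add, h, h']
    | tmul a y =>
      rw [barSnoc_tprod, contractValue_tmul]
      simp only [eqToHom_refl, Category.id_comp, bimoduleAct_id, LinearMap.id_apply]
      rfl
  · funext i
    refine Fin.lastCases ?_ (fun i => ?_) i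
    · exact (Fin.snoc_last (α := fun _ => A) q _).trans e.symm
    · exact Fin.snoc_castSucc (α := fun _ => A) q _ i

-- Every string can be brought into the form for which the contraction is computed. The added last
-- morphism is 0, an irrelevant value since the contraction overwrites it.
omit [Linear k A] [IsLinearBimodule k F] in
theorem exists_stringInit (q : A) {n : ℕ} (X : Fin (n + 1) → A)
    (f : ∀ i : Fin n, X i.succ ⟶ X i.castSucc) :
    ∃ (X' : Fin (n + 2) → A) (e : X' ∘ Fin.castSucc = X) (_ : X' (Fin.last _) = q)
      (f' : ∀ i : Fin (n + 1), X' i.succ ⟶ X' i.castSucc), e ▸ stringInit f' = f := by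
  obtain ⟨X', rfl, e⟩ : ∃ X' : Fin (n + 2) → A, X' ∘ Fin.castSucc = X ∧ X' (Fin.last _) = q :=
    ⟨Fin.snoc X q, funext fun i => Fin.snoc_castSucc (α := fun _ => A) q X i,
      Fin.snoc_last (α := fun _ => A) q X⟩
  let f' : ∀ i : Fin (n + 1), X' i.succ ⟶ X' i.castSucc := fun i =>
    Fin.lastCases (motive := fun i => X' i.succ ⟶ X' i.castSucc) 0 (fun i => f i) i
  exact ⟨X', rfl, e, f', funext fun i =>
    Fin.lastCases_castSucc (motive := fun i => X' i.succ ⟶ X' i.castSucc) i⟩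

omit [IsLinearBimodule k F] in
/-- Linear maps out of the bar construction agree if they agree on all strings which are obtained
by removing the last morphism of a longer string ending in `q`. -/
theorem bar_hom_ext_stringInit (q : A) {n : ℕ} {M : Type*} [AddCommGroup M]
    [Module k M] {g h : BarSimplices F n →ₗ[k] M}
    (H : ∀ (X : Fin (n + 2) → A) (f : ∀ i : Fin (n + 1), X i.succ ⟶ X i.castSucc)
      (_ : X (Fin.last _) = q) (x : (F.obj (op (X 0))).obj (X (Fin.last n).castSucc)),
      g (barElt F (X ∘ Fin.castSucc) (stringInit f) x) =
        h (barElt F (X ∘ Fin.castSucc) (stringInit f) x)) : g = h := by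
  refine bar_hom_ext fun X f x => ?_
  obtain ⟨X', rfl, e, f', rfl⟩ := exists_stringInit q X f
  exact H X' f' e x

/-- The operators that keep the appended vertex q in the last place commute with the contraction.
Morphisms after θ(m) act on F before contracting, and are composed with the appended morphism after
it; the naturality of τ says that this is the same. All faces but the last are covered. -/
theorem barOp_contract {n m : ℕ} (θ : Fin (m + 1) →o Fin (n + 1))
    (θ' : Fin (m + 2) →o Fin (n + 2)) (h : ∀ i, θ' i.castSucc = (θ i).castSucc)
    (hl : θ' (Fin.last _) = Fin.last _) (z : BarSimplices F n) :
    barOp F θ' (τ.contract n z) = τ.contract m (barOp F θ z) := by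
  suffices barOp F θ' ∘ₗ τ.contract n = τ.contract m ∘ₗ barOp F θ from LinearMap.congr_fun this z
  refine bar_hom_ext_stringInit (M := BarSimplices F (m + 1)) q fun X f e x => ?_
  have hlast : θ' (Fin.last m).castSucc ≤ (Fin.last n).castSucc := by
    rw [h]
    exact Fin.castSucc_le_castSucc_iff.mpr (Fin.le_last _)
  let p := stringComp f (Fin.zero_le (θ' 0))
  let c := stringComp f hlast
  have e' : (X ∘ θ') (Fin.last _) = q := (congrArg X hl).trans e
  have key : barElt F ((X ∘ Fin.castSucc) ∘ θ) (stringPull (X := X ∘ Fin.castSucc) (stringInit f) θ)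
      (bimoduleAct F (stringComp (X := X ∘ Fin.castSucc) (stringInit f) (Fin.zero_le (θ 0)))
        (stringComp (X := X ∘ Fin.castSucc) (stringInit f) (Fin.le_last (θ (Fin.last m)))) x) =
      barElt F ((X ∘ θ') ∘ Fin.castSucc) (stringInit (stringPull f θ'))
        (bimoduleAct F p c x) := by
    refine barElt_eq F _ _ _ _ (fun i => congrArg X (h i).symm) (fun i => ?_) ?_
    · unfold stringPull
      rw [stringComp_stringInit]
      exact stringComp_eqToHom f _ _ (h i.castSucc).symm (h i.succ).symm
    · refine Eq.trans ?_ (LinearMap.congr_fun (bimoduleAct_comp F _ _ _ _) x)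
      have hp : p = eqToHom (congrArg X (h 0)) ≫
          stringComp (X := X ∘ Fin.castSucc) (stringInit f) (Fin.zero_le (θ 0)) := by
        rw [stringComp_stringInit]
        refine (stringComp_eqToHom f _ (Fin.castSucc_le_castSucc_iff.mpr (Fin.zero_le (θ 0)))
          rfl (h 0)).trans ?_
        rw [eqToHom_refl, Category.comp_id]
      have hc : c = stringComp (X := X ∘ Fin.castSucc) (stringInit f) (Fin.le_last (θ (Fin.last m)))
          ≫ eqToHom (congrArg X (h (Fin.last m)).symm) := by
        rw [stringComp_stringInit]
        refine (stringComp_eqToHom f _ (Fin.castSucc_le_castSucc_iff.mpr (Fin.le_last _))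
          (h _) rfl).trans ?_
        rw [eqToHom_refl, Category.id_comp]
      exact congrArg₂ (fun a b => bimoduleAct F a b x) hp hc
  refine (congrArg (barOp F θ') (τ.contract_barElt X f e x)).trans (Eq.trans ?_
    ((congrArg (τ.contract m) ((barOp_barElt F θ (X ∘ Fin.castSucc) (stringInit f) x).trans
      key)).trans (τ.contract_barElt (X ∘ θ') (stringPull f θ') e' (bimoduleAct F p c x))).symm)
  refine Eq.trans ?_ (congrArg (contractValue (X ∘ θ') (stringPull f θ') e')
    (τ.naturality p c x)).symm
  generalize τ.τ (X 0) (X (Fin.last n).castSucc) x = z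
  induction z using TensorProduct.induction_on with
  | zero => simp only [map_zero]
  | add z z' h h' => simp only [map_add, h, h']
  | tmul a y =>
    rw [TensorProduct.map_tmul]
    erw [contractValue_tmul, contractValue_tmul]
    rw [barOp_barElt]
    -- Pulling back along θ' composes the appended morphism a with c, the composite of the morphisms
    -- that θ drops at the end.
    have hstr : stringPull (Function.update f (Fin.last n) (eqToHom e ≫ a)) θ' =
        Function.update (stringPull f θ') (Fin.last m) (eqToHom e' ≫ a ≫ c) := by
      funext i
      refine Fin.lastCases ?_ (fun i => ?_) i
      · rw [Function.update_self]
        have h2 : (Fin.last n).succ ≤ θ' (Fin.last m).succ := hl.ge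
        refine (stringComp_update f (Fin.last n) _ hlast h2).trans ?_
        rw [stringComp_eq_eqToHom f h2 hl, Category.assoc, eqToHom_trans_assoc]
      · rw [Function.update_of_ne (Fin.castSucc_lt_last i).ne]
        refine stringComp_update_of_not f _ _ _ fun hh => ?_
        have h3 : θ' i.castSucc.succ = (θ i.succ).castSucc := h i.succ
        rw [h3] at hh
        exact absurd hh.2 (not_le.mpr (Fin.castSucc_lt_last _))
    rw [hstr]
    refine congrArg (barElt F _ _) ?_
    have h0 : stringComp (Function.update f (Fin.last n) (eqToHom e ≫ a)) (Fin.zero_le (θ' 0)) =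
        p := by
      refine stringComp_update_of_not f _ _ _ fun hh => ?_
      have h3 : θ' 0 = (θ 0).castSucc := h 0
      rw [h3] at hh
      exact absurd hh.2 (not_le.mpr (Fin.castSucc_lt_last _))
    rw [h0, stringComp_eq_eqToHom _ _ hl.symm, ← LinearMap.comp_apply, ← LinearMap.comp_apply,
      ← bimoduleAct_comp]
    erw [← bimoduleAct_comp]
    simp

/-- The last face removes q and lets the appended morphism act on F, which undoes the factorization
τ by multiplying its two factors. -/
theorem barOp_castSucc_contract {n : ℕ} (X : Fin (n + 1) → A)
    (f : ∀ i : Fin n, X i.succ ⟶ X i.castSucc) (x : (F.obj (op (X 0))).obj (X (Fin.last n))) :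
    barOp F Fin.castSuccOrderEmb.toOrderHom (τ.contract n (barElt F X f x)) =
      barElt F X f (bimoduleMul F q _ _ (τ.τ _ _ x)) := by
  obtain ⟨X', rfl, e, f', rfl⟩ := exists_stringInit q X f
  refine (congrArg (barOp F Fin.castSuccOrderEmb.toOrderHom)
    (τ.contract_barElt X' f' e x)).trans ?_
  change _ = barElt F (X' ∘ Fin.castSucc) (stringInit f') (bimoduleMul F q (X' 0)
    (X' (Fin.last n).castSucc) (τ.τ (X' 0) (X' (Fin.last n).castSucc) x))
  subst e
  generalize τ.τ (X' 0) (X' (Fin.last n).castSucc) x = z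
  induction z using TensorProduct.induction_on with
  | zero =>
    simp only [map_zero]
    exact (barElt_zero F _ _).symm
  | add z z' h h' =>
    simp only [map_add, h, h']
    exact (barElt_add F (X' ∘ Fin.castSucc) _ _ _).symm
  | tmul a y =>
    rw [contractValue_tmul, barOp_barElt]
    simp only [eqToHom_refl, Category.id_comp, bimoduleAct_id, LinearMap.id_apply]
    have h1 : stringPull (Function.update f' (Fin.last n) a) Fin.castSuccOrderEmb.toOrderHom =
        stringInit f' := by
      funext i
      exact (stringComp_succ _ i.castSucc).trans
        (Function.update_of_ne (Fin.castSucc_lt_last i).ne _ _)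
    refine (congrArg (fun g => barElt F (X' ∘ Fin.castSucc) g _) h1).trans ?_
    refine congrArg (barElt F (X' ∘ Fin.castSucc) (stringInit f')) ?_
    have h2 : stringComp (Function.update f' (Fin.last n) a) (Fin.zero_le 0) = 𝟙 _ :=
      stringComp_refl _ _
    have h3 : stringComp (Function.update f' (Fin.last n) a)
        (Fin.castSucc_le_succ (Fin.last n)) = a :=
      (stringComp_succ _ _).trans (Function.update_self _ _ _)
    exact congrArg₂ (fun p c => bimoduleAct F p c y) h2 h3

end BimoduleFactorization

variable (F : Aᵒᵖ ⥤ A ⥤ ModuleCat.{t} k) [IsLinearBimodule k F]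

/-- The differential of the derived coend. -/
def barDiff (n : ℕ) : BarSimplices F (n + 1) →ₗ[k] BarSimplices F n :=
  ∑ i : Fin (n + 2), (-1 : ℤ) ^ (i : ℕ) • barOp F i.succAboveOrderEmb.toOrderHom

theorem barDiff_apply (n : ℕ) (z : BarSimplices F (n + 1)) :
    barDiff F n z =
      ∑ i : Fin (n + 2), (-1 : ℤ) ^ (i : ℕ) • barOp F i.succAboveOrderEmb.toOrderHom z := by
  simp [barDiff]

theorem derivedCoend_d (n : ℕ) :
    (derivedCoend F).d (n + 1) n = ModuleCat.ofHom (barDiff F n) := by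
  unfold derivedCoend
  rw [AlgebraicTopology.alternatingFaceMapComplex_obj_d]
  unfold AlgebraicTopology.AlternatingFaceMapComplex.objD
  refine ModuleCat.hom_ext ?_
  rw [ModuleCat.hom_sum]
  rfl

variable {F} in
/-- The bar construction of a split bimodule is acyclic in positive degrees. -/
theorem IsSplitBimodule.exists_barDiff_eq (hF : IsSplitBimodule F) (n : ℕ) (z : BarSimplices F (n + 1))
    (hz : barDiff F n z = 0) : ∃ w : BarSimplices F (n + 2), barDiff F (n + 1) w = z := by
  obtain ⟨J, _, q, τ, hτ⟩ := hF
  -- This s is an extra degeneracy: every face but the last commutes with it, and the last face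
  -- after s is the identity because the multiplied factorizations add up to the identity.
  let s : ∀ m, BarSimplices F m →ₗ[k] BarSimplices F (m + 1) := fun m => ∑ j, (τ j).contract m
  have hs : ∀ i : Fin (n + 2), barOp F i.castSucc.succAboveOrderEmb.toOrderHom (s (n + 1) z) =
      s n (barOp F i.succAboveOrderEmb.toOrderHom z) := fun i => by
    simp only [s, LinearMap.coe_sum, Finset.sum_apply, map_sum]
    refine Finset.sum_congr rfl fun j _ => ?_
    refine (τ j).barOp_contract _ _ (fun l => ?_) ?_ z
    · exact Fin.castSucc_succAbove_castSucc
    · exact Fin.succAbove_ne_last_last (Fin.castSucc_lt_last i).ne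
  have hl : barOp F (Fin.last (n + 2)).succAboveOrderEmb.toOrderHom (s (n + 1) z) = z := by
    have h1 : (Fin.last (n + 2)).succAboveOrderEmb.toOrderHom =
        (Fin.castSuccOrderEmb (n := n + 2)).toOrderHom :=
      OrderHom.ext _ _ Fin.succAbove_last
    rw [h1]
    suffices h : barOp F Fin.castSuccOrderEmb.toOrderHom ∘ₗ s (n + 1) = LinearMap.id from
      LinearMap.congr_fun h z
    refine bar_hom_ext (M := BarSimplices F (n + 1)) fun X f x => ?_
    simp only [s, LinearMap.comp_apply, LinearMap.coe_sum, Finset.sum_apply, map_sum,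
      LinearMap.id_apply]
    refine (Finset.sum_congr rfl fun j _ => (τ j).barOp_castSucc_contract X f x).trans ?_
    rw [← barElt_sum, hτ]
  -- For a cycle z the differential of s z is its last face alone, with index n + 2; the sign
  -- corrects for this.
  refine ⟨(-1 : ℤ) ^ (n + 2) • s (n + 1) z, ?_⟩
  rw [map_zsmul, barDiff_apply, Fin.sum_univ_castSucc, hl]
  simp only [hs, Fin.val_castSucc]
  rw [barDiff_apply] at hz
  have h0 : ∑ i : Fin (n + 2), (-1 : ℤ) ^ (i : ℕ) •
      s n (barOp F i.succAboveOrderEmb.toOrderHom z) = 0 := by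
    rw [← map_zero (s n), ← hz, map_sum]
    simp only [map_zsmul]
  rw [h0, zero_add, Fin.val_last, smul_smul, ← mul_pow]
  simp

end Bar

/-! ### Duality in rigid abelian categories -/

section Duality

variable {C : Type u} [Category.{v} C] [MonoidalCategory C] [RigidCategory C]

/-- The morphism `Z ⟶ Y ⊗ Wᘁ` corresponding to `h : Z ⊗ W ⟶ Y` by duality. -/
def curryDual {Z W Y : C} (h : Z ⊗ W ⟶ Y) : Z ⟶ Y ⊗ Wᘁ :=
  tensorRightHomEquiv Z W Wᘁ Y h

theorem curryDual_eq {Z W Y : C} (h : Z ⊗ W ⟶ Y) :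
    curryDual h = (ρ_ Z).inv ≫ Z ◁ η_ W Wᘁ ≫ (α_ Z W Wᘁ).inv ≫ h ▷ Wᘁ := rfl

theorem curryDual_injective {Z W Y : C} {h h' : Z ⊗ W ⟶ Y} (e : curryDual h = curryDual h') :
    h = h' :=
  (tensorRightHomEquiv Z W Wᘁ Y).injective e

theorem exists_curryDual_eq {Z W Y : C} (g : Z ⟶ Y ⊗ Wᘁ) : ∃ h : Z ⊗ W ⟶ Y, curryDual h = g :=
  (tensorRightHomEquiv Z W Wᘁ Y).surjective g

theorem curryDual_comp {Z W Y Y' : C} (h : Z ⊗ W ⟶ Y) (f : Y ⟶ Y') :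
    curryDual (h ≫ f) = curryDual h ≫ f ▷ Wᘁ :=
  tensorRightHomEquiv_naturality h f

theorem curryDual_whiskerRight_comp {Z Z' W Y : C} (x : Z' ⟶ Z) (h : Z ⊗ W ⟶ Y) :
    curryDual (x ▷ W ≫ h) = x ≫ curryDual h := by
  rw [curryDual_eq, curryDual_eq]
  simp only [comp_whiskerRight, ← associator_inv_naturality_left_assoc, whisker_exchange_assoc,
    rightUnitor_inv_naturality_assoc]

/-- The dual of g is characterized by sliding g through the coevaluation. This is the source of the
cowedge relation in the augmentation. -/
theorem curryDual_whiskerLeft_comp {Z W W' Y : C} (g : W' ⟶ W) (h : Z ⊗ W ⟶ Y) :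
    curryDual (Z ◁ g ≫ h) = curryDual h ≫ Y ◁ gᘁ := by
  have h1 := coevaluation_comp_rightAdjointMate g
  rw [curryDual_eq, curryDual_eq]
  simp only [comp_whiskerRight, Category.assoc, ← associator_inv_naturality_middle_assoc]
  rw [← MonoidalCategory.whiskerLeft_comp_assoc, ← h1, MonoidalCategory.whiskerLeft_comp_assoc,
    associator_inv_naturality_right_assoc, whisker_exchange]

theorem curryDual_leftUnitor_comp {X Y : C} (h : X ⟶ Y) :
    curryDual ((λ_ X).hom ≫ h) = homToTensorDual h := by
  rw [curryDual_eq, homToTensorDual]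
  simp only [comp_whiskerRight, leftUnitor_whiskerRight, Category.assoc, Iso.inv_hom_id_assoc,
    leftUnitor_naturality_assoc, ← unitors_inv_equal]

/-- The functor - ⊗ W has the right adjoint - ⊗ Wᘁ, which is itself a left adjoint and so preserves
epimorphisms. -/
theorem projective_tensor [Preadditive C] (Y W : C) [Projective Y] : Projective (Y ⊗ W) := by
  have : (tensorRight Wᘁ).IsLeftAdjoint := ⟨_, ⟨tensorRightAdjunction Wᘁ (Wᘁ)ᘁ⟩⟩
  exact (tensorRightAdjunction W Wᘁ).map_projective Y inferInstance

/-- The two duals of Z give adjoints of Z ⊗ - on both sides, so it is exact. -/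
instance (Z : C) : PreservesFiniteLimits (tensorLeft Z) := by
  have : (tensorLeft Z).IsRightAdjoint := ⟨_, ⟨tensorLeftAdjunction Z Zᘁ⟩⟩
  infer_instance

instance (Z : C) : PreservesFiniteColimits (tensorLeft Z) := by
  have : (tensorLeft Z).IsLeftAdjoint := ⟨_, ⟨tensorLeftAdjunction (ᘁZ) Z⟩⟩
  infer_instance

section Preadditive

variable [Preadditive C] [MonoidalPreadditive C]

theorem curryDual_add {Z W Y : C} (h h' : Z ⊗ W ⟶ Y) :
    curryDual (h + h') = curryDual h + curryDual h' := by
  simp only [curryDual_eq, MonoidalPreadditive.add_whiskerRight, Preadditive.comp_add]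

theorem rightAdjointMate_add {X Y : C} (f g : X ⟶ Y) : (f + g)ᘁ = fᘁ + gᘁ := by
  simp [rightAdjointMate, MonoidalPreadditive.whiskerLeft_add, MonoidalPreadditive.add_whiskerRight]

variable {k : Type w} [Field k] [Linear k C] [MonoidalLinear k C]

theorem curryDual_smul {Z W Y : C} (r : k) (h : Z ⊗ W ⟶ Y) :
    curryDual (r • h) = r • curryDual h := by
  simp only [curryDual_eq, MonoidalLinear.smul_whiskerRight, Linear.comp_smul]

theorem rightAdjointMate_smul {X Y : C} (r : k) (f : X ⟶ Y) : (r • f)ᘁ = r • fᘁ := by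
  simp [rightAdjointMate, MonoidalLinear.whiskerLeft_smul, MonoidalLinear.smul_whiskerRight]

end Preadditive

end Duality

/-! ### Existence and presentation of the coend -/

section CoendPresentation

variable {C : Type u} [Category.{v} C] [Abelian C]

/-- A map `C(P, X) ⟶ C(P, Y)` of `End P`-modules comes from a morphism `X ⟶ Y`. -/
theorem IsProgenerator.exists_comp_eq {P : C} (hP : IsProgenerator P) {X Y : C}
    (F : (P ⟶ X) → (P ⟶ Y)) (hadd : ∀ b b', F (b + b') = F b + F b')
    (hcomp : ∀ (e : P ⟶ P) b, F (e ≫ b) = e ≫ F b) : ∃ g : X ⟶ Y, ∀ b, b ≫ g = F b := by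
  obtain ⟨n, b, hb⟩ := hP.exists_family X
  have hP' := hP.projective
  have := Abelian.hasFiniteBiproducts (C := C)
  let B : ⨁ (fun _ : Fin n => P) ⟶ X := biproduct.desc b
  have hB : Epi B := ⟨fun f g h => hb _ f g fun i => by
    simpa [B] using (biproduct.ι (fun _ : Fin n => P) i) ≫= h⟩
  let F' : (P ⟶ X) →+ (P ⟶ Y) := AddMonoidHom.mk' F hadd
  have key : ∀ β : P ⟶ ⨁ (fun _ : Fin n => P), β ≫ biproduct.desc (fun i => F (b i)) =
      F (β ≫ B) := fun β => by
    have h1 : ∀ {Q : C} (a : Fin n → (P ⟶ Q)), β ≫ biproduct.desc a =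
        ∑ i, (β ≫ biproduct.π _ i) ≫ a i := fun a => by
      rw [biproduct.desc_eq, Preadditive.comp_sum]
      simp
    rw [h1, h1]
    refine Eq.trans (Finset.sum_congr rfl fun i _ => (hcomp _ _).symm) (map_sum F' _ _).symm
  -- By `key`, a map P ⟶ ker B is sent to F 0 = 0, and such maps are jointly epimorphic; so the map
  -- defined on generators descends to X.
  have hk : kernel.ι B ≫ biproduct.desc (fun i => F (b i)) = 0 := by
    obtain ⟨m, c, hc⟩ := hP.exists_family (kernel B)
    refine hc _ _ _ fun i => ?_
    rw [← Category.assoc, key, Category.assoc, kernel.condition, comp_zero, comp_zero]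
    exact map_zero F'
  refine ⟨Abelian.epiDesc B _ hk, fun x => ?_⟩
  have h2 : Projective.factorThru x B ≫ B = x := Projective.factorThru_comp x B
  conv_lhs => rw [← h2]
  rw [Category.assoc, Abelian.comp_epiDesc, key, h2]

variable [MonoidalCategory C] [RigidCategory C]

-- Dualizing W away turns the claim into one about morphisms out of X, where maps from P are jointly
-- epimorphic.
omit [Abelian C] in
theorem IsProgenerator.whiskerRight_hom_ext {P : C} (hP : IsProgenerator P) {X W T : C}
    {f g : X ⊗ W ⟶ T} (h : ∀ b : P ⟶ X, b ▷ W ≫ f = b ▷ W ≫ g) : f = g := by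
  obtain ⟨n, b, hb⟩ := hP.exists_family X
  refine curryDual_injective (hb _ _ _ fun i => ?_)
  rw [← curryDual_whiskerRight_comp, h, curryDual_whiskerRight_comp]

omit [Abelian C] in
theorem cowedge_condition {G : C ⥤ C} (c : Cowedge (tensorTwistedDual G)) {X Y : C} (f : X ⟶ Y) :
    X ◁ (G.map f)ᘁ ≫ c.π X = f ▷ (G.obj Y)ᘁ ≫ c.π Y :=
  Cowedge.condition c f

variable [MonoidalPreadditive C] {G : C ⥤ C} [G.Additive]

/-- After dualizing, the required equation prescribes a map C(P, X) ⟶ C(P, T ⊗ G(X)ᘁᘁ); the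
hypothesis on t is what makes it linear over End P, hence induced by a morphism. -/
theorem IsProgenerator.exists_extension {P : C} (hP : IsProgenerator P) {T : C}
    (t : P ⊗ (G.obj P)ᘁ ⟶ T) (ht : ∀ e : P ⟶ P, P ◁ (G.map e)ᘁ ≫ t = e ▷ (G.obj P)ᘁ ≫ t) (X : C) :
    ∃ π : X ⊗ (G.obj X)ᘁ ⟶ T, ∀ b : P ⟶ X, b ▷ (G.obj X)ᘁ ≫ π = P ◁ (G.map b)ᘁ ≫ t := by
  obtain ⟨g, hg⟩ := hP.exists_comp_eq (X := X) (fun b => curryDual (P ◁ (G.map b)ᘁ ≫ t))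
    (fun b b' => by
      rw [G.map_add, rightAdjointMate_add, MonoidalPreadditive.whiskerLeft_add,
        Preadditive.add_comp, curryDual_add])
    (fun e b => by
      rw [← curryDual_whiskerRight_comp, ← whisker_exchange_assoc, ← ht, G.map_comp,
        comp_rightAdjointMate, whiskerLeft_comp, Category.assoc])
  obtain ⟨π, rfl⟩ := exists_curryDual_eq g
  refine ⟨π, fun b => curryDual_injective ?_⟩
  rw [curryDual_whiskerRight_comp, hg]

/-- The cowedge given by a morphism `P ⊗ G(P)ᘁ ⟶ T` which coequalizes the actions of `End P`. -/
theorem IsProgenerator.exists_cowedge {P : C} (hP : IsProgenerator P) {T : C}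
    (t : P ⊗ (G.obj P)ᘁ ⟶ T) (ht : ∀ e : P ⟶ P, P ◁ (G.map e)ᘁ ≫ t = e ▷ (G.obj P)ᘁ ≫ t) :
    ∃ π : ∀ X : C, X ⊗ (G.obj X)ᘁ ⟶ T, π P = t ∧
      ∀ {X Y : C} (f : X ⟶ Y), X ◁ (G.map f)ᘁ ≫ π X = f ▷ (G.obj Y)ᘁ ≫ π Y := by
  choose π hπ using hP.exists_extension t ht
  refine ⟨π, by simpa using hπ P (𝟙 P), fun {X Y} f => hP.whiskerRight_hom_ext fun b => ?_⟩
  rw [← comp_whiskerRight_assoc, hπ, ← whisker_exchange_assoc, hπ, G.map_comp,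
    comp_rightAdjointMate, whiskerLeft_comp, Category.assoc]

-- The cowedge condition for b : P ⟶ X expresses c.π X through c.π P, so the coend is a quotient of
-- P ⊗ G(P)ᘁ alone.
omit [Abelian C] [MonoidalPreadditive C] [G.Additive] in
theorem IsProgenerator.cowedge_hom_ext {P : C} (hP : IsProgenerator P)
    (c : Cowedge (tensorTwistedDual G)) (hc : IsColimit c) {T : C} {f g : c.pt ⟶ T}
    (h : c.π P ≫ f = c.π P ≫ g) : f = g := by
  refine Cowedge.IsColimit.hom_ext hc fun X => hP.whiskerRight_hom_ext fun b => ?_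
  have key : ∀ f' : c.pt ⟶ T, b ▷ (G.obj X)ᘁ ≫ (c.π X ≫ f') = P ◁ (G.map b)ᘁ ≫ (c.π P ≫ f') :=
    fun f' => (Category.assoc _ _ _).symm.trans
      ((congrArg (· ≫ f') (cowedge_condition c b).symm).trans (Category.assoc _ _ _))
  exact (key f).trans ((congrArg _ h).trans (key g).symm)

variable (G) in
/-- The difference of the two actions of an endomorphism of `P` on `P ⊗ G(P)ᘁ`. -/
def coendRelation {P : C} (e : P ⟶ P) : P ⊗ (G.obj P)ᘁ ⟶ P ⊗ (G.obj P)ᘁ :=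
  P ◁ (G.map e)ᘁ - e ▷ (G.obj P)ᘁ

variable {k : Type w} [Field k] [Linear k C] [MonoidalLinear k C] [G.Linear k]

variable (k G) in
/-- `coendRelation` as a linear map. -/
def coendRelationHom (P : C) : (P ⟶ P) →ₗ[k] (P ⊗ (G.obj P)ᘁ ⟶ P ⊗ (G.obj P)ᘁ) where
  toFun := coendRelation G
  map_add' e e' := by
    simp only [coendRelation, G.map_add, rightAdjointMate_add, MonoidalPreadditive.whiskerLeft_add,
      MonoidalPreadditive.add_whiskerRight]
    abel
  map_smul' r e := by
    simp only [coendRelation, G.map_smul, rightAdjointMate_smul, MonoidalLinear.whiskerLeft_smul,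
      MonoidalLinear.smul_whiskerRight, smul_sub, RingHom.id_apply]

-- The relation is linear in e, so a basis of End P suffices; finitely many relations are needed in
-- order to form a cokernel.
variable (k G) in
theorem exists_coendRelation_family (P : C) [Module.Finite k (P ⟶ P)] :
    ∃ (n : ℕ) (e : Fin n → (P ⟶ P)), ∀ {T : C} (t : P ⊗ (G.obj P)ᘁ ⟶ T),
      (∀ i, coendRelation G (e i) ≫ t = 0) →
        ∀ e : P ⟶ P, P ◁ (G.map e)ᘁ ≫ t = e ▷ (G.obj P)ᘁ ≫ t := by
  let b := Module.finBasis k (P ⟶ P)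
  refine ⟨_, b, fun {T} t h e => ?_⟩
  have h1 : coendRelation G e = ∑ i, b.repr e i • coendRelation G (b i) := by
    change coendRelationHom G k P e = ∑ i, b.repr e i • coendRelationHom G k P (b i)
    conv_lhs => rw [← b.sum_repr e]
    simp only [map_sum, map_smul]
  have h2 : coendRelation G e ≫ t = 0 := by
    rw [h1, Preadditive.sum_comp]
    exact Finset.sum_eq_zero fun i _ => by rw [Linear.smul_comp, h, smul_zero]
  rwa [coendRelation, Preadditive.sub_comp, sub_eq_zero] at h2

-- The coend is the cokernel of the relations from a basis of End P: the cokernel map extends to a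
-- cowedge from P to all objects, and every cowedge kills the relations.
variable (k G) in
theorem hasCoend_tensorTwistedDual [IsFiniteLinearCategory k C] : HasCoend (tensorTwistedDual G) := by
  obtain ⟨P, hP⟩ := exists_isProgenerator k C
  have := finite_hom k C P P
  have := Abelian.hasFiniteBiproducts (C := C)
  obtain ⟨n, e, he⟩ := exists_coendRelation_family G k P
  let R : ⨁ (fun _ : Fin n => P ⊗ (G.obj P)ᘁ) ⟶ P ⊗ (G.obj P)ᘁ :=
    biproduct.desc fun i => coendRelation G (e i)
  have hR : ∀ {T : C} (t : P ⊗ (G.obj P)ᘁ ⟶ T), R ≫ t = 0 ↔ ∀ i, coendRelation G (e i) ≫ t = 0 :=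
    fun t => ⟨fun h i => by simpa [R] using biproduct.ι _ i ≫= h, fun h =>
      biproduct.hom_ext' _ _ fun i => by simpa [R] using h i⟩
  obtain ⟨π, hπ, hcond⟩ := hP.exists_cowedge (cokernel.π R) (he _ ((hR _).mp (cokernel.condition R)))
  let c : Cowedge (tensorTwistedDual G) := Cowedge.mk (cokernel R) π fun _ _ f => hcond f
  have hs : ∀ s : Cowedge (tensorTwistedDual G), R ≫ s.π P = 0 := fun s =>
    (hR (T := s.pt) _).mpr fun i => (Preadditive.sub_comp _ _ _).trans
      (sub_eq_zero.mpr (cowedge_condition s (e i)))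
  refine ⟨⟨⟨c, Multicofork.IsColimit.mk _ (fun s => cokernel.desc R (s.π P) (hs s))
    (fun s X => ?_) (fun s m hm => ?_)⟩⟩⟩
  · refine hP.whiskerRight_hom_ext (W := (G.obj X)ᘁ) fun b => ?_
    refine Eq.trans ?_ (cowedge_condition s b)
    have h1 : ∀ d : cokernel R ⟶ s.pt, b ▷ (G.obj X)ᘁ ≫ π X ≫ d =
        P ◁ (G.map b)ᘁ ≫ cokernel.π R ≫ d := fun d => by
      rw [← Category.assoc, ← hcond b, hπ, Category.assoc]
    exact (h1 _).trans (congrArg _ (cokernel.π_desc R _ (hs s)))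
  · refine (cancel_epi (cokernel.π R)).mp (Eq.trans ?_ (cokernel.π_desc R _ (hs s)).symm)
    exact (congrArg (· ≫ m) hπ.symm).trans (hm P)

omit [Abelian C] [MonoidalPreadditive C] [G.Additive] in
theorem IsProgenerator.epi_cowedge_π {P : C} (hP : IsProgenerator P)
    (c : Cowedge (tensorTwistedDual G)) (hc : IsColimit c) : Epi (c.π P) :=
  ⟨fun _ _ h => hP.cowedge_hom_ext c hc h⟩

variable (k) in
/-- A morphism from a projective object which vanishes in the coend is a combination of relations. -/
theorem IsProgenerator.exists_eq_sum_coendRelation {P : C} (hP : IsProgenerator P)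
    [Module.Finite k (P ⟶ P)] (c : Cowedge (tensorTwistedDual G)) (hc : IsColimit c) {Z : C}
    [Projective Z] (z : Z ⟶ P ⊗ (G.obj P)ᘁ) (hz : z ≫ c.π P = 0) :
    ∃ (n : ℕ) (e : Fin n → (P ⟶ P)) (y : Fin n → (Z ⟶ P ⊗ (G.obj P)ᘁ)),
      z = ∑ i, y i ≫ coendRelation G (e i) := by
  have := Abelian.hasFiniteBiproducts (C := C)
  obtain ⟨n, e, he⟩ := exists_coendRelation_family G k P
  let R : ⨁ (fun _ : Fin n => P ⊗ (G.obj P)ᘁ) ⟶ P ⊗ (G.obj P)ᘁ :=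
    biproduct.desc fun i => coendRelation G (e i)
  have hR : ∀ {T : C} (t : P ⊗ (G.obj P)ᘁ ⟶ T), R ≫ t = 0 → ∀ i, coendRelation G (e i) ≫ t = 0 :=
    fun t h i => by simpa [R] using biproduct.ι _ i ≫= h
  have hex : (ShortComplex.mk R (cokernel.π R) (cokernel.condition R)).Exact :=
    ShortComplex.exact_cokernel R
  obtain ⟨π, hπ, hcond⟩ := hP.exists_cowedge (cokernel.π R) (he _ (hR _ (cokernel.condition R)))
  -- The cokernel map factors through the coend, so z dies in the cokernel of the relations and, Z
  -- being projective, lifts through R.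
  have hd : c.π P ≫ Cowedge.IsColimit.desc hc π (fun _ _ f => hcond f) = cokernel.π R :=
    (Cowedge.IsColimit.π_desc hc π (fun _ _ f => hcond f) P).trans hπ
  have h0 : z ≫ cokernel.π R = 0 := by
    rw [← hd]
    exact (Category.assoc _ _ _).symm.trans ((congrArg (· ≫ _) hz).trans zero_comp)
  obtain ⟨y, hy⟩ : ∃ y : Z ⟶ ⨁ (fun _ : Fin n => P ⊗ (G.obj P)ᘁ), y ≫ R = z :=
    ⟨hex.liftFromProjective z h0, hex.liftFromProjective_comp z h0⟩
  refine ⟨n, e, fun i => y ≫ biproduct.π _ i, ?_⟩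
  simp only [← hy, R, biproduct.desc_eq, Preadditive.comp_sum, Category.assoc]

end CoendPresentation

/-! ### Split bimodules from exact functors with projective values -/

section Split

variable {k : Type w} [Field k] [IsAlgClosed k] {C : Type u} [Category.{v} C] [Abelian C]
  [Linear k C] [IsFiniteLinearCategory k C]

variable (k) in
theorem isSplitBimodule_twistedHom (T : C ⥤ C) [T.Additive] [T.Linear k] [PreservesFiniteLimits T]
    [PreservesFiniteColimits T] (hT : ∀ X, Projective (T.obj X)) :
    IsSplitBimodule (twistedHom k T) := by
  obtain ⟨P, hP⟩ := exists_isProgenerator k C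
  have hfin := finite_hom k C
  obtain ⟨𝒮⟩ := hP.nonempty_simpleFamily hfin
  obtain ⟨D⟩ := hP.nonempty_splitting hfin 𝒮 T hT
  exact D.isSplitBimodule hP hfin hT

end Split

/-! ### The augmentation of the bar construction -/

section Bar

variable {k : Type w} [Field k] {A : Type u} [Category.{v} A]

open Classical in
/-- The `0`-simplices of the bar construction given by the elements of `F(X, X)`. -/
def barZero (F : Aᵒᵖ ⥤ A ⥤ ModuleCat.{t} k) [Preadditive A] [Linear k A] (X : A) :
    (F.obj (op X)).obj X →ₗ[k] BarSimplices F 0 :=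
  DirectSum.lof k (Fin 1 → A) (fun X => BarSummand F X) (fun _ => X) ∘ₗ
    TensorProduct.mk k _ _ (PiTensorProduct.tprod k fun i => i.elim0)

variable [Preadditive A] [Linear k A] (F : Aᵒᵖ ⥤ A ⥤ ModuleCat.{t} k)

variable {F} in
theorem mem_of_barElt_mem {n : ℕ} (S : Submodule k (BarSimplices F n))
    (H : ∀ X f x, barElt F X f x ∈ S) (z : BarSimplices F n) : z ∈ S := by
  classical
  induction z using DirectSum.induction_on with
  | zero => exact S.zero_mem
  | add z z' h h' => exact S.add_mem h h'
  | of X y =>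
    change DirectSum.lof k (Fin (n + 1) → A) (fun X => BarSummand F X) X y ∈ S
    induction y using TensorProduct.induction_on with
    | zero => exact (map_zero (DirectSum.lof k _ (fun X => BarSummand F X) X)) ▸ S.zero_mem
    | add y y' h h' =>
      rw [map_add]
      exact S.add_mem h h'
    | tmul p x =>
      induction p using PiTensorProduct.induction_on with
      | smul_tprod r f =>
        rw [← TensorProduct.smul_tmul', map_smul]
        exact S.smul_mem r (H X f x)
      | add p p' h h' =>
        rw [TensorProduct.add_tmul, map_add]
        exact S.add_mem h h'

theorem barElt_eq_barZero (X : Fin 1 → A) (f : ∀ i : Fin 0, X i.succ ⟶ X i.castSucc)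
    (x : (F.obj (op (X 0))).obj (X (Fin.last 0))) : barElt F X f x = barZero F (X 0) x := by
  refine barElt_eq (Y := fun _ => X 0) F f (fun i => i.elim0) x x (fun i => congrArg X (Subsingleton.elim _ _))
    (fun i => i.elim0) ?_
  exact (LinearMap.congr_fun (bimoduleAct_id F (X 0) (X (Fin.last 0))) x).symm

theorem barDiff_zero_barElt [IsLinearBimodule k F] (X : Fin 2 → A)
    (f : ∀ i : Fin 1, X i.succ ⟶ X i.castSucc) (x : (F.obj (op (X 0))).obj (X 1)) :
    barDiff F 0 (barElt F X f x) = barZero F (X 1) (bimoduleAct F (f 0) (𝟙 (X 1)) x) -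
      barZero F (X 0) (bimoduleAct F (𝟙 (X 0)) (f 0) x) := by
  rw [barDiff_apply, Fin.sum_univ_two]
  have h0 : barOp F (Fin.succAboveOrderEmb (0 : Fin 2)).toOrderHom (barElt F X f x) =
      barZero F (X 1) (bimoduleAct F (f 0) (𝟙 (X 1)) x) := by
    refine (barOp_barElt F _ X f x).trans ((barElt_eq_barZero F _ _ _).trans ?_)
    exact congrArg₂ (fun p q => barZero F (X 1) (bimoduleAct F p q x))
      (stringComp_succ f 0) (stringComp_refl f 1)
  have h1 : barOp F (Fin.succAboveOrderEmb (1 : Fin 2)).toOrderHom (barElt F X f x) =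
      barZero F (X 0) (bimoduleAct F (𝟙 (X 0)) (f 0) x) := by
    refine (barOp_barElt F _ X f x).trans ((barElt_eq_barZero F _ _ _).trans ?_)
    exact congrArg₂ (fun p q => barZero F (X 0) (bimoduleAct F p q x))
      (stringComp_refl f 0) (stringComp_succ f 0)
  rw [h0, h1]
  simp [sub_eq_add_neg]

theorem exists_barDiff_eq_sub [IsLinearBimodule k F] {X Y : A} (f : X ⟶ Y)
    (x : (F.obj (op Y)).obj X) : ∃ w, barDiff F 0 w =
      barZero F X (bimoduleAct F f (𝟙 X) x) - barZero F Y (bimoduleAct F (𝟙 Y) f x) := by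
  let X' : Fin 2 → A := fun i => Fin.cases (motive := fun _ => A) Y (fun _ => X) i
  let f' : ∀ i : Fin 1, X' i.succ ⟶ X' i.castSucc := fun i =>
    Fin.cases (motive := fun i : Fin 1 => X' i.succ ⟶ X' i.castSucc) f (fun i => i.elim0) i
  exact ⟨barElt F X' f' x, barDiff_zero_barElt F X' f' x⟩

variable {F} {M : Type*} [AddCommGroup M] [Module k M]

open Classical in
/-- The map from the `0`-simplices of the bar construction given by maps `F(X, X) ⟶ M`. -/
def barAug (φ : ∀ X : A, (F.obj (op X)).obj X →ₗ[k] M) : BarSimplices F 0 →ₗ[k] M :=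
  DirectSum.toModule k _ _ fun X => TensorProduct.lift (PiTensorProduct.lift
    (MultilinearMap.constOfIsEmpty k _ (φ (X 0))))

theorem barAug_barElt (φ : ∀ X : A, (F.obj (op X)).obj X →ₗ[k] M) (X : Fin 1 → A)
    (f : ∀ i : Fin 0, X i.succ ⟶ X i.castSucc) (x : (F.obj (op (X 0))).obj (X (Fin.last 0))) :
    barAug φ (barElt F X f x) = φ (X 0) x := by
  unfold barAug barElt
  erw [DirectSum.toModule_lof]
  rw [TensorProduct.lift.tmul, PiTensorProduct.lift.tprod]
  rfl

theorem barAug_barZero (φ : ∀ X : A, (F.obj (op X)).obj X →ₗ[k] M) (X : A)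
    (x : (F.obj (op X)).obj X) : barAug φ (barZero F X x) = φ X x :=
  barAug_barElt φ (fun _ => X) _ x

theorem barAug_barDiff [IsLinearBimodule k F] (φ : ∀ X : A, (F.obj (op X)).obj X →ₗ[k] M)
    (hφ : ∀ {X Y : A} (f : X ⟶ Y) (x : (F.obj (op Y)).obj X),
      φ X (bimoduleAct F f (𝟙 X) x) = φ Y (bimoduleAct F (𝟙 Y) f x)) (z : BarSimplices F 1) :
    barAug φ (barDiff F 0 z) = 0 := by
  suffices barAug φ ∘ₗ barDiff F 0 = 0 from LinearMap.congr_fun this z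
  refine bar_hom_ext fun X f x => ?_
  refine (congrArg (barAug φ) (barDiff_zero_barElt F X f x)).trans ?_
  rw [map_sub, barAug_barZero, barAug_barZero]
  exact sub_eq_zero.mpr (hφ (f 0) x)

end Bar

/-! ### Augmentation to the coend and exactness in degree zero -/

section Augmentation

variable {k : Type w} [Field k] {C : Type u} [Category.{v} C] [Abelian C] [Linear k C]
  [MonoidalCategory C] [MonoidalPreadditive C] [MonoidalLinear k C] [RigidCategory C]
  {G : C ⥤ C} [G.Additive] [G.Linear k]

variable (k) in
/-- The linear map `C(Z ⊗ G(X), X) ⟶ C(Z, ∫^X X ⊗ G(X)ᘁ)` given by duality. -/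
def coendAugAux (c : Cowedge (tensorTwistedDual G)) (Z X : C) :
    (Z ⊗ G.obj X ⟶ X) →ₗ[k] ULift.{max u w} (Z ⟶ c.pt) where
  toFun h := ULift.up (curryDual h ≫ c.π X)
  map_add' h h' := congrArg ULift.up ((congrArg (· ≫ c.π X) (curryDual_add h h')).trans
    (Preadditive.add_comp _ _ _ _ _ _))
  map_smul' r h := congrArg ULift.up ((congrArg (· ≫ c.π X) (curryDual_smul r h)).trans
    (Linear.smul_comp _ _ _ _ _ _))

variable (k) in
/-- The augmentation `B_0 ⟶ C(Z, ∫^X X ⊗ G(X)ᘁ)` of the bar construction. -/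
def coendAug (c : Cowedge (tensorTwistedDual G)) (Z : C) :
    BarSimplices (twistedHom k (G ⋙ tensorLeft Z)) 0 →ₗ[k] ULift.{max u w} (Z ⟶ c.pt) :=
  barAug fun X => coendAugAux k c Z X.obj

omit [G.Additive] [G.Linear k] in
theorem coendAug_barZero (c : Cowedge (tensorTwistedDual G)) (Z : C) (X : Proj C)
    (h : Z ⊗ G.obj X.obj ⟶ X.obj) : coendAug k c Z (barZero (twistedHom k (G ⋙ tensorLeft Z)) X h) =
      ULift.up (curryDual h ≫ c.π X.obj) :=
  barAug_barZero _ _ _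

theorem coendAug_barDiff (c : Cowedge (tensorTwistedDual G)) (Z : C)
    (z : BarSimplices (twistedHom k (G ⋙ tensorLeft Z)) 1) :
    coendAug k c Z (barDiff _ 0 z) = 0 := by
  refine barAug_barDiff _ (fun {X Y} f h => congrArg ULift.up ?_) z
  change Z ⊗ G.obj Y.obj ⟶ X.obj at h
  have h1 : curryDual ((Z ◁ G.map f.hom ≫ h) ≫ 𝟙 _) = curryDual h ≫ X.obj ◁ (G.map f.hom)ᘁ := by
    rw [Category.comp_id, curryDual_whiskerLeft_comp]
  have h2 : curryDual ((Z ◁ G.map (𝟙 Y.obj) ≫ h) ≫ f.hom) = curryDual h ≫ f.hom ▷ _ := by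
    rw [G.map_id, MonoidalCategory.whiskerLeft_id, Category.id_comp, curryDual_comp]
  refine (congrArg (· ≫ c.π X.obj) h1).trans (Eq.trans ?_ (congrArg (· ≫ c.π Y.obj) h2).symm)
  exact (Category.assoc _ _ _).trans ((congrArg (curryDual h ≫ ·)
    (cowedge_condition c f.hom)).trans (Category.assoc _ _ _).symm)

variable [IsFiniteLinearCategory k C]

-- The 0-simplices at the progenerator suffice: P ⊗ G(P)ᘁ maps onto the coend and Z is projective.
omit [G.Additive] [G.Linear k] in
theorem coendAug_surjective (c : Cowedge (tensorTwistedDual G)) (hc : IsColimit c) (Z : C)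
    [Projective Z] (g : Z ⟶ c.pt) : ∃ z, coendAug k c Z z = ULift.up g := by
  obtain ⟨P, hP⟩ := exists_isProgenerator k C
  let π : P ⊗ (G.obj P)ᘁ ⟶ c.pt := c.π P
  have : Epi π := hP.epi_cowedge_π c hc
  obtain ⟨h, hh⟩ := exists_curryDual_eq (Projective.factorThru g π)
  let P' : Proj C := ⟨P, hP.projective⟩
  refine ⟨barZero (twistedHom k (G ⋙ tensorLeft Z)) P' h,
    (coendAug_barZero c Z P' h).trans (congrArg ULift.up ?_)⟩
  exact (congrArg (· ≫ π) hh).trans (Projective.factorThru_comp g π)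

/-- Modulo boundaries every 0-chain is concentrated at the progenerator P. There the presentation of
the coend writes an element of the kernel as a sum of relations, and each relation is a boundary. -/
theorem exists_barDiff_eq_of_coendAug (c : Cowedge (tensorTwistedDual G)) (hc : IsColimit c) (Z : C)
    [Projective Z] (z : BarSimplices (twistedHom k (G ⋙ tensorLeft Z)) 0)
    (hz : coendAug k c Z z = 0) : ∃ w, barDiff _ 0 w = z := by
  obtain ⟨P, hP⟩ := exists_isProgenerator k C
  have := finite_hom k C P P
  let F := twistedHom k (G ⋙ tensorLeft Z)
  let D : Submodule k (BarSimplices F 0) := LinearMap.range (barDiff F 0)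
  let P' : Proj C := ⟨P, hP.projective⟩
  have hrel : ∀ {X Y : Proj C} (f : X ⟶ Y) (h : Z ⊗ G.obj Y.obj ⟶ X.obj),
      barZero F X (Z ◁ G.map f.hom ≫ h : Z ⊗ G.obj X.obj ⟶ X.obj) -
        barZero F Y (h ≫ f.hom : Z ⊗ G.obj Y.obj ⟶ Y.obj) ∈ D := fun {X Y} f h => by
    obtain ⟨w, hw⟩ := exists_barDiff_eq_sub F f h
    refine ⟨w, hw.trans (congrArg₂ (fun a b => barZero F X a - barZero F Y b) ?_ ?_)⟩
    · exact Category.comp_id (Z ◁ G.map f.hom ≫ h)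
    · change (Z ◁ G.map (𝟙 Y.obj) ≫ h) ≫ f.hom = h ≫ f.hom
      rw [G.map_id, MonoidalCategory.whiskerLeft_id, Category.id_comp]
  let E : Submodule k (BarSimplices F 0) := LinearMap.range (barZero F P')
  -- The identity of X 0 is a sum of composites a i ≫ b i through P, and moving b i around the
  -- trace-like relation replaces a 0-simplex at X 0 by 0-simplices at P.
  have htop : z ∈ D ⊔ E := by
    refine mem_of_barElt_mem _ (fun X f h => ?_) z
    rw [barElt_eq_barZero]
    change Z ⊗ G.obj (X 0).obj ⟶ (X 0).obj at h
    have : Projective (X 0).obj := (X 0).property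
    obtain ⟨n, a, b, hab⟩ := hP.exists_decomposition (X 0).obj
    have h1 : h = ∑ i, (h ≫ a i) ≫ b i := by
      simp only [Category.assoc, ← Preadditive.comp_sum]
      rw [hab, Category.comp_id]
    have h2 : barZero F (X 0) h = ∑ i, barZero F (X 0) ((h ≫ a i) ≫ b i :
        Z ⊗ G.obj (X 0).obj ⟶ (X 0).obj) :=
      (congrArg (barZero F (X 0)) h1).trans (map_sum (barZero F (X 0)) _ _)
    rw [h2]
    refine Submodule.sum_mem _ fun i _ => ?_
    have h3 := hrel (X := P') (Y := X 0) (ObjectProperty.homMk (b i)) (h ≫ a i)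
    obtain ⟨w, hw⟩ := h3
    have h3 : barZero F (X 0) ((h ≫ a i) ≫ b i : Z ⊗ G.obj (X 0).obj ⟶ (X 0).obj) -
        barZero F P' (Z ◁ G.map (b i) ≫ h ≫ a i : Z ⊗ G.obj P ⟶ P) ∈ D :=
      ⟨-w, (map_neg (barDiff F 0) w).trans ((congrArg Neg.neg hw).trans (neg_sub (α := BarSimplices F 0) _ _))⟩
    have h5 : barZero F P' (Z ◁ G.map (b i) ≫ h ≫ a i : Z ⊗ G.obj P ⟶ P) ∈ E :=
      LinearMap.mem_range_self _ _
    have h4 := Submodule.add_mem_sup h3 h5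
    exact (congrArg (· ∈ D ⊔ E) (sub_add_cancel (G := BarSimplices F 0) _ _)).mp h4
  obtain ⟨y, ⟨w, rfl⟩, _, ⟨h, rfl⟩, rfl⟩ := Submodule.mem_sup.mp htop
  change Z ⊗ G.obj P ⟶ P at h
  rw [map_add, coendAug_barDiff, zero_add] at hz
  have hz' : curryDual h ≫ c.π P = 0 :=
    congrArg ULift.down ((coendAug_barZero (k := k) c Z P' h).symm.trans hz)
  obtain ⟨n, e, y, hy⟩ := hP.exists_eq_sum_coendRelation k c hc (curryDual h) hz'
  choose g hg using fun i => exists_curryDual_eq (y i)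
  -- Under duality a relation composed with y i becomes the difference of the two faces of a
  -- 1-simplex.
  have hh : h = ∑ i, (Z ◁ G.map (e i) ≫ g i - g i ≫ e i) := by
    let cd : (Z ⊗ G.obj P ⟶ P) →+ (Z ⟶ P ⊗ (G.obj P)ᘁ) := AddMonoidHom.mk' curryDual curryDual_add
    refine curryDual_injective (hy.trans (Eq.symm ((map_sum cd _ _).trans
      (Finset.sum_congr rfl fun i _ => ?_))))
    rw [map_sub, ← hg, coendRelation, Preadditive.comp_sub, ← curryDual_comp,
      ← curryDual_whiskerLeft_comp]
    rfl
  have hD : barDiff F 0 w + barZero F P' h ∈ D := by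
    refine D.add_mem (LinearMap.mem_range_self _ w) ?_
    have h5 : barZero F P' h = ∑ i, (barZero F P' (Z ◁ G.map (e i) ≫ g i : Z ⊗ G.obj P ⟶ P) -
        barZero F P' (g i ≫ e i : Z ⊗ G.obj P ⟶ P)) :=
      (congrArg (barZero F P') hh).trans ((map_sum (barZero F P') _ _).trans
        (Finset.sum_congr rfl fun i _ => map_sub (barZero F P') _ _))
    rw [h5]
    exact Submodule.sum_mem _ fun i _ => hrel (X := P') (Y := P') (ObjectProperty.homMk (e i)) (g i)
  exact hD

end Augmentation

/-! ### Relative projective resolutions -/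

section Comparison

variable {𝒜 : Type u} [Category.{v} 𝒜] [Preadditive 𝒜]

/-- `W` is projective relative to the augmented complex `L ⟶ T`. -/
structure LiftsAlong (W : 𝒜) (L : ChainComplex 𝒜 ℕ) {T : 𝒜} (ε : L.X 0 ⟶ T) : Prop where
  zero : ∀ f : W ⟶ T, ∃ g : W ⟶ L.X 0, g ≫ ε = f
  one : ∀ f : W ⟶ L.X 0, f ≫ ε = 0 → ∃ g : W ⟶ L.X 1, g ≫ L.d 1 0 = f
  succ : ∀ (n : ℕ) (f : W ⟶ L.X (n + 1)), f ≫ L.d (n + 1) n = 0 →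
    ∃ g : W ⟶ L.X (n + 2), g ≫ L.d (n + 2) (n + 1) = f

variable {K L : ChainComplex 𝒜 ℕ} {T : 𝒜} {ε : L.X 0 ⟶ T}

/-- The usual inductive lifting; only the lifting properties of the terms enter, so no projectives
of the ambient category are needed. -/
theorem exists_chainMap (hL : ∀ n, LiftsAlong (K.X n) L ε) (κ : K.X 0 ⟶ T)
    (hκ : K.d 1 0 ≫ κ = 0) : ∃ φ : K ⟶ L, φ.f 0 ≫ ε = κ := by
  obtain ⟨f0, h0⟩ := (hL 0).zero κ
  obtain ⟨f1, h1⟩ := (hL 1).one (K.d 1 0 ≫ f0) (by rw [Category.assoc, h0, hκ])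
  have hs : ∀ (n : ℕ) (p : Σ' (f : K.X n ⟶ L.X n) (f' : K.X (n + 1) ⟶ L.X (n + 1)),
      f' ≫ L.d (n + 1) n = K.d (n + 1) n ≫ f), ∃ g : K.X (n + 2) ⟶ L.X (n + 2),
        g ≫ L.d (n + 2) (n + 1) = K.d (n + 2) (n + 1) ≫ p.2.1 := fun n p =>
    (hL (n + 2)).succ n _ (by rw [Category.assoc, p.2.2, ← Category.assoc, K.d_comp_d, zero_comp])
  exact ⟨ChainComplex.mkHom K L f0 f1 h1 fun n p => ⟨_, (hs n p).choose_spec⟩, h0⟩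

theorem nonempty_homotopy_zero (hL : ∀ n, LiftsAlong (K.X n) L ε) (φ : K ⟶ L)
    (hφ : φ.f 0 ≫ ε = 0) : Nonempty (Homotopy φ 0) := by
  obtain ⟨f0, h0⟩ := (hL 0).one (φ.f 0) hφ
  obtain ⟨f1, h1⟩ := (hL 1).succ 0 (φ.f 1 - K.d 1 0 ≫ f0) (by
    rw [Preadditive.sub_comp, Category.assoc, h0, φ.comm, sub_self])
  have hs : ∀ (n : ℕ) (p : Σ' (f : K.X n ⟶ L.X (n + 1)) (f' : K.X (n + 1) ⟶ L.X (n + 2)),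
      φ.f (n + 1) = K.d (n + 1) n ≫ f + f' ≫ L.d (n + 2) (n + 1)),
      ∃ g : K.X (n + 2) ⟶ L.X (n + 3),
        φ.f (n + 2) = K.d (n + 2) (n + 1) ≫ p.2.1 + g ≫ L.d (n + 3) (n + 2) := fun n p => by
    obtain ⟨g, hg⟩ := (hL (n + 2)).succ (n + 1) (φ.f (n + 2) - K.d (n + 2) (n + 1) ≫ p.2.1) (by
      have : p.2.1 ≫ L.d (n + 2) (n + 1) = φ.f (n + 1) - K.d (n + 1) n ≫ p.1 :=
        eq_sub_of_add_eq' p.2.2.symm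
      rw [Preadditive.sub_comp, Category.assoc, this, φ.comm, Preadditive.comp_sub,
        ← Category.assoc (K.d _ _), K.d_comp_d, zero_comp, sub_zero, sub_self])
    exact ⟨g, by rw [hg]; abel⟩
  exact ⟨Homotopy.mkInductive φ f0 h0.symm f1 (by rw [h1]; abel) fun n p =>
    ⟨_, (hs n p).choose_spec⟩⟩

theorem nonempty_homotopy (hL : ∀ n, LiftsAlong (K.X n) L ε) (φ ψ : K ⟶ L)
    (h : φ.f 0 ≫ ε = ψ.f 0 ≫ ε) : Nonempty (Homotopy φ ψ) := by
  obtain ⟨H⟩ := nonempty_homotopy_zero hL (φ - ψ) (by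
    rw [HomologicalComplex.sub_f_apply, Preadditive.sub_comp, h, sub_self])
  exact ⟨(Homotopy.equivSubZero).symm H⟩

/-- A lift in the opposite direction is inverse to φ up to homotopy, as both composites cover the
identity of T. -/
theorem exists_homotopyEquiv {κ : K.X 0 ⟶ T}
    (hLL : ∀ n, LiftsAlong (L.X n) L ε) (hKK : ∀ n, LiftsAlong (K.X n) K κ)
    (hLK : ∀ n, LiftsAlong (L.X n) K κ) (hε : L.d 1 0 ≫ ε = 0) (φ : K ⟶ L)
    (hφ : φ.f 0 ≫ ε = κ) : ∃ e : HomotopyEquiv K L, e.hom = φ := by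
  obtain ⟨ψ, hψ⟩ := exists_chainMap hLK ε hε
  obtain ⟨h1⟩ := nonempty_homotopy hKK (φ ≫ ψ) (𝟙 K) (by
    rw [HomologicalComplex.comp_f, Category.assoc, hψ, hφ, HomologicalComplex.id_f,
      Category.id_comp])
  obtain ⟨h2⟩ := nonempty_homotopy hLL (ψ ≫ φ) (𝟙 L) (by
    rw [HomologicalComplex.comp_f, Category.assoc, hφ, hψ, HomologicalComplex.id_f,
      Category.id_comp])
  exact ⟨⟨φ, ψ, h1, h2⟩, rfl⟩

end Comparison

/-! ### Linear presheaves and projectivity relative to the projective objects -/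

section Presheaf

variable {k : Type w} [Field k] {C : Type u} [Category.{v} C] [Preadditive C] [Linear k C]

/-- A presheaf of `k`-vector spaces is linear if it is a `k`-linear functor. -/
structure IsLinearPresheaf (L : Cᵒᵖ ⥤ ModuleCat.{t} k) : Prop where
  map_add : ∀ {X Y : C} (f g : X ⟶ Y), L.map (f + g).op = L.map f.op + L.map g.op
  map_smul : ∀ {X Y : C} (r : k) (f : X ⟶ Y), L.map (r • f).op = r • L.map f.op

/-- The action of morphisms on a linear presheaf as a linear map. -/
def IsLinearPresheaf.act {L : Cᵒᵖ ⥤ ModuleCat.{t} k} (hL : IsLinearPresheaf L) (X Y : C) :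
    (X ⟶ Y) →ₗ[k] (L.obj (op Y) →ₗ[k] L.obj (op X)) where
  toFun f := (L.map f.op).hom
  map_add' f g := by rw [hL.map_add, ModuleCat.hom_add]
  map_smul' r f := by
    rw [hL.map_smul, ModuleCat.hom_smul]
    rfl

/-- A presheaf is relatively projective if morphisms out of it can be lifted through morphisms
from linear presheaves as soon as they can be lifted on elements over projective objects. -/
def IsRelativelyProjective (W : Cᵒᵖ ⥤ ModuleCat.{t} k) : Prop :=
  ∀ (L L' : Cᵒᵖ ⥤ ModuleCat.{t} k) (_ : IsLinearPresheaf L) (p : L ⟶ L') (f : W ⟶ L')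
    (_ : ∀ (Z : C) [Projective Z] (x : W.obj (op Z)),
      ∃ y : L.obj (op Z), (p.app (op Z)).hom y = (f.app (op Z)).hom x),
    ∃ g : W ⟶ L, g ≫ p = f

/-- Relative projectivity turns exactness over projective objects into lifting of morphisms of
presheaves, since a morphism into the cycles takes values in cycles over each object. -/
theorem IsRelativelyProjective.liftsAlong {W : Cᵒᵖ ⥤ ModuleCat.{t} k}
    (hW : IsRelativelyProjective W) {L : ChainComplex (Cᵒᵖ ⥤ ModuleCat.{t} k) ℕ}
    (hL : ∀ n, IsLinearPresheaf (L.X n)) {T : Cᵒᵖ ⥤ ModuleCat.{t} k} {ε : L.X 0 ⟶ T}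
    (h0 : ∀ (Z : C) [Projective Z] (x : T.obj (op Z)), ∃ y : (L.X 0).obj (op Z),
      (ε.app (op Z)).hom y = x)
    (h1 : ∀ (Z : C) [Projective Z] (x : (L.X 0).obj (op Z)), (ε.app (op Z)).hom x = 0 →
      ∃ y : (L.X 1).obj (op Z), ((L.d 1 0).app (op Z)).hom y = x)
    (h2 : ∀ (n : ℕ) (Z : C) [Projective Z] (x : (L.X (n + 1)).obj (op Z)),
      ((L.d (n + 1) n).app (op Z)).hom x = 0 → ∃ y : (L.X (n + 2)).obj (op Z),
        ((L.d (n + 2) (n + 1)).app (op Z)).hom y = x) : LiftsAlong W L ε where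
  zero f := hW _ _ (hL 0) ε f fun Z _ _ => h0 Z _
  one f hf := hW _ _ (hL 1) _ f fun Z _ x => h1 Z _
    (congrArg (fun a : W ⟶ T => (a.app (op Z)).hom x) hf)
  succ n f hf := hW _ _ (hL (n + 2)) _ f fun Z _ x => h2 n Z _
    (congrArg (fun a : W ⟶ L.X n => (a.app (op Z)).hom x) hf)

/-- Representable presheaves with values in vector spaces (lifted to a larger universe). -/
def homPresheaf (k : Type w) [Field k] {C : Type u} [Category.{v} C] [Preadditive C] [Linear k C] :
    C ⥤ Cᵒᵖ ⥤ ModuleCat.{max u v w} k :=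
  linearYoneda k C ⋙ (Functor.whiskeringRight _ _ _).obj (ModuleCat.uliftFunctor.{max u w} k)

instance : (homPresheaf k (C := C)).Additive where
  map_add {X Y f g} := by
    ext Z h
    exact congrArg ULift.up (Preadditive.comp_add _ _ _ h.down f g)

theorem isLinearPresheaf_homPresheaf (X : C) : IsLinearPresheaf ((homPresheaf k).obj X) where
  map_add f g := by
    ext h
    exact congrArg ULift.up (Preadditive.add_comp _ _ _ f g h.down)
  map_smul r f := by
    ext h
    exact congrArg ULift.up (Linear.smul_comp _ _ _ r f h.down)

/-- By the Yoneda lemma it is enough to lift one element over P, the image of the identity;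
linearity of L makes the resulting transformation linear. -/
theorem isRelativelyProjective_homPresheaf (P : C) [Projective P] :
    IsRelativelyProjective ((homPresheaf k).obj P) := by
  intro L L' hL p f hf
  obtain ⟨y, hy⟩ := hf P (ULift.up (𝟙 P))
  refine ⟨{ app := fun Z => ModuleCat.ofHom (((hL.act Z.unop P).flip y) ∘ₗ
              (ULift.moduleEquiv (R := k) (M := (Z.unop ⟶ P))).toLinearMap)
            naturality := fun Z Z' x => ?_ }, ?_⟩
  · ext h
    exact congrArg (fun a => a.hom y) (L.map_comp (h.down : Z.unop ⟶ P).op x)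
  · ext Z h
    change (p.app Z).hom ((L.map h.down.op).hom y) = (f.app Z).hom h
    have h1 := congrArg (fun a => a.hom y) (p.naturality h.down.op)
    have h2 := congrArg (fun a => a.hom (ULift.up (𝟙 P))) (f.naturality h.down.op)
    refine h1.trans ((congrArg (L'.map h.down.op).hom hy).trans (h2.symm.trans ?_))
    exact congrArg (fun a => (f.app Z).hom (ULift.up a)) (Category.comp_id h.down)

end Presheaf

/-! ### The bar construction as a complex of presheaves -/

section Bar

variable {k : Type w} [Field k] {A : Type u} [Category.{v} A] [Preadditive A] [Linear k A]

theorem barElt_smul (F : Aᵒᵖ ⥤ A ⥤ ModuleCat.{t} k) {n : ℕ} (X : Fin (n + 1) → A)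
    (f : ∀ i : Fin n, X i.succ ⟶ X i.castSucc) (r : k)
    (x : (F.obj (op (X 0))).obj (X (Fin.last n))) :
    barElt F X f (r • x) = r • barElt F X f x := by
  unfold barElt
  rw [TensorProduct.tmul_smul, map_smul]

theorem barMap_barDiff {F F' : Aᵒᵖ ⥤ A ⥤ ModuleCat.{t} k} [IsLinearBimodule k F]
    [IsLinearBimodule k F'] (η : F ⟶ F') (n : ℕ) (z : BarSimplices F (n + 1)) :
    barMap η n (barDiff F n z) = barDiff F' n (barMap η (n + 1) z) := by
  have h := (derivedCoendMap η).comm (n + 1) n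
  rw [derivedCoend_d, derivedCoend_d] at h
  exact (congrArg (fun a => a.hom z) h).symm

theorem barDiff_barDiff (F : Aᵒᵖ ⥤ A ⥤ ModuleCat.{t} k) [IsLinearBimodule k F] (n : ℕ)
    (z : BarSimplices F (n + 2)) : barDiff F n (barDiff F (n + 1) z) = 0 := by
  have h := (derivedCoend F).d_comp_d (n + 2) (n + 1) n
  rw [derivedCoend_d, derivedCoend_d] at h
  exact congrArg (fun a => a.hom z) h

end Bar

section TwistedHom

variable (k : Type w) [Field k] {C : Type u} [Category.{v} C] [Preadditive C] [Linear k C]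

/-- Precomposition with a natural transformation as a morphism of bimodules. -/
def twistedHomMap {G G' : C ⥤ C} (α : G' ⟶ G) : twistedHom k G ⟶ twistedHom k G' :=
  Functor.whiskerRight (NatTrans.op (Functor.whiskerLeft (isProjective C).ι α))
    (linearCoyoneda k C ⋙ (Functor.whiskeringLeft _ _ _).obj (isProjective C).ι)

theorem barMap_twistedHomMap {G G' : C ⥤ C} (α : G' ⟶ G) {n : ℕ} (X : Fin (n + 1) → Proj C)
    (f : ∀ i : Fin n, X i.succ ⟶ X i.castSucc) (h : G.obj (X 0).obj ⟶ (X (Fin.last n)).obj) :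
    barMap (twistedHomMap k α) n (barElt (twistedHom k G) X f h) =
      barElt (twistedHom k G') X f
        (α.app (X 0).obj ≫ h : G'.obj (X 0).obj ⟶ (X (Fin.last n)).obj) :=
  barMap_barElt (twistedHomMap k α) X f h

end TwistedHom

section BarPresheaf

variable {k : Type w} [Field k] {C : Type u} [Category.{v} C] [Abelian C] [Linear k C]
  [MonoidalCategory C] [MonoidalPreadditive C] [MonoidalLinear k C]

/-- The natural transformation `Z' ⊗ G(-) ⟶ Z ⊗ G(-)` given by `Z' ⟶ Z`. -/
def tensorTwist (G : C ⥤ C) {Z Z' : C} (x : Z' ⟶ Z) : G ⋙ tensorLeft Z' ⟶ G ⋙ tensorLeft Z where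
  app X := x ▷ G.obj X
  naturality _ _ f := whisker_exchange x (G.map f)

/-- The natural transformation `Z ⊗ G'(-) ⟶ Z ⊗ G(-)` given by `G' ⟶ G`. -/
def tensorWhisker {G G' : C ⥤ C} (α : G' ⟶ G) (Z : C) :
    G' ⋙ tensorLeft Z ⟶ G ⋙ tensorLeft Z :=
  Functor.whiskerRight α (tensorLeft Z)

variable (k) in
/-- The presheaf of `n`-simplices of the bar constructions of the bimodules `C(Z ⊗ G(X), Y)`. -/
def barPresheaf (G : C ⥤ C) (n : ℕ) : Cᵒᵖ ⥤ ModuleCat.{max u v w} k where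
  obj Z := ModuleCat.of k (BarSimplices (twistedHom k (G ⋙ tensorLeft Z.unop)) n)
  map x := ModuleCat.ofHom (barMap (twistedHomMap k (tensorTwist G x.unop)) n)
  map_id Z := by
    refine ModuleCat.hom_ext (bar_hom_ext fun X f h => ?_)
    change Z.unop ⊗ G.obj (X 0).obj ⟶ (X (Fin.last n)).obj at h
    refine (barMap_twistedHomMap k (tensorTwist G (𝟙 Z.unop)) X f h).trans
      (congrArg (barElt (twistedHom k (G ⋙ tensorLeft Z.unop)) X f) ?_)
    change 𝟙 Z.unop ▷ G.obj (X 0).obj ≫ h = h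
    rw [id_whiskerRight, Category.id_comp]
  map_comp {Z Z' Z''} x x' := by
    refine ModuleCat.hom_ext (bar_hom_ext fun X f h => ?_)
    change Z.unop ⊗ G.obj (X 0).obj ⟶ (X (Fin.last n)).obj at h
    refine (barMap_twistedHomMap k (tensorTwist G (x'.unop ≫ x.unop)) X f h).trans (Eq.symm ?_)
    refine (congrArg (barMap (twistedHomMap k (tensorTwist G x'.unop)) n)
      (barMap_twistedHomMap k (tensorTwist G x.unop) X f h)).trans
      ((barMap_twistedHomMap k (tensorTwist G x'.unop) X f _).trans
        (congrArg (barElt (twistedHom k (G ⋙ tensorLeft Z''.unop)) X f) ?_))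
    change x'.unop ▷ G.obj (X 0).obj ≫ x.unop ▷ G.obj (X 0).obj ≫ h =
      (x'.unop ≫ x.unop) ▷ G.obj (X 0).obj ≫ h
    rw [comp_whiskerRight_assoc]

variable (G : C ⥤ C)

/-- The elements of the presheaf of bar constructions. -/
def barTensor {n : ℕ} (X : Fin (n + 1) → Proj C) (f : ∀ i : Fin n, X i.succ ⟶ X i.castSucc) {Z : C}
    (h : Z ⊗ G.obj (X 0).obj ⟶ (X (Fin.last n)).obj) : (barPresheaf k G n).obj (op Z) :=
  barElt (twistedHom k (G ⋙ tensorLeft Z)) X f h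

variable {G}

omit [MonoidalPreadditive C] [MonoidalLinear k C] in
theorem barPresheaf_map_barTensor {n : ℕ} (X : Fin (n + 1) → Proj C)
    (f : ∀ i : Fin n, X i.succ ⟶ X i.castSucc) {Z Z' : C}
    (h : Z ⊗ G.obj (X 0).obj ⟶ (X (Fin.last n)).obj) (x : Z' ⟶ Z) :
    ((barPresheaf k G n).map x.op).hom (barTensor G X f h) =
      barTensor G X f (x ▷ G.obj (X 0).obj ≫ h) :=
  barMap_twistedHomMap k (tensorTwist G x) X f h

omit [MonoidalPreadditive C] [MonoidalLinear k C] in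
theorem barPresheaf_hom_ext {n : ℕ} {Z : C} {M : ModuleCat.{max u v w} k}
    {a b : (barPresheaf k G n).obj (op Z) ⟶ M}
    (H : ∀ X f (h : Z ⊗ G.obj (X 0).obj ⟶ (X (Fin.last n)).obj),
      a.hom (barTensor G X f h) = b.hom (barTensor G X f h)) : a = b :=
  ModuleCat.hom_ext (bar_hom_ext fun X f h => H X f h)

theorem isLinearPresheaf_barPresheaf (n : ℕ) : IsLinearPresheaf (barPresheaf k G n) where
  map_add {Z' Z} x x' := by
    refine barPresheaf_hom_ext fun X f h => ?_
    refine (barPresheaf_map_barTensor X f h (x + x')).trans (Eq.trans ?_ (congrArg₂ (· + ·)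
      (barPresheaf_map_barTensor X f h x) (barPresheaf_map_barTensor X f h x')).symm)
    rw [MonoidalPreadditive.add_whiskerRight, Preadditive.add_comp]
    exact barElt_add _ X f _ _
  map_smul {Z' Z} r x := by
    refine barPresheaf_hom_ext fun X f h => ?_
    refine (barPresheaf_map_barTensor X f h (r • x)).trans (Eq.trans ?_ (congrArg
      (fun z : (barPresheaf k G n).obj (op Z') => r • z) (barPresheaf_map_barTensor X f h x)).symm)
    rw [MonoidalLinear.smul_whiskerRight, Linear.smul_comp]
    exact barElt_smul _ X f _ _

section Complex

variable [G.Additive] [G.Linear k]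

variable (k G) in
/-- The differential of the complex of presheaves `Z ↦ ∫_L C(Z ⊗ G(X), X)`. -/
def barPresheafDiff (n : ℕ) : barPresheaf k G (n + 1) ⟶ barPresheaf k G n where
  app Z := ModuleCat.ofHom (barDiff (twistedHom k (G ⋙ tensorLeft Z.unop)) n)
  naturality _ _ x := ModuleCat.hom_ext (LinearMap.ext fun z =>
    (barMap_barDiff (twistedHomMap k (tensorTwist G x.unop)) n z).symm)

variable (k G) in
/-- The complex of presheaves `Z ↦ ∫_L C(Z ⊗ G(X), X)`. -/
def barPresheafComplex : ChainComplex (Cᵒᵖ ⥤ ModuleCat.{max u v w} k) ℕ :=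
  ChainComplex.of (barPresheaf k G) (barPresheafDiff k G) fun n => by
    ext Z z
    exact barDiff_barDiff _ n z

theorem barPresheafComplex_d (n : ℕ) :
    (barPresheafComplex k G).d (n + 1) n = barPresheafDiff k G n :=
  ChainComplex.of_d _ _ _

variable (k) in
/-- The effect of a natural transformation on the presheaves of bar constructions. -/
def barPresheafMap {G G' : C ⥤ C} (α : G' ⟶ G) (n : ℕ) : barPresheaf k G n ⟶ barPresheaf k G' n where
  app Z := ModuleCat.ofHom (barMap (twistedHomMap k (tensorWhisker α Z.unop)) n)
  naturality Z Z' x := by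
    refine barPresheaf_hom_ext fun X f h => ?_
    refine (congrArg (barMap (twistedHomMap k (tensorWhisker α Z'.unop)) n)
      (barMap_twistedHomMap k (tensorTwist G x.unop) X f h)).trans
      ((barMap_twistedHomMap k (tensorWhisker α Z'.unop) X f _).trans ?_)
    refine Eq.trans ?_ (congrArg (barMap (twistedHomMap k (tensorTwist G' x.unop)) n)
      (barMap_twistedHomMap k (tensorWhisker α Z.unop) X f h)).symm
    refine Eq.trans (congrArg (barElt (twistedHom k (G' ⋙ tensorLeft Z'.unop)) X f) ?_)
      (barMap_twistedHomMap k (tensorTwist G' x.unop) X f _).symm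
    exact whisker_exchange_assoc _ _ _

variable (k) in
/-- The effect of a natural transformation on the complexes of presheaves. -/
def barPresheafComplexMap {G' : C ⥤ C} [G'.Additive] [G'.Linear k] (α : G' ⟶ G) :
    barPresheafComplex k G ⟶ barPresheafComplex k G' where
  f n := barPresheafMap k α n
  comm' i n := by
    rintro rfl
    rw [barPresheafComplex_d, barPresheafComplex_d]
    ext Z z
    exact (barMap_barDiff (twistedHomMap k (tensorWhisker α Z.unop)) n z).symm

end Complex

variable [RigidCategory C]

variable (k) in
/-- `curryDual` as a linear map. -/
def curryDualHom (Z W Y : C) : (Z ⊗ W ⟶ Y) →ₗ[k] (Z ⟶ Y ⊗ Wᘁ) where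
  toFun := curryDual
  map_add' := curryDual_add
  map_smul' := curryDual_smul

/-- Vector spaces are projective, so pointwise lifts can be made linear. -/
theorem LinearMap.exists_comp_eq {E M N : Type*} [AddCommGroup E] [Module k E] [AddCommGroup M]
    [Module k M] [AddCommGroup N] [Module k N] (d : M →ₗ[k] N) (g : E →ₗ[k] N)
    (h : ∀ x, ∃ y, d y = g x) : ∃ s : E →ₗ[k] M, ∀ x, d (s x) = g x := by
  obtain ⟨s, hs⟩ := Module.projective_lifting_property d.rangeRestrict
    (g.codRestrict (LinearMap.range d) h) d.surjective_rangeRestrict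
  exact ⟨s, fun x => congrArg Subtype.val (LinearMap.congr_fun hs x)⟩

-- By duality the summand of a family X is its space of strings tensored with the presheaf
-- represented by Xₙ ⊗ G(X₀)ᘁ, a projective object; the Yoneda argument applies with vector space
-- coefficients.
open Classical in
theorem isRelativelyProjective_barPresheaf (n : ℕ) :
    IsRelativelyProjective (barPresheaf k G n) := by
  intro L L' hL p f hf
  let W : (Fin (n + 1) → Proj C) → C := fun X => (X (Fin.last n)).obj ⊗ (G.obj (X 0).obj)ᘁ
  have hW : ∀ X, Projective (W X) := fun X => by
    have : Projective (X (Fin.last n)).obj := (X (Fin.last n)).property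
    exact projective_tensor _ _
  -- The morphism e X is the universal element: every h is its pullback along `curryDual h`.
  choose e he using fun X : Fin (n + 1) → Proj C =>
    exists_curryDual_eq (W := G.obj (X 0).obj) (Y := (X (Fin.last n)).obj) (𝟙 (W X))
  -- Lifting the universal element has to be done linearly in the string g, not string by string.
  have hs : ∀ X : Fin (n + 1) → Proj C,
      ∃ s : (⨂[k] i : Fin n, (X i.succ ⟶ X i.castSucc)) →ₗ[k] L.obj (op (W X)),
        ∀ g, (p.app (op (W X))).hom (s (PiTensorProduct.tprod k g)) =
          (f.app (op (W X))).hom (barTensor G X g (e X)) := fun X => by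
    let F := twistedHom k (G ⋙ tensorLeft (W X))
    let ι : (⨂[k] i : Fin n, (X i.succ ⟶ X i.castSucc)) →ₗ[k] BarSimplices F n :=
      DirectSum.lof k (Fin (n + 1) → Proj C) (fun Y => BarSummand F Y) X ∘ₗ
        (TensorProduct.mk k _ ((F.obj (op (X 0))).obj (X (Fin.last n)))).flip (e X)
    obtain ⟨s, hs⟩ := LinearMap.exists_comp_eq (p.app (op (W X))).hom
      ((f.app (op (W X))).hom ∘ₗ ι) fun x => hf (W X) (ι x)
    exact ⟨s, fun g => hs _⟩
  choose s hs using hs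
  let φ : ∀ Z : C, BarSimplices (twistedHom k (G ⋙ tensorLeft Z)) n →ₗ[k] L.obj (op Z) := fun Z =>
    DirectSum.toModule k _ _ fun X => TensorProduct.lift
      (((hL.act Z (W X)).comp (curryDualHom k Z (G.obj (X 0).obj) (X (Fin.last n)).obj)).flip ∘ₗ s X)
  have hφ : ∀ (Z : C) X g (h : Z ⊗ G.obj (X 0).obj ⟶ (X (Fin.last n)).obj),
      φ Z (barTensor G X g h) =
        (L.map (curryDual h).op).hom (s X (PiTensorProduct.tprod k g)) := fun Z X g h =>
    (DirectSum.toModule_lof k X _).trans (TensorProduct.lift.tmul _ _)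
  refine ⟨{ app := fun Z => ModuleCat.ofHom (φ Z.unop), naturality := fun Z Z' x => ?_ }, ?_⟩
  · refine barPresheaf_hom_ext fun X g h => ?_
    refine (congrArg (φ Z'.unop) (barPresheaf_map_barTensor X g h x.unop)).trans
      ((hφ Z'.unop X g _).trans (Eq.trans ?_ (congrArg (L.map x).hom (hφ Z.unop X g h)).symm))
    rw [curryDual_whiskerRight_comp]
    exact congrArg (fun a => a.hom (s X (PiTensorProduct.tprod k g)))
      (L.map_comp (curryDual h).op x)
  · refine NatTrans.ext (funext fun Z => barPresheaf_hom_ext fun X g h => ?_)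
    refine (congrArg (p.app Z).hom (hφ Z.unop X g h)).trans ?_
    have h1 := congrArg (fun a => a.hom (s X (PiTensorProduct.tprod k g)))
      (p.naturality (curryDual h).op)
    have h2 := congrArg (fun a => a.hom (barTensor G X g (e X))) (f.naturality (curryDual h).op)
    refine h1.trans ((congrArg (L'.map (curryDual h).op).hom (hs X g)).trans (h2.symm.trans ?_))
    refine congrArg (f.app Z).hom ((barPresheaf_map_barTensor X g (e X) (curryDual h)).trans
      (congrArg (barTensor G X g) (curryDual_injective ?_)))
    rw [curryDual_whiskerRight_comp, he, Category.comp_id]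

end BarPresheaf

/-! ### The comparison of the bar construction with projective resolutions of the coend -/

section Resolutions

variable {k : Type w} [Field k] {C : Type u} [Category.{v} C] [Abelian C] [Linear k C]
  [MonoidalCategory C] [MonoidalPreadditive C] [MonoidalLinear k C] [RigidCategory C]
  {G : C ⥤ C}

theorem coendAug_barTensor (c : Cowedge (tensorTwistedDual G)) (X : Fin 1 → Proj C)
    (f : ∀ i : Fin 0, X i.succ ⟶ X i.castSucc) {Z : C}
    (h : Z ⊗ G.obj (X 0).obj ⟶ (X (Fin.last 0)).obj) :
    coendAug k c Z (barTensor G X f h) = ULift.up (curryDual (Y := (X 0).obj) h ≫ c.π (X 0).obj) :=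
  barAug_barElt _ X f _

variable (k) in
/-- The augmentation of the complex of presheaves `Z ↦ ∫_L C(Z ⊗ G(X), X)`. -/
def barPresheafAug (c : Cowedge (tensorTwistedDual G)) :
    barPresheaf k G 0 ⟶ (homPresheaf k).obj c.pt where
  app Z := ModuleCat.ofHom (coendAug k c Z.unop)
  naturality Z Z' x := by
    refine barPresheaf_hom_ext fun X f h => ?_
    refine (congrArg (coendAug k c Z'.unop) (barPresheaf_map_barTensor X f h x.unop)).trans
      ((coendAug_barTensor c X f _).trans (Eq.symm ((congrArg (((homPresheaf k).obj c.pt).map x).hom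
        (coendAug_barTensor c X f h)).trans (congrArg ULift.up ?_))))
    exact (Category.assoc _ _ _).symm.trans (congrArg (· ≫ c.π (X 0).obj)
      (curryDual_whiskerRight_comp (Y := (X 0).obj) x.unop h).symm)

variable (k) in
/-- The complex of presheaves represented by a complex. -/
def homPresheafComplex (Q : ChainComplex C ℕ) : ChainComplex (Cᵒᵖ ⥤ ModuleCat.{max u v w} k) ℕ :=
  ((homPresheaf k).mapHomologicalComplex _).obj Q

-- For projective Z the functor C(Z, -) is exact, so it carries the resolution to a resolution.
omit [MonoidalCategory C] [MonoidalPreadditive C] [MonoidalLinear k C] [RigidCategory C] in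
theorem ProjectiveResolution.liftsAlong {T : C} (Q : ProjectiveResolution T)
    {W : Cᵒᵖ ⥤ ModuleCat.{max u v w} k} (hW : IsRelativelyProjective W) :
    LiftsAlong W (homPresheafComplex k Q.complex) ((homPresheaf k).map (Q.π.f 0)) := by
  refine hW.liftsAlong (fun n => isLinearPresheaf_homPresheaf _) (fun Z _ x => ?_)
    (fun Z _ x hx => ?_) (fun n Z _ x hx => ?_)
  · exact ⟨ULift.up (Projective.factorThru x.down (Q.π.f 0)),
      congrArg ULift.up (Projective.factorThru_comp x.down (Q.π.f 0))⟩
  · have h := congrArg ULift.down hx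
    exact ⟨ULift.up (Q.exact₀.liftFromProjective x.down h),
      congrArg ULift.up (Q.exact₀.liftFromProjective_comp x.down h)⟩
  · have h := congrArg ULift.down hx
    exact ⟨ULift.up ((Q.exact_succ n).liftFromProjective x.down h),
      congrArg ULift.up ((Q.exact_succ n).liftFromProjective_comp x.down h)⟩

variable [G.Additive] [G.Linear k]

theorem barPresheafComplex_d_comp_aug (c : Cowedge (tensorTwistedDual G)) :
    (barPresheafComplex k G).d 1 0 ≫ barPresheafAug k c = 0 := by
  rw [barPresheafComplex_d]
  ext Z z
  exact coendAug_barDiff c Z.unop z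

/-- For projective Z the functor Z ⊗ G(-) is exact with projective values. Positive degrees are then
exact by splitness, the lowest ones by the presentation of the coend. -/
theorem liftsAlong_barPresheafComplex [IsAlgClosed k] [IsFiniteLinearCategory k C]
    [PreservesFiniteLimits G] [PreservesFiniteColimits G] (c : Cowedge (tensorTwistedDual G))
    (hc : IsColimit c) {W : Cᵒᵖ ⥤ ModuleCat.{max u v w} k} (hW : IsRelativelyProjective W) :
    LiftsAlong W (barPresheafComplex k G) (barPresheafAug k c) := by
  refine hW.liftsAlong isLinearPresheaf_barPresheaf (fun Z _ x => ?_)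
    (fun Z _ x hx => ?_) (fun n Z _ x hx => ?_)
  · exact coendAug_surjective c hc Z x.down
  · rw [barPresheafComplex_d]
    exact exists_barDiff_eq_of_coendAug c hc Z x hx
  · rw [barPresheafComplex_d] at hx ⊢
    exact (isSplitBimodule_twistedHom k (G ⋙ tensorLeft Z)
      (fun X => projective_tensor Z (G.obj X))).exists_barDiff_eq n x hx

variable (G) in
/-- The unit isomorphism `𝟙_ C ⊗ G(X) ≅ G(X)`. -/
def unitTwist : G ⋙ tensorLeft (𝟙_ C) ≅ G :=
  NatIso.ofComponents (fun X => λ_ (G.obj X)) fun f => leftUnitor_naturality (G.map f)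

variable (k) in
/-- Evaluation at the unit object, for complexes of presheaves. -/
abbrev evalUnit : ChainComplex (Cᵒᵖ ⥤ ModuleCat.{max u v w} k) ℕ ⥤
    ChainComplex (ModuleCat.{max u v w} k) ℕ :=
  ((evaluation Cᵒᵖ (ModuleCat.{max u v w} k)).obj (op (𝟙_ C))).mapHomologicalComplex _

variable (k G) in
/-- The identification of `∫_L C(G(X), X)` with the value of the complex of presheaves
`Z ↦ ∫_L C(Z ⊗ G(X), X)` at the unit object. -/
def twistedHochschildUnit :
    twistedHochschildComplex k G ⟶ (evalUnit k).obj (barPresheafComplex k G) where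
  f n := ModuleCat.ofHom (barMap (twistedHomMap k (unitTwist G).hom) n)
  comm' i n := by
    rintro rfl
    have h : ((evalUnit k).obj (barPresheafComplex k G)).d (n + 1) n =
        ModuleCat.ofHom (barDiff (twistedHom k (G ⋙ tensorLeft (𝟙_ C))) n) :=
      congrArg (fun a => a.app (op (𝟙_ C))) (barPresheafComplex_d (k := k) (G := G) n)
    have h' : (twistedHochschildComplex k G).d (n + 1) n = ModuleCat.ofHom (barDiff _ n) :=
      derivedCoend_d _ n
    rw [h, h']
    ext z
    exact (barMap_barDiff (twistedHomMap k (unitTwist G).hom) n z).symm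

instance : IsIso (twistedHochschildUnit k G) := by
  have : ∀ n, IsIso ((twistedHochschildUnit k G).f n) := fun n => by
    refine ⟨ModuleCat.ofHom (barMap (twistedHomMap k (unitTwist G).inv) n), ?_, ?_⟩
    · refine ModuleCat.hom_ext (bar_hom_ext fun X f h => ?_)
      change G.obj (X 0).obj ⟶ (X (Fin.last n)).obj at h
      refine (congrArg (barMap (twistedHomMap k (unitTwist G).inv) n)
        (barMap_twistedHomMap k (unitTwist G).hom X f h)).trans
          ((barMap_twistedHomMap k (unitTwist G).inv X f _).trans
            (congrArg (barElt (twistedHom k G) X f) ?_))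
      exact (unitTwist G).inv_hom_id_app_assoc (X 0).obj h
    · refine ModuleCat.hom_ext (bar_hom_ext fun X f h => ?_)
      change 𝟙_ C ⊗ G.obj (X 0).obj ⟶ (X (Fin.last n)).obj at h
      refine (congrArg (barMap (twistedHomMap k (unitTwist G).hom) n)
        (barMap_twistedHomMap k (unitTwist G).inv X f h)).trans
          ((barMap_twistedHomMap k (unitTwist G).hom X f _).trans
            (congrArg (barElt (twistedHom k (G ⋙ tensorLeft (𝟙_ C))) X f) ?_))
      exact (unitTwist G).hom_inv_id_app_assoc (X 0).obj h
  exact HomologicalComplex.Hom.isIso_of_components _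

omit [RigidCategory C] in
theorem twistedHochschildUnit_naturality {G' : C ⥤ C} [G'.Additive] [G'.Linear k] (α : G' ⟶ G) :
    twistedHochschildUnit k G ≫ (evalUnit k).map (barPresheafComplexMap k α) =
      twistedHochschildMap k α ≫ twistedHochschildUnit k G' := by
  refine HomologicalComplex.hom_ext _ _ fun n => ModuleCat.hom_ext (bar_hom_ext fun X f h => ?_)
  change G.obj (X 0).obj ⟶ (X (Fin.last n)).obj at h
  refine (congrArg (barMap (twistedHomMap k (tensorWhisker α (𝟙_ C))) n)
    (barMap_twistedHomMap k (unitTwist G).hom X f h)).trans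
      ((barMap_twistedHomMap k (tensorWhisker α (𝟙_ C)) X f _).trans (Eq.symm ?_))
  refine (congrArg (barMap (twistedHomMap k (unitTwist G').hom) n)
    (barMap_twistedHomMap k α X f h)).trans
      ((barMap_twistedHomMap k (unitTwist G').hom X f _).trans
        (congrArg (barElt (twistedHom k (G' ⋙ tensorLeft (𝟙_ C))) X f) ?_))
  exact (leftUnitor_naturality_assoc (α.app (X 0).obj) h).symm

/-- The compatibility of a with α matches precomposition by α because dualizing turns Z ◁ α into
whiskering with αᘁ. -/
theorem barPresheafComplexMap_comp_aug {G' : C ⥤ C} [G'.Additive] [G'.Linear k] (α : G' ⟶ G)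
    (c : Cowedge (tensorTwistedDual G)) (c' : Cowedge (tensorTwistedDual G')) (a : c.pt ⟶ c'.pt)
    (ha : ∀ X : C, c.π X ≫ a = (X ◁ (α.app X)ᘁ) ≫ c'.π X) :
    (barPresheafComplexMap k α).f 0 ≫ barPresheafAug k c' =
      barPresheafAug k c ≫ (homPresheaf k).map a := by
  refine NatTrans.ext (funext fun Z => barPresheaf_hom_ext fun X f h => ?_)
  refine (congrArg (coendAug k c' Z.unop)
    (barMap_twistedHomMap k (tensorWhisker α Z.unop) X f h)).trans
      ((coendAug_barTensor c' X f _).trans (Eq.symm ((congrArg (((homPresheaf k).map a).app Z).hom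
        (coendAug_barTensor c X f h)).trans (congrArg ULift.up ?_))))
  refine (Category.assoc _ _ _).trans ((congrArg _ (ha (X 0).obj)).trans ?_)
  exact (Category.assoc _ _ _).symm.trans (congrArg (· ≫ c'.π (X 0).obj)
    (curryDual_whiskerLeft_comp (Y := (X 0).obj) (α.app (X 0).obj) h).symm)

end Resolutions

/-! ### Homotopy equivalence of the two relative resolutions -/

section Comparison

variable {k : Type w} [Field k] [IsAlgClosed k] {C : Type u} [Category.{v} C] [Abelian C]
  [Linear k C] [MonoidalCategory C] [MonoidalPreadditive C] [MonoidalLinear k C] [RigidCategory C]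
  [IsFiniteLinearCategory k C]

omit [IsAlgClosed k] [MonoidalPreadditive C] [MonoidalLinear k C] [IsFiniteLinearCategory k C] in
theorem liftsAlong_homPresheafComplex (R : CoendResolution k C)
    {L : ChainComplex (Cᵒᵖ ⥤ ModuleCat.{max u v w} k) ℕ} {T : Cᵒᵖ ⥤ ModuleCat.{max u v w} k}
    {ε : L.X 0 ⟶ T}
    (H : ∀ W : Cᵒᵖ ⥤ ModuleCat.{max u v w} k, IsRelativelyProjective W → LiftsAlong W L ε) (n : ℕ) :
    LiftsAlong ((homPresheafComplex k R.resolution.complex).X n) L ε := by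
  have := R.resolution.projective n
  exact H _ (isRelativelyProjective_homPresheaf _)

theorem exists_presheaf_comparison (R : CoendResolution k C) :
    ∃ e : HomotopyEquiv (barPresheafComplex k R.G) (homPresheafComplex k R.resolution.complex),
      e.hom.f 0 ≫ (homPresheaf k).map (R.resolution.π.f 0) = barPresheafAug k R.cowedge := by
  have h1 : ∀ W : Cᵒᵖ ⥤ ModuleCat.{max u v w} k, IsRelativelyProjective W →
      LiftsAlong W (barPresheafComplex k R.G) (barPresheafAug k R.cowedge) :=
    fun W hW => liftsAlong_barPresheafComplex R.cowedge R.isColimit hW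
  have h2 : ∀ W : Cᵒᵖ ⥤ ModuleCat.{max u v w} k, IsRelativelyProjective W →
      LiftsAlong W (homPresheafComplex k R.resolution.complex)
        ((homPresheaf k).map (R.resolution.π.f 0)) :=
    fun W hW => ProjectiveResolution.liftsAlong R.resolution hW
  have hb := isRelativelyProjective_barPresheaf (k := k) (G := R.G)
  obtain ⟨φ, hφ⟩ := exists_chainMap (K := barPresheafComplex k R.G) (fun n => h2 _ (hb n))
    (barPresheafAug k R.cowedge) (barPresheafComplex_d_comp_aug R.cowedge)
  obtain ⟨e, rfl⟩ := exists_homotopyEquiv (liftsAlong_homPresheafComplex R h2)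
    (fun n => h1 _ (hb n)) (liftsAlong_homPresheafComplex R h1)
    (by
      refine ((homPresheaf k).map_comp _ _).symm.trans ?_
      rw [R.resolution.complex_d_comp_π_f_zero, Functor.map_zero]
      rfl) φ hφ
  exact ⟨e, hφ⟩

-- Yoneda in degree zero: l is the value of φ on the universal element over P ⊗ G(P)ᘁ, and the dual
-- of h pulls this element back to h.
omit [IsAlgClosed k] [IsFiniteLinearCategory k C] in
theorem exists_lift_of_presheaf_comparison {G : C ⥤ C} {c : Cowedge (tensorTwistedDual G)}
    {Q₀ : C} {π : Q₀ ⟶ c.pt} (φ : barPresheaf k G 0 ⟶ (homPresheaf k).obj Q₀)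
    (hφ : φ ≫ (homPresheaf k).map π = barPresheafAug k c) (P : Proj C) :
    ∃ l : P.obj ⊗ (G.obj P.obj)ᘁ ⟶ Q₀, l ≫ π = c.π P.obj ∧ ∀ h : G.obj P.obj ⟶ P.obj,
      (φ.app (op (𝟙_ C))).hom (barTensor G (fun _ => P) (fun i => i.elim0)
        ((λ_ (G.obj P.obj)).hom ≫ h)) = ULift.up (homToTensorDual h ≫ l) := by
  obtain ⟨e, he⟩ := exists_curryDual_eq (𝟙 (P.obj ⊗ (G.obj P.obj)ᘁ))
  let b : (barPresheaf k G 0).obj (op (P.obj ⊗ (G.obj P.obj)ᘁ)) :=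
    barTensor G (fun _ => P) (fun i => i.elim0) e
  let l : ULift.{max u w} (P.obj ⊗ (G.obj P.obj)ᘁ ⟶ Q₀) := (φ.app (op _)).hom b
  refine ⟨l.down, ?_, fun h => ?_⟩
  · have h1 := congrArg (fun a => (a.app (op (P.obj ⊗ (G.obj P.obj)ᘁ))).hom b) hφ
    refine (congrArg ULift.down h1).trans ((congrArg ULift.down
      (coendAug_barTensor c (fun _ => P) (fun i => i.elim0) e)).trans ?_)
    exact (congrArg (· ≫ c.π P.obj) he).trans (Category.id_comp _)
  · have h1 := congrArg (fun a => a.hom b) (φ.naturality (homToTensorDual h).op)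
    refine Eq.trans (congrArg (φ.app (op (𝟙_ C))).hom (Eq.symm ?_)) h1
    refine (barPresheaf_map_barTensor (fun _ => P) (fun i => i.elim0) e (homToTensorDual h)).trans
      (congrArg (barTensor G (fun _ => P) (fun i => i.elim0)) (curryDual_injective ?_))
    rw [curryDual_whiskerRight_comp, he, Category.comp_id, curryDual_leftUnitor_comp]

end Comparison

end

/-! ### The theorem, by evaluation at the unit object -/

theorem theorem3p9 {k : Type w} [Field k] [IsAlgClosed k] {C : Type u} [Category.{v} C]
    [Abelian C] [Linear k C] [MonoidalCategory C] [MonoidalPreadditive C] [MonoidalLinear k C]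
    [RigidCategory C] [Simple (𝟙_ C)] [IsFiniteLinearCategory k C] [PivotalCategory C] :
    -- the coends exist
    (∀ (G : C ⥤ C) [G.Additive] [G.Linear k] [PreservesFiniteLimits G]
      [PreservesFiniteColimits G], HasCoend (tensorTwistedDual G)) ∧
    -- for all exact `G` and all projective resolutions of the coend there is an equivalence
    (∃ Φ : ∀ R : CoendResolution k C,
        twistedHochschildComplex k R.G ⟶ unitHomComplex k R.resolution.complex,
      (∀ R : CoendResolution k C, QuasiIso (Φ R)) ∧
      -- which in degree `0` is given by duality and by lifts of the maps to the coend
      (∀ (R : CoendResolution k C) (P : Proj C),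
        ∃ l : P.obj ⊗ (R.G.obj P.obj)ᘁ ⟶ R.resolution.complex.X 0,
          l ≫ R.resolution.π.f 0 = R.cowedge.π P.obj ∧
          ∀ h : R.G.obj P.obj ⟶ P.obj,
            (Φ R).f 0 (twistedHochschildZero k R.G P h) =
              unitHomZero k R.resolution.complex (homToTensorDual h ≫ l)) ∧
      -- and which is natural up to homotopy in the functor, the coend and its resolution
      (∀ (R R' : CoendResolution k C) (α : R'.G ⟶ R.G) (a : R.cowedge.pt ⟶ R'.cowedge.pt)
        (φ : R.resolution.complex ⟶ R'.resolution.complex),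
        (∀ X : C, R.cowedge.π X ≫ a = (X ◁ (α.app X)ᘁ) ≫ R'.cowedge.π X) →
        φ ≫ R'.resolution.π = R.resolution.π ≫ (ChainComplex.single₀ C).map a →
        Nonempty (Homotopy (Φ R ≫ unitHomMap k φ) (twistedHochschildMap k α ≫ Φ R')))) ∧
    -- in particular, the Hochschild complex is described by the canonical coend
    (HasCoend (tensorDual C) ∧
      ∀ (c : Cowedge (tensorDual C)) (_ : IsColimit c) (Q : ProjectiveResolution c.pt),
        ∃ Ψ : hochschildComplex k C ⟶ unitHomComplex k Q.complex, QuasiIso Ψ) := by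
  have hcoend : ∀ (G : C ⥤ C) [G.Additive] [G.Linear k] [PreservesFiniteLimits G]
      [PreservesFiniteColimits G], HasCoend (tensorTwistedDual G) :=
    fun G _ _ _ _ => hasCoend_tensorTwistedDual G k
  obtain ⟨Φ, hΦ, hΦ'⟩ : ∃ Φ : ∀ R : CoendResolution k C,
      twistedHochschildComplex k R.G ⟶ unitHomComplex k R.resolution.complex,
      (∀ R : CoendResolution k C, QuasiIso (Φ R)) ∧
      (∀ (R : CoendResolution k C) (P : Proj C),
        ∃ l : P.obj ⊗ (R.G.obj P.obj)ᘁ ⟶ R.resolution.complex.X 0,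
          l ≫ R.resolution.π.f 0 = R.cowedge.π P.obj ∧
          ∀ h : R.G.obj P.obj ⟶ P.obj,
            (Φ R).f 0 (twistedHochschildZero k R.G P h) =
              unitHomZero k R.resolution.complex (homToTensorDual h ≫ l)) ∧
      (∀ (R R' : CoendResolution k C) (α : R'.G ⟶ R.G) (a : R.cowedge.pt ⟶ R'.cowedge.pt)
        (φ : R.resolution.complex ⟶ R'.resolution.complex),
        (∀ X : C, R.cowedge.π X ≫ a = (X ◁ (α.app X)ᘁ) ≫ R'.cowedge.π X) →
        φ ≫ R'.resolution.π = R.resolution.π ≫ (ChainComplex.single₀ C).map a →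
        Nonempty (Homotopy (Φ R ≫ unitHomMap k φ) (twistedHochschildMap k α ≫ Φ R'))) := by
    choose e he using fun R : CoendResolution k C => exists_presheaf_comparison R
    refine ⟨fun R => twistedHochschildUnit k R.G ≫ (evalUnit k).map (e R).hom, fun R => ?_,
      fun R P => ?_, fun R R' α a φ ha hφ => ?_⟩
    -- The unit need not be projective, so exactness over projectives says nothing here; the
    -- homotopy equivalence is what passes to the value at the unit.
    · have h1 : QuasiIso ((evalUnit k).map (e R).hom) :=
        (Functor.mapHomotopyEquiv _ (e R)).quasiIso_hom
      have h2 : QuasiIso (twistedHochschildUnit k R.G ≫ (evalUnit k).map (e R).hom) :=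
        quasiIso_comp _ _
      exact h2
    · obtain ⟨l, hl, hl'⟩ := exists_lift_of_presheaf_comparison ((e R).hom.f 0) (he R) P
      refine ⟨l, hl, fun h => Eq.trans (congrArg (((e R).hom.f 0).app (op (𝟙_ C))).hom ?_) (hl' h)⟩
      exact barMap_twistedHomMap k (unitTwist R.G).hom (fun _ => P) (fun i => i.elim0) h
    · let φ' : homPresheafComplex k R.resolution.complex ⟶ homPresheafComplex k R'.resolution.complex :=
        ((homPresheaf k).mapHomologicalComplex _).map φ
      have hφ0 : φ.f 0 ≫ R'.resolution.π.f 0 = R.resolution.π.f 0 ≫ a := by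
        have h := congrArg (fun a => HomologicalComplex.Hom.f a 0) hφ
        refine h.trans (congrArg (R.resolution.π.f 0 ≫ ·) ?_)
        exact ChainComplex.single₀_map_f_zero a
      have hb := isRelativelyProjective_barPresheaf (k := k) (G := R.G)
      -- The two sides of the square are compared as maps of presheaf complexes: both lift the
      -- composite of the augmentation of the bar complex with a, hence are homotopic before
      -- evaluation.
      obtain ⟨H⟩ := nonempty_homotopy (fun n =>
          ProjectiveResolution.liftsAlong R'.resolution (hb n))
        ((e R).hom ≫ φ') (barPresheafComplexMap k α ≫ (e R').hom) (by
          have h1 : φ'.f 0 ≫ (homPresheaf k).map (R'.resolution.π.f 0) =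
              (homPresheaf k).map (R.resolution.π.f 0) ≫ (homPresheaf k).map a :=
            ((homPresheaf k).map_comp _ _).symm.trans ((congrArg _ hφ0).trans
              ((homPresheaf k).map_comp _ _))
          refine (Category.assoc _ _ _).trans (Eq.trans ?_ (Category.assoc _ _ _).symm)
          refine (congrArg ((e R).hom.f 0 ≫ ·) h1).trans (Eq.trans ?_
            (congrArg ((barPresheafComplexMap k α).f 0 ≫ ·) (he R')).symm)
          refine Eq.trans ?_ (barPresheafComplexMap_comp_aug α R.cowedge R'.cowedge a ha).symm
          exact (Category.assoc _ _ _).symm.trans (congrArg (· ≫ (homPresheaf k).map a) (he R)))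
      have H' := (((evaluation Cᵒᵖ (ModuleCat.{max u v w} k)).obj (op (𝟙_ C))).mapHomotopy
        H).compLeft (twistedHochschildUnit k R.G)
      refine ⟨(Homotopy.ofEq ?_).trans (H'.trans (Homotopy.ofEq ?_))⟩
      · exact (Category.assoc _ _ _).trans (congrArg (twistedHochschildUnit k R.G ≫ ·)
          ((evalUnit k).map_comp (e R).hom φ').symm)
      · refine (congrArg (twistedHochschildUnit k R.G ≫ ·) ((evalUnit k).map_comp _ _)).trans ?_
        exact (Category.assoc _ _ _).symm.trans ((congrArg (· ≫ (evalUnit k).map (e R').hom)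
          (twistedHochschildUnit_naturality α)).trans (Category.assoc _ _ _))
  refine ⟨hcoend, ⟨Φ, hΦ, hΦ'⟩, hcoend (𝟭 C), fun c hc Q => ?_⟩
  -- For the identity functor the twisted bifunctor and bimodule unfold to the untwisted ones, so
  -- this is the case G = 𝟭 of the equivalence.
  exact ⟨_, hΦ { G := 𝟭 C, cowedge := c, isColimit := hc, resolution := Q }⟩
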